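/- **Setting.** For $t>0$ and $x\in\mathbb R^2$ let $G_t(x)=\frac1{2\pi t}e^{-|x|^2/(2t)}$ and, for $\mathfrak m\in\mathbb R$, $G^{\mathfrak m}_t=e^{\mathfrak m t}G_t$; $*$ is spatial convolution and $G^{\mathfrak m}_0*g=g$. Let $\eta$ be a spatial white noise on $\mathbb R^2$ on a probability space $(\Omega,\mathcal F,\mathbb P)$, that is, a random tempered distribution such that $\langle\eta,\varphi\rangle$ is centred Gaussian with variance $\int\varphi^2$ for every real Schwartz function $\varphi$. Let $\varepsilon\in(0,1)$ and $\eta_\varepsilon=G_{\varepsilon^2}*\eta$. For $f=f(t,u)$, $t>0$, $u\in\mathbb R$, write $f'=\partial_uf$ and define $F$ by $f(t,u)=t^{-3/2}F(t,t^{1/2}u)$. We say $f\in\bar S_1(L_1,L_2)$ ($L_1,L_2\ge0$) if $F$ is continuous on $(0,\infty)\times\mathbb R$ and for each $t>0$ the function $F(t,\cdot)$ is odd and differentiable with $\mathrm{Lip}(F(t,\cdot))\le L_1$ and $\mathrm{Lip}(F'(t,\cdot))\le L_2$. We say $f\in\bar S_2(\gamma_1,\gamma_2,\ell_1,\ell_2)$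 ($\gamma_1\ge2$, $\gamma_2\ge1$, $\ell_1,\ell_2\ge0$) if $F$ is continuous on $(0,\infty)\times\mathbb R$ and for each $t>0$ the function $F(t,\cdot)$ is odd, differentiable and non-decreasing with locally Lipschitz derivative, and $\mathrm{Lip}(F(t,\cdot)|_{[0,u]})\le\ell_1(1+u^{\gamma_1})$, $\mathrm{Lip}(F'(t,\cdot)|_{[0,u]})\le\ell_2(1+u^{\gamma_2})$ for all $u\ge0$. Finally $f\in\bar S$ if $f=f_1+f_2$ with $f_1\in\bar S_1(L_1,L_2)$ and $f_2\in\bar S_2(\gamma_1,\gamma_2,\ell_1,\ell_2)$ for some values of the parameters. A *solution* of the McKean–Vlasov equation $$\partial_tv=\tfrac12\Delta v+\mathfrak m v-\tfrac1{\log\varepsilon^{-1}}\mathbb E[f'(t+\varepsilon^2,v)]\,v,\qquad v(0,\cdot)=\eta_\varepsilon,\tag{1}$$ is a random field $v(t,x)$, $t\ge0$, $x\in\mathbb R^2$, such that $f'(t+\varepsilon^2,v(t,x))$ is integrable for all $t\ge 0$ and $x$ and, almost surely: $v$ is continuous on $[0,\infty)\times\mathbb R^2$; on $(0,\infty)\times\mathbb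 R^2$ it is $C^1$, and $C^\infty$ in $x$ with all spatial derivatives jointly continuous in $(t,x)$; (1) holds for all $t>0$ and $x$; and, for every $T$, the functions $\sup_{t\in[0,T]}|v(t,\cdot)|$ and $\sup_{t\in[0,T]}\mathbb E|f'(t+\varepsilon^2,v(t,\cdot))|$ are bounded by $Ce^{\lambda|x|}$ for some $C$ and $\lambda>0$. **Lemma.** Let $f\in\bar S$ and $\mathfrak m\in\mathbb R$. Then $f'(t+\varepsilon^2,s\,G^{\mathfrak m}_t*\eta_\varepsilon(x))$ is integrable for all $t\ge0$, $s\in\mathbb R$, $x\in\mathbb R^2$, and there is a function $\sigma_\varepsilon:[0,\infty)\to(0,\infty)$ such that for every $x\in\mathbb R^2$ $$\dot\sigma_\varepsilon(t)=-\tfrac1{\log\varepsilon^{-1}}\mathbb E\big[f'(t+\varepsilon^2,\sigma_\varepsilon(t)\,G^{\mathfrak m}_t*\eta_\varepsilon(x))\big]\sigma_\varepsilon(t)\quad(t\ge0),\qquad\sigma_\varepsilon(0)=1;\tag{2}$$ for every $x$ and $T$, any solution of (2) on $[0,T]$ agrees there with $\sigma_\varepsilon$. If $f=f_1+f_2$ with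 $f_1\in\bar S_1(L_1,L_2)$ and $f_2\in\bar S_2(\gamma_1,\gamma_2,\ell_1,\ell_2)$, then for all $t\ge0$ $$0<\sigma_\varepsilon(t)\le\exp\Big\{\frac{L_1}{\log\varepsilon^{-1}}\int_0^t\frac{ds}{s+\varepsilon^2}\Big\},$$ and hence $\sigma_\varepsilon(t)\le e^{3L_1}$ whenever $t+\varepsilon^2\le\varepsilon^{-1}$. The random field $$v_\varepsilon(t,x)=\sigma_\varepsilon(t)\,G^{\mathfrak m}_t*\eta_\varepsilon(x)$$ is a solution of (1), and every solution of (1) almost surely coincides with it on $[0,\infty)\times\mathbb R^2$. If moreover $f$ has the self-similar form $f(t,u)=t^{-3/2}F(t^{1/2}u)$, then almost surely $v_\varepsilon$ is $C^\infty$ on $(0,\infty)\times\mathbb R^2$. -/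

import Mathlib

open MeasureTheory ProbabilityTheory
open scoped SchwartzMap Laplacian

noncomputable section

namespace McKeanVlasov

/-- The plane `ℝ²` with its Euclidean norm. -/
abbrev Plane : Type := EuclideanSpace ℝ (Fin 2)

/-! ### Heat kernels -/

/-- The standard heat kernel `G_t(x) = (2πt)⁻¹ exp(-|x|²/(2t))`, for `t > 0`. -/
def heatKernel (t : ℝ) (x : Plane) : ℝ :=
  1 / (2 * Real.pi * t) * Real.exp (-‖x‖ ^ 2 / (2 * t))

/-- The massive heat kernel `G^m_t(x) = e^{mt} G_t(x)`, for `t > 0`. -/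
def massHeatKernel (m t : ℝ) (x : Plane) : ℝ :=
  Real.exp (m * t) * heatKernel t x

/-- The spatial convolution `G^m_t * g`; at `t = 0` the kernel `G^m_0` is the Dirac mass. -/
def heatFlow (m t : ℝ) (g : Plane → ℝ) (x : Plane) : ℝ :=
  if t = 0 then g x else ∫ y, massHeatKernel m t (x - y) * g y

lemma contDiff_heatKernel (t : ℝ) : ContDiff ℝ (⊤ : ℕ∞) (heatKernel t) := by
  unfold heatKernel
  exact contDiff_const.mul (Real.contDiff_exp.comp (((contDiff_norm_sq ℝ).neg).div_const _))

lemma one_add_pow_mul_exp_le {a : ℝ} (ha : 0 < a) (N : ℕ) {r : ℝ} (hr : 0 ≤ r) :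
    (1 + r) ^ N * Real.exp (-(a * r ^ 2)) ≤ (2 / a) ^ N * N.factorial * Real.exp a := by
  have h1 : (1 + r) ^ N ≤ (2 * (1 + r ^ 2)) ^ N := by
    apply pow_le_pow_left₀ (by positivity)
    nlinarith [sq_nonneg (r - 1)]
  have h2 : (a * (1 + r ^ 2)) ^ N / N.factorial ≤ Real.exp (a * (1 + r ^ 2)) :=
    Real.pow_div_factorial_le_exp _ (by positivity) N
  have h3 : (a * (1 + r ^ 2)) ^ N ≤ Real.exp (a * (1 + r ^ 2)) * N.factorial := by
    rwa [div_le_iff₀ (by positivity)] at h2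
  have h4 : (2 * (1 + r ^ 2)) ^ N = (2 / a) ^ N * (a * (1 + r ^ 2)) ^ N := by
    rw [← mul_pow]; congr 1; field_simp
  have h5 : Real.exp (a * (1 + r ^ 2)) * Real.exp (-(a * r ^ 2)) = Real.exp a := by
    rw [← Real.exp_add]; congr 1; ring
  calc (1 + r) ^ N * Real.exp (-(a * r ^ 2))
      ≤ ((2 / a) ^ N * (Real.exp (a * (1 + r ^ 2)) * N.factorial)) * Real.exp (-(a * r ^ 2)) := by
        apply mul_le_mul_of_nonneg_right _ (Real.exp_nonneg _)
        rw [h4] at h1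
        exact h1.trans (mul_le_mul_of_nonneg_left h3 (by positivity))
    _ = (2 / a) ^ N * N.factorial * (Real.exp (a * (1 + r ^ 2)) * Real.exp (-(a * r ^ 2))) := by
        ring
    _ = _ := by rw [h5]

lemma heatKernel_decay {t : ℝ} (ht : 0 < t) (k n : ℕ) :
    ∃ C : ℝ, ∀ x : Plane, ‖x‖ ^ k * ‖iteratedFDeriv ℝ n (heatKernel t) x‖ ≤ C := by
  set a : ℝ := 1 / (2 * t) with ha_def
  have ha : 0 < a := by positivity
  set q : Plane → ℝ := fun x => -‖x‖ ^ 2 / (2 * t) with hq_def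
  have hq_eq : ∀ x, q x = -(a * ‖x‖ ^ 2) := fun x => by simp only [hq_def, ha_def]; ring
  have hq : Function.HasTemperateGrowth q := by
    have h1 : Function.HasTemperateGrowth (fun x : Plane => ‖x‖ ^ 2) := by fun_prop
    have h2 : q = fun x => (-a) * ‖x‖ ^ 2 := by
      funext x; rw [hq_eq]; ring
    rw [h2]; fun_prop
  have hqs : ContDiff ℝ (⊤ : ℕ∞) q := hq.1
  obtain ⟨K, C, hC0, hC⟩ := hq.norm_iteratedFDeriv_le_uniform n
  set D : Plane → ℝ := fun x => (C + 1) * (1 + ‖x‖) ^ K with hD_def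
  have hD1 : ∀ x, 1 ≤ D x := fun x =>
    one_le_mul_of_one_le_of_one_le (by linarith) (one_le_pow₀ (by linarith [norm_nonneg x]))
  have hcomp : ∀ x, ‖iteratedFDeriv ℝ n (Real.exp ∘ q) x‖
      ≤ n.factorial * Real.exp (q x) * D x ^ n := by
    intro x
    refine norm_iteratedFDeriv_comp_le (N := ((⊤ : ℕ∞) : WithTop ℕ∞)) Real.contDiff_exp hqs
      (by exact_mod_cast le_top) x ?_ ?_
    · intro i _
      rw [norm_iteratedFDeriv_eq_norm_iteratedDeriv, iteratedDeriv_eq_iterate,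
        Real.iter_deriv_exp, Real.norm_eq_abs, abs_of_pos (Real.exp_pos _)]
    · intro i hi1 hin
      refine (hC i hin x).trans ?_
      refine le_trans ?_ (le_self_pow₀ (hD1 x) (by omega))
      exact mul_le_mul_of_nonneg_right (by linarith) (by positivity)
  have hker : heatKernel t = fun x => (1 / (2 * Real.pi * t)) • (Real.exp ∘ q) x := by
    funext x; simp [heatKernel, hq_def]
  have hexp : ContDiff ℝ (⊤ : ℕ∞) (Real.exp ∘ q) := Real.contDiff_exp.comp hqs
  refine ⟨(1 / (2 * Real.pi * t)) * (n.factorial * (C + 1) ^ n) *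
    ((2 / a) ^ (k + K * n) * (k + K * n).factorial * Real.exp a), fun x => ?_⟩
  have h1 : ‖iteratedFDeriv ℝ n (heatKernel t) x‖
      = (1 / (2 * Real.pi * t)) * ‖iteratedFDeriv ℝ n (Real.exp ∘ q) x‖ := by
    rw [hker, iteratedFDeriv_const_smul_apply' ((hexp.of_le (by exact_mod_cast le_top)).contDiffAt),
      norm_smul, Real.norm_eq_abs, abs_of_pos (by positivity)]
  have h2 : ‖x‖ ^ k ≤ (1 + ‖x‖) ^ k :=
    pow_le_pow_left₀ (norm_nonneg x) (by linarith) k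
  have h3 := one_add_pow_mul_exp_le ha (k + K * n) (norm_nonneg x)
  calc ‖x‖ ^ k * ‖iteratedFDeriv ℝ n (heatKernel t) x‖
      ≤ (1 + ‖x‖) ^ k * ((1 / (2 * Real.pi * t)) *
          (n.factorial * Real.exp (q x) * D x ^ n)) := by
        rw [h1]
        exact mul_le_mul h2 (mul_le_mul_of_nonneg_left (hcomp x) (by positivity))
          (by positivity) (by positivity)
    _ = (1 / (2 * Real.pi * t)) * (n.factorial * (C + 1) ^ n) *
          ((1 + ‖x‖) ^ (k + K * n) * Real.exp (-(a * ‖x‖ ^ 2))) := by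
        rw [hq_eq, hD_def]; simp only [mul_pow, ← pow_mul, pow_add]; ring
    _ ≤ _ := mul_le_mul_of_nonneg_left h3 (by positivity)

/-- For `t > 0`, the heat kernel `G_t` as a Schwartz function. -/
def heatKernelSchwartz (t : ℝ) (ht : 0 < t) : 𝓢(Plane, ℝ) where
  toFun := heatKernel t
  smooth' := contDiff_heatKernel t
  decay' := heatKernel_decay ht

/-! ### White noise -/

/-- `η` is a spatial white noise on `ℝ²` under `P`: a random tempered distribution such that for
every real Schwartz function `φ` the pairing `⟨η, φ⟩` is a centred Gaussian random variable with
variance `∫ φ²`. As `η` is linear in `φ`, this makes `φ ↦ ⟨η, φ⟩` a centred Gaussian process with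
covariance `E[⟨η, φ⟩ ⟨η, ψ⟩] = ∫ φ ψ`. -/
def IsWhiteNoise {Ω : Type*} [MeasurableSpace Ω] (P : Measure Ω)
    (η : Ω → 𝓢(Plane, ℝ) →L[ℝ] ℝ) : Prop :=
  ∀ φ : 𝓢(Plane, ℝ),
    HasLaw (fun ω => η ω φ) (gaussianReal 0 (Real.toNNReal (∫ y, φ y ^ 2))) P

/-- The mollification `(G_{ε²} * T)(x) = ⟨T, G_{ε²}(· - x)⟩` of a tempered distribution `T`
(the kernel is even). -/
def mollify (ε : ℝ) (hε : 0 < ε) (T : 𝓢(Plane, ℝ) →L[ℝ] ℝ) (x : Plane) : ℝ :=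
  T (SchwartzMap.compSubConstCLM ℝ x (heatKernelSchwartz (ε ^ 2) (pow_pos hε 2)))

/-! ### Classes of nonlinearities -/

/-- The class `S₁(L₁, L₂)`. -/
structure MemS₁ (L₁ L₂ : ℝ) (F : ℝ → ℝ → ℝ) : Prop where
  L₁_nonneg : 0 ≤ L₁
  L₂_nonneg : 0 ≤ L₂
  continuousOn : ContinuousOn (fun p : ℝ × ℝ => F p.1 p.2) (Set.Ioi 0 ×ˢ Set.univ)
  odd : ∀ t > 0, Function.Odd (F t)
  differentiable : ∀ t > 0, Differentiable ℝ (F t)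
  lipschitz : ∀ t > 0, LipschitzWith L₁.toNNReal (F t)
  lipschitz_deriv : ∀ t > 0, LipschitzWith L₂.toNNReal (deriv (F t))

/-- The class `S₂(γ₁, γ₂, ℓ₁, ℓ₂)`. -/
structure MemS₂ (γ₁ γ₂ l₁ l₂ : ℝ) (F : ℝ → ℝ → ℝ) : Prop where
  two_le_γ₁ : 2 ≤ γ₁
  one_le_γ₂ : 1 ≤ γ₂
  l₁_nonneg : 0 ≤ l₁
  l₂_nonneg : 0 ≤ l₂
  continuousOn : ContinuousOn (fun p : ℝ × ℝ => F p.1 p.2) (Set.Ioi 0 ×ˢ Set.univ)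
  odd : ∀ t > 0, Function.Odd (F t)
  differentiable : ∀ t > 0, Differentiable ℝ (F t)
  monotone : ∀ t > 0, Monotone (F t)
  locallyLipschitz_deriv : ∀ t > 0, LocallyLipschitz (deriv (F t))
  lipschitzOn : ∀ t > 0, ∀ u ≥ 0,
    LipschitzOnWith (Real.toNNReal (l₁ * (1 + u ^ γ₁))) (F t) (Set.Icc 0 u)
  lipschitzOn_deriv : ∀ t > 0, ∀ u ≥ 0,
    LipschitzOnWith (Real.toNNReal (l₂ * (1 + u ^ γ₂))) (deriv (F t)) (Set.Icc 0 u)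

/-- The class `S = S₁ + S₂`. Only positive times matter. -/
def MemS (F : ℝ → ℝ → ℝ) : Prop :=
  ∃ F₁ F₂ : ℝ → ℝ → ℝ, (∃ L₁ L₂, MemS₁ L₁ L₂ F₁) ∧ (∃ γ₁ γ₂ l₁ l₂, MemS₂ γ₁ γ₂ l₁ l₂ F₂) ∧
    ∀ t > 0, ∀ u, F t u = F₁ t u + F₂ t u

/-- The rescaled function `F` with `f(t,u) = t^{-3/2} F(t, t^{1/2} u)` for `t > 0`. -/
def rescale (f : ℝ → ℝ → ℝ) (t u : ℝ) : ℝ :=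
  t ^ (3 / 2 : ℝ) * f t (u / Real.sqrt t)

/-- `f ∈ S̄₁(L₁, L₂)`. -/
def MemSbar₁ (L₁ L₂ : ℝ) (f : ℝ → ℝ → ℝ) : Prop := MemS₁ L₁ L₂ (rescale f)

/-- `f ∈ S̄₂(γ₁, γ₂, ℓ₁, ℓ₂)`. -/
def MemSbar₂ (γ₁ γ₂ l₁ l₂ : ℝ) (f : ℝ → ℝ → ℝ) : Prop := MemS₂ γ₁ γ₂ l₁ l₂ (rescale f)

/-- `f ∈ S̄`. -/
def MemSbar (f : ℝ → ℝ → ℝ) : Prop := MemS (rescale f)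

/-! ### The McKean–Vlasov equation -/

/-- Regularity of classical solutions `v = v(t,x)`: continuous on `[0,∞) × ℝ²`; on `(0,∞) × ℝ²`
continuously differentiable, and infinitely differentiable in `x`, with all spatial derivatives
jointly continuous in `(t,x)`. -/
structure IsRegular (v : ℝ → Plane → ℝ) : Prop where
  continuousOn : ContinuousOn (fun p : ℝ × Plane => v p.1 p.2) (Set.Ici 0 ×ˢ Set.univ)
  contDiffOn_one : ContDiffOn ℝ 1 (fun p : ℝ × Plane => v p.1 p.2) (Set.Ioi 0 ×ˢ Set.univ)
  contDiff_space : ∀ t > 0, ContDiff ℝ (⊤ : ℕ∞) (v t)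
  continuousOn_space : ∀ n : ℕ,
    ContinuousOn (fun p : ℝ × Plane => iteratedFDeriv ℝ n (v p.1) p.2) (Set.Ioi 0 ×ˢ Set.univ)

/-- For every `T`, the function `sup_{t ∈ [0,T]} |g(t,·)|` grows at most exponentially:
`sup_x sup_{t ∈ [0,T]} |g(t,x)| e^{-a|x|} < ∞` for some `a > 0`. -/
def ExpGrowth (g : ℝ → Plane → ℝ) : Prop :=
  ∀ T : ℝ, ∃ a > 0, ∃ C : ℝ, ∀ t ∈ Set.Icc 0 T, ∀ x, |g t x| ≤ C * Real.exp (a * ‖x‖)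

variable {Ω : Type*} [MeasurableSpace Ω]

/-- The random field `v = v(ω,t,x)` is a solution of
`∂_t v = ½ Δv + m v - (log ε⁻¹)⁻¹ E[f'(t+ε², v)] v`, `v(0,·) = g`,
where `f'` is the derivative of `f` in its second argument. -/
structure IsSolution (P : Measure Ω) (m ε : ℝ) (f : ℝ → ℝ → ℝ) (g : Ω → Plane → ℝ)
    (v : Ω → ℝ → Plane → ℝ) : Prop where
  aemeasurable : ∀ t ≥ 0, ∀ x, AEMeasurable (fun ω => v ω t x) P
  regular : ∀ᵐ ω ∂P, IsRegular (v ω)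
  initial : ∀ᵐ ω ∂P, ∀ x, v ω 0 x = g ω x
  integrable : ∀ t ≥ 0, ∀ x, Integrable (fun ω => deriv (f (t + ε ^ 2)) (v ω t x)) P
  equation : ∀ᵐ ω ∂P, ∀ t > 0, ∀ x,
    deriv (fun s => v ω s x) t = 1 / 2 * (Δ (v ω t)) x + m * v ω t x
      - 1 / Real.log ε⁻¹ * (∫ ω', deriv (f (t + ε ^ 2)) (v ω' t x) ∂P) * v ω t x
  growth : ∀ᵐ ω ∂P, ExpGrowth (v ω)
  growth_coeff : ExpGrowth fun t x => ∫ ω, |deriv (f (t + ε ^ 2)) (v ω t x)| ∂P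

/-- `τ` solves, on the time set `I` (an interval containing `0`), the initial value problem
`τ'(t) = -(log ε⁻¹)⁻¹ E[f'(t+ε², τ(t) (G^m_t * g)(x))] τ(t)`, `τ(0) = 1`, where `x` is a fixed
point of the plane and `g` a random field. Derivatives at end points of `I` are one-sided. -/
def SolvesODE (P : Measure Ω) (m ε : ℝ) (f : ℝ → ℝ → ℝ) (g : Ω → Plane → ℝ) (x : Plane)
    (I : Set ℝ) (τ : ℝ → ℝ) : Prop :=
  τ 0 = 1 ∧ ∀ t ∈ I, HasDerivWithinAt τ
    (-(1 / Real.log ε⁻¹) *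
      (∫ ω, deriv (f (t + ε ^ 2)) (τ t * heatFlow m t (g ω) x) ∂P) * τ t) I t

end McKeanVlasov

end

/-! Write `κ = 1 / log ε⁻¹`. By stationarity of white noise, `G^m_t * η_ε (x)` is a centred Gaussian
whose variance does not depend on `x`. Hence `E[f'(t+ε², s G^m_t * η_ε (x))]` is a function `a(t,
s)`, called `gaussRate`, of time and amplitude alone. For a field `σ(t) G^m_t * η_ε (x)` the
nonlocal coefficient is thus constant in space; as the heat flow already solves the massive heat
equation, (1) collapses to the scalar equation `σ' = -κ a(t, σ) σ`. The one-point law comes from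
`IsWhiteNoise.average_ae_eq`.

The scalar equation is well posed for two reasons. Both `f'` and its increments grow at most
polynomially in `u`, so Gaussian moments make `a` continuous in `(t, s)` and locally Lipschitz in
`s` (`TameCoeff.isRate_gaussRate`). Moreover `f' ≥ -L₁/t`, because `f₂` is non-decreasing and `f₁`
costs at most `L₁/t`; so `log σ` has slope at most `κ L₁/(t+ε²)`. This excludes explosion
(`IsRate.exists_global`), and integrating it gives the upper bound (`le_growthFactor`).

Uniqueness for (1) cannot use the ansatz, since another solution may have a coefficient depending on
`x`. The lower bound on the coefficient and the maximum principle for functions of exponential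
growth (`maximum_principle`, `abs_le_mul_majorant`) bound every solution by an explicit multiple `W`
of the heat flow of `|η_ε|`, whose moments are bounded uniformly in `x`. The difference of two
solutions solves a linear equation forced by the difference of the coefficients. If the latter is at
most `N e^{bt}`, the solutions differ by at most `(κN/b) e^{bt} W`; taking expectations, the
coefficients differ by at most `(κK/b) N e^{bt}`. For large `b` this is a contraction, and iterating
it forces equality (`IsSolution.ae_eq_on_Icc`).

Smoothness rests on exponential integrals (`contDiffOn_expIntegral`): the heat flow is one in the
parameters `(1/(2t), x/t)`. In the self-similar case so is the rate, as a function of the standard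
deviation, although `F'` itself need not be smooth; a bootstrap in the scalar equation then makes
`σ` smooth. -/

noncomputable section

namespace McKeanVlasov

/-! ### Exponential integrals -/

section ExpIntegral

variable {Y E V : Type*} [MeasurableSpace Y] {μ : Measure Y}
  [NormedAddCommGroup E] [NormedSpace ℝ E] [NormedAddCommGroup V] [NormedSpace ℝ V]

/-- The exponential integral `θ ↦ ∫ e^{S(y) θ} h(y) dμ(y)`. -/
def expIntegral (μ : Measure Y) (S : Y → E →L[ℝ] ℝ) (h : Y → V) (θ : E) : V :=
  ∫ y, Real.exp (S y θ) • h y ∂μ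

/-- Absolute convergence of the exponential integral with a margin. -/
def ExpIntegrableAt (μ : Measure Y) (S : Y → E →L[ℝ] ℝ) (h : Y → V) (θ : E) : Prop :=
  ∃ r > 0, Integrable (fun y => Real.exp (S y θ + r * ‖S y‖) * ‖h y‖) μ

/-- Differentiation brings down a factor `S y`. Half of the margin `r` pays for it, through `‖S y‖ ≤
(2/r) e^{r‖S y‖/2}`, and the other half remains for the next derivative. -/
lemma ExpIntegrableAt.smulRight {S : Y → E →L[ℝ] ℝ} {h : Y → V} {θ : E}
    (hS : AEStronglyMeasurable S μ) (hh : AEStronglyMeasurable h μ)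
    (H : ExpIntegrableAt μ S h θ) : ExpIntegrableAt μ S (fun y => (S y).smulRight (h y)) θ := by
  obtain ⟨r, hr, hi⟩ := H
  refine ⟨r / 2, by positivity, (hi.const_mul (2 / r)).mono' ?_ (ae_of_all _ fun y => ?_)⟩
  · have h1 : AEStronglyMeasurable (fun y => S y θ) μ :=
      (ContinuousLinearMap.apply ℝ ℝ θ).continuous.comp_aestronglyMeasurable hS
    have h2 : AEStronglyMeasurable (fun y => ‖(S y).smulRight (h y)‖) μ := by
      simp only [ContinuousLinearMap.norm_smulRight_apply]
      exact hS.norm.mul hh.norm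
    exact (Real.continuous_exp.comp_aestronglyMeasurable (h1.add (hS.norm.const_mul _))).mul h2
  · rw [Real.norm_eq_abs, abs_of_nonneg (by positivity), ContinuousLinearMap.norm_smulRight_apply]
    have h3 : ‖S y‖ ≤ 2 / r * Real.exp (r / 2 * ‖S y‖) := by
      have := Real.add_one_le_exp (r / 2 * ‖S y‖)
      have h4 : r / 2 * ‖S y‖ ≤ Real.exp (r / 2 * ‖S y‖) := by linarith
      calc ‖S y‖ = 2 / r * (r / 2 * ‖S y‖) := by field_simp
        _ ≤ _ := by gcongr
    have h5 : Real.exp (S y θ + r * ‖S y‖)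
        = Real.exp (S y θ + r / 2 * ‖S y‖) * Real.exp (r / 2 * ‖S y‖) := by
      rw [← Real.exp_add]; congr 1; ring
    calc Real.exp (S y θ + r / 2 * ‖S y‖) * (‖S y‖ * ‖h y‖)
        ≤ Real.exp (S y θ + r / 2 * ‖S y‖) * ((2 / r * Real.exp (r / 2 * ‖S y‖)) * ‖h y‖) := by
          gcongr
      _ = _ := by rw [h5]; ring

lemma aestronglyMeasurable_exp_smul {S : Y → E →L[ℝ] ℝ} {h : Y → V}
    (hS : AEStronglyMeasurable S μ) (hh : AEStronglyMeasurable h μ) (θ : E) :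
    AEStronglyMeasurable (fun y => Real.exp (S y θ) • h y) μ :=
  (Real.continuous_exp.comp_aestronglyMeasurable
    ((ContinuousLinearMap.apply ℝ ℝ θ).continuous.comp_aestronglyMeasurable hS)).smul hh

lemma ExpIntegrableAt.integrable {S : Y → E →L[ℝ] ℝ} {h : Y → V} {θ : E}
    (hS : AEStronglyMeasurable S μ) (hh : AEStronglyMeasurable h μ)
    (H : ExpIntegrableAt μ S h θ) : Integrable (fun y => Real.exp (S y θ) • h y) μ := by
  obtain ⟨r, hr, hi⟩ := H
  refine hi.mono' (aestronglyMeasurable_exp_smul hS hh θ) (ae_of_all _ fun y => ?_)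
  rw [norm_smul, Real.norm_eq_abs, abs_of_pos (Real.exp_pos _)]
  gcongr
  linarith [mul_nonneg hr.le (norm_nonneg (S y))]

/-- The margin provides a dominating function valid on a whole ball: if `‖θ' - θ‖ < r` then `S y θ'
≤ S y θ + r ‖S y‖`. -/
lemma hasFDerivAt_expIntegral {S : Y → E →L[ℝ] ℝ} {h : Y → V} {θ : E}
    (hS : AEStronglyMeasurable S μ) (hh : AEStronglyMeasurable h μ)
    (H : ExpIntegrableAt μ S h θ) :
    HasFDerivAt (expIntegral μ S h) (expIntegral μ S (fun y => (S y).smulRight (h y)) θ) θ := by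
  have hh' : AEStronglyMeasurable (fun y => (S y).smulRight (h y)) μ :=
    (isBoundedBilinearMap_smulRight (𝕜 := ℝ) (E := E) (F := V)).continuous.comp_aestronglyMeasurable
      (hS.prodMk hh)
  obtain ⟨r, hr, hi⟩ := H.smulRight hS hh
  refine hasFDerivAt_integral_of_dominated_of_fderiv_le
    (F := fun (θ : E) y => Real.exp (S y θ) • h y)
    (F' := fun (θ : E) y => Real.exp (S y θ) • (S y).smulRight (h y)) (Metric.ball_mem_nhds θ hr)
    (Filter.Eventually.of_forall fun θ' => aestronglyMeasurable_exp_smul hS hh θ')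
    (H.integrable hS hh) (aestronglyMeasurable_exp_smul hS hh' θ)
    (ae_of_all _ fun y θ' hθ' => ?_) hi (ae_of_all _ fun y θ' _ => ?_)
  · rw [norm_smul, Real.norm_eq_abs, abs_of_pos (Real.exp_pos _)]
    gcongr
    have h1 : S y θ' = S y θ + S y (θ' - θ) := by rw [map_sub]; ring
    have h2 : S y (θ' - θ) ≤ ‖S y‖ * ‖θ' - θ‖ :=
      (le_abs_self _).trans ((S y).le_opNorm _)
    have h3 : ‖θ' - θ‖ ≤ r := (mem_ball_iff_norm.1 hθ').le
    nlinarith [norm_nonneg (S y)]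
  · have h1 : HasFDerivAt (fun θ => Real.exp (S y θ)) (Real.exp (S y θ') • S y) θ' :=
      (S y).hasFDerivAt.exp
    convert h1.smul_const (h y) using 1
    ext v
    simp [mul_smul]

end ExpIntegral

/-- Exponential integrals are smooth in the interior of their domain of convergence. -/
lemma contDiffOn_nat_expIntegral {Y E : Type} [MeasurableSpace Y] {μ : Measure Y}
    [NormedAddCommGroup E] [NormedSpace ℝ E] {S : Y → E →L[ℝ] ℝ} {Θ : Set E}
    (hS : AEStronglyMeasurable S μ) (n : ℕ) :
    ∀ (V : Type) [NormedAddCommGroup V] [NormedSpace ℝ V] (h : Y → V)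
      (_ : AEStronglyMeasurable h μ) (_ : ∀ θ ∈ Θ, ExpIntegrableAt μ S h θ),
      ContDiffOn ℝ n (expIntegral μ S h) Θ := by
  induction n with
  | zero =>
    intro V _ _ h hh H
    exact contDiffOn_zero.2 fun θ hθ =>
      (hasFDerivAt_expIntegral hS hh (H θ hθ)).continuousAt.continuousWithinAt
  | succ n ih =>
    intro V _ _ h hh H
    have hh' : AEStronglyMeasurable (fun y => (S y).smulRight (h y)) μ :=
      (isBoundedBilinearMap_smulRight (𝕜 := ℝ) (E := E)
        (F := V)).continuous.comp_aestronglyMeasurable (hS.prodMk hh)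
    rw [Nat.cast_succ, contDiffOn_succ_iff_hasFDerivWithinAt (by simp)]
    intro θ hθ
    refine ⟨Θ, by simp [Set.insert_eq_of_mem hθ, self_mem_nhdsWithin], by simp,
      expIntegral μ S (fun y => (S y).smulRight (h y)),
      fun x hx => (hasFDerivAt_expIntegral hS hh (H x hx)).hasFDerivWithinAt, ?_⟩
    -- The derivative is again an exponential integral, with values in `E →L[ℝ] V`. This is why the
    -- target space is quantified inside the induction and why all types lie in one universe.
    exact (ih (E →L[ℝ] V) _ hh' fun x hx => (H x hx).smulRight hS hh)

lemma contDiffOn_expIntegral {Y E V : Type} [MeasurableSpace Y] {μ : Measure Y}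
    [NormedAddCommGroup E] [NormedSpace ℝ E] [NormedAddCommGroup V] [NormedSpace ℝ V]
    {S : Y → E →L[ℝ] ℝ} {Θ : Set E}
    (hS : AEStronglyMeasurable S μ) {h : Y → V} (hh : AEStronglyMeasurable h μ)
    (H : ∀ θ ∈ Θ, ExpIntegrableAt μ S h θ) :
    ContDiffOn ℝ (⊤ : ℕ∞) (expIntegral μ S h) Θ :=
  contDiffOn_infty.2 fun n => contDiffOn_nat_expIntegral hS n V h hh H

lemma hasFDerivAt_expIntegral_apply {Y E : Type*} [MeasurableSpace Y] {μ : Measure Y}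
    [NormedAddCommGroup E] [NormedSpace ℝ E]
    {S : Y → E →L[ℝ] ℝ} {h : Y → ℝ} {θ : E}
    (hS : AEStronglyMeasurable S μ) (hh : AEStronglyMeasurable h μ)
    (H : ExpIntegrableAt μ S h θ) :
    ∃ L : E →L[ℝ] ℝ, HasFDerivAt (expIntegral μ S h) L θ ∧
      ∀ v, L v = expIntegral μ S (fun y => S y v * h y) θ := by
  refine ⟨_, hasFDerivAt_expIntegral hS hh H, fun v => ?_⟩
  have hh' : AEStronglyMeasurable (fun y => (S y).smulRight (h y)) μ :=
    (isBoundedBilinearMap_smulRight (𝕜 := ℝ) (E := E) (F := ℝ)).continuous.comp_aestronglyMeasurable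
      (hS.prodMk hh)
  unfold expIntegral
  rw [ContinuousLinearMap.integral_apply ((H.smulRight hS hh).integrable hS hh')]
  simp

/-! ### The Laplacian and the maximum principle -/

/-- The standard basis vectors of the plane. -/
abbrev stdVec (i : Fin 2) : Plane := EuclideanSpace.single i 1

lemma hasDerivAt_line {f : Plane → ℝ} {x v : Plane} {r : ℝ} (hf : DifferentiableAt ℝ f (x + r • v)) :
    HasDerivAt (fun r : ℝ => f (x + r • v)) (fderiv ℝ f (x + r • v) v) r := by
  have h1 : HasDerivAt (fun r : ℝ => x + r • v) v r := by
    simpa using ((hasDerivAt_id r).smul_const v).const_add x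
  exact hf.hasFDerivAt.comp_hasDerivAt r h1

lemma laplacian_eq_sum_iteratedFDeriv (f : Plane → ℝ) (x : Plane) :
    (Δ f) x = ∑ i, iteratedFDeriv ℝ 2 f x ![stdVec i, stdVec i] := by
  rw [InnerProductSpace.laplacian_eq_iteratedFDeriv_orthonormalBasis f
    (EuclideanSpace.basisFun (Fin 2) ℝ)]
  simp [stdVec]

lemma hasDerivAt_fderiv_line {f : Plane → ℝ} (hf : ContDiff ℝ 2 f) (x v : Plane) :
    HasDerivAt (fun r : ℝ => fderiv ℝ f (x + r • v) v) (iteratedFDeriv ℝ 2 f x ![v, v]) 0 := by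
  have hd : DifferentiableAt ℝ (fderiv ℝ f) (x + (0 : ℝ) • v) :=
    ((hf.fderiv_right (m := 1) (by norm_num)).differentiable (by norm_num)) _
  have h1 : HasDerivAt (fun r : ℝ => x + r • v) v 0 := by
    simpa using ((hasDerivAt_id (0 : ℝ)).smul_const v).const_add x
  have h2 : HasDerivAt (fun r : ℝ => fderiv ℝ f (x + r • v))
      (fderiv ℝ (fderiv ℝ f) (x + (0 : ℝ) • v) v) 0 :=
    hd.hasFDerivAt.comp_hasDerivAt (0 : ℝ) h1
  have h3 : HasDerivAt (fun r : ℝ => fderiv ℝ f (x + r • v) v)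
      (fderiv ℝ (fderiv ℝ f) (x + (0 : ℝ) • v) v v) 0 :=
    (ContinuousLinearMap.apply ℝ ℝ v).hasFDerivAt.comp_hasDerivAt (0 : ℝ) h2
  rw [zero_smul, add_zero] at h3
  rw [iteratedFDeriv_two_apply]
  exact h3

/-- The Laplacian computed from second derivatives along the coordinate lines. -/
lemma laplacian_eq_sum_of_hasDerivAt {f : Plane → ℝ} (hf : ContDiff ℝ 2 f) {x : Plane}
    {d : Fin 2 → ℝ → ℝ} {k : Fin 2 → ℝ}
    (h1 : ∀ i r, HasDerivAt (fun r : ℝ => f (x + r • stdVec i)) (d i r) r)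
    (h2 : ∀ i, HasDerivAt (d i) (k i) 0) : (Δ f) x = ∑ i, k i := by
  rw [laplacian_eq_sum_iteratedFDeriv]
  refine Finset.sum_congr rfl fun i _ => ?_
  have h3 : d i = fun r : ℝ => fderiv ℝ f (x + r • stdVec i) (stdVec i) := by
    funext r
    exact (h1 i r).unique (hasDerivAt_line ((hf.differentiable (by norm_num)) _))
  have h4 := h2 i
  rw [h3] at h4
  exact (hasDerivAt_fderiv_line hf x _).unique h4

/-- If `k > 0`, the second derivative test makes the critical point a local minimum as well; then
`g` is locally constant and `k = 0`. -/
lemma second_deriv_nonpos_of_isLocalMax {g d : ℝ → ℝ} {k x : ℝ} (hmax : IsLocalMax g x)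
    (h1 : ∀ r, HasDerivAt g (d r) r) (h2 : HasDerivAt d k x) : k ≤ 0 := by
  by_contra! hk
  have hd : deriv g = d := funext fun r => (h1 r).deriv
  have hmin : IsLocalMin g x :=
    isLocalMin_of_deriv_deriv_pos (by rw [hd, h2.deriv]; exact hk) hmax.deriv_eq_zero
      (h1 x).continuousAt
  have hconst : g =ᶠ[nhds x] fun _ => g x := by
    filter_upwards [hmax, hmin] with y hy1 hy2 using le_antisymm hy1 hy2
  have h3 : d =ᶠ[nhds x] fun _ => 0 := by
    have := hconst.eventuallyEq_nhds
    filter_upwards [this] with y hy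
    rw [← hd, hy.deriv_eq]; simp
  have : k = 0 := by
    rw [← h2.deriv, h3.deriv_eq]; simp
  exact hk.ne' this

lemma laplacian_nonpos_of_isLocalMax {f : Plane → ℝ} (hf : ContDiff ℝ 2 f) {x : Plane}
    (hmax : IsLocalMax f x) : (Δ f) x ≤ 0 := by
  rw [laplacian_eq_sum_iteratedFDeriv]
  refine Finset.sum_nonpos fun i _ => ?_
  refine second_deriv_nonpos_of_isLocalMax (x := 0) (g := fun r : ℝ => f (x + r • stdVec i)) ?_
    (fun r => hasDerivAt_line ((hf.differentiable (by norm_num)) _)) (hasDerivAt_fderiv_line hf x _)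
  have hc : Filter.Tendsto (fun r : ℝ => x + r • stdVec i) (nhds 0) (nhds x) := by
    have : Continuous fun r : ℝ => x + r • stdVec i := by fun_prop
    simpa using this.tendsto 0
  have := hc.eventually hmax
  simpa [IsLocalMax, IsMaxFilter] using this

/-- The spatial profile of the barrier function. -/
def coshBarrier (a : ℝ) (x : Plane) : ℝ := Real.cosh (a * x 0) + Real.cosh (a * x 1)

lemma contDiff_coshBarrier (a : ℝ) {n : WithTop ℕ∞} : ContDiff ℝ n (coshBarrier a) := by
  unfold coshBarrier
  have h : ∀ i : Fin 2, ContDiff ℝ n fun x : Plane => x i := fun i =>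
    (EuclideanSpace.proj (𝕜 := ℝ) i).contDiff
  exact (Real.contDiff_cosh.comp (contDiff_const.mul (h 0))).add
    (Real.contDiff_cosh.comp (contDiff_const.mul (h 1)))

lemma coshBarrier_pos (a : ℝ) (x : Plane) : 0 < coshBarrier a x :=
  add_pos (Real.cosh_pos _) (Real.cosh_pos _)

/-- The barrier is an eigenfunction of the Laplacian, so multiplying it by a sufficiently fast
exponential in time gives a strict supersolution. -/
lemma laplacian_coshBarrier (a : ℝ) (x : Plane) :
    (Δ (coshBarrier a)) x = a ^ 2 * coshBarrier a x := by
  have key : ∀ (c r : ℝ), HasDerivAt (fun r : ℝ => Real.cosh (a * (c + r)))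
      (a * Real.sinh (a * (c + r))) r := fun c r => by
    have h1 : HasDerivAt (fun r : ℝ => a * (c + r)) a r := by
      simpa using ((hasDerivAt_id r).const_add c).const_mul a
    exact h1.cosh.congr_deriv (by ring)
  have key2 : ∀ (c : ℝ), HasDerivAt (fun r : ℝ => a * Real.sinh (a * (c + r)))
      (a ^ 2 * Real.cosh (a * c)) 0 := fun c => by
    have h1 : HasDerivAt (fun r : ℝ => a * (c + r)) a 0 := by
      simpa using ((hasDerivAt_id (0 : ℝ)).const_add c).const_mul a
    exact (h1.sinh.const_mul a).congr_deriv (by rw [add_zero]; ring)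
  rw [laplacian_eq_sum_of_hasDerivAt (contDiff_coshBarrier a) (x := x)
    (d := fun i r => a * Real.sinh (a * (x i + r))) (k := fun i => a ^ 2 * Real.cosh (a * x i))
    ?_ (fun i => key2 (x i))]
  · simp [coshBarrier]; ring
  · intro i r
    fin_cases i
    · simpa [coshBarrier] using (key (x 0) r).add_const (Real.cosh (a * x 1))
    · simpa [coshBarrier] using (key (x 1) r).const_add (Real.cosh (a * x 0))

/-- Some coordinate has `|x i| ≥ ‖x‖/√2 ≥ (2/3)‖x‖`. The exponent `4/3 a` strictly exceeds `a`, so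
the barrier with parameter `2a` eventually beats growth of rate `a` in every direction. -/
lemma exp_le_coshBarrier {a : ℝ} (ha : 0 ≤ a) (x : Plane) :
    Real.exp (4 / 3 * a * ‖x‖) ≤ 2 * coshBarrier (2 * a) x := by
  have hn : ‖x‖ ^ 2 = x 0 ^ 2 + x 1 ^ 2 := by
    rw [EuclideanSpace.norm_sq_eq]; simp
  have hcosh : ∀ y : ℝ, Real.exp |y| ≤ 2 * Real.cosh y := fun y => by
    rw [← Real.cosh_abs, Real.cosh_eq]
    linarith [Real.exp_pos (-|y|)]
  have h : ‖x‖ ≤ 3 / 2 * |x 0| ∨ ‖x‖ ≤ 3 / 2 * |x 1| := by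
    by_contra! hc
    obtain ⟨h0, h1⟩ := hc
    have e0 : (3 / 2 * |x 0|) ^ 2 < ‖x‖ ^ 2 := pow_lt_pow_left₀ h0 (by positivity) two_ne_zero
    have e1 : (3 / 2 * |x 1|) ^ 2 < ‖x‖ ^ 2 := pow_lt_pow_left₀ h1 (by positivity) two_ne_zero
    rw [mul_pow, sq_abs] at e0 e1
    nlinarith [sq_nonneg (x 0), sq_nonneg (x 1)]
  have aux : ∀ i : Fin 2, ‖x‖ ≤ 3 / 2 * |x i| → 
      Real.exp (4 / 3 * a * ‖x‖) ≤ 2 * Real.cosh (2 * a * x i) := fun i hi => by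
    refine le_trans (Real.exp_le_exp.2 ?_) (hcosh _)
    rw [abs_mul, abs_of_nonneg (by positivity : 0 ≤ 2 * a)]
    nlinarith
  unfold coshBarrier
  rcases h with h | h
  · linarith [aux 0 h, Real.cosh_pos (2 * a * x 1)]
  · linarith [aux 1 h, Real.cosh_pos (2 * a * x 0)]

/-- Only earlier times are compared, so the maximum may sit at the final time of the interval. -/
lemma deriv_nonneg_of_isMaxOn_Icc {g : ℝ → ℝ} {g' t : ℝ} (ht : 0 < t)
    (hg : HasDerivAt g g' t) (hmax : ∀ s ∈ Set.Icc 0 t, g s ≤ g t) : 0 ≤ g' := by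
  have h1 : HasDerivWithinAt g g' (Set.Iio t) t := hg.hasDerivWithinAt
  have h2 := (hasDerivWithinAt_iff_tendsto_slope' (by simp)).1 h1
  refine ge_of_tendsto h2 ?_
  have : Set.Ioo 0 t ∈ nhdsWithin t (Set.Iio t) := Ioo_mem_nhdsLT ht
  filter_upwards [this] with s hs
  rw [slope_def_field]
  exact div_nonneg_of_nonpos (by linarith [hmax s ⟨hs.1.le, hs.2.le⟩]) (by linarith [hs.2])

/-- The parabolic maximum principle on the plane, for functions of at most exponential growth. -/
theorem maximum_principle {T a b C : ℝ} (ha : 0 < a) {u u' : ℝ → Plane → ℝ}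
    (hcont : ContinuousOn (fun p : ℝ × Plane => u p.1 p.2) (Set.Icc 0 T ×ˢ Set.univ))
    (hsmooth : ∀ t ∈ Set.Ioc 0 T, ContDiff ℝ 2 (u t))
    (hderiv : ∀ t ∈ Set.Ioc 0 T, ∀ x, HasDerivAt (fun s => u s x) (u' t x) t)
    (hineq : ∀ t ∈ Set.Ioc 0 T, ∀ x, 0 < u t x → u' t x ≤ 1 / 2 * (Δ (u t)) x + b * u t x)
    (hinit : ∀ x, u 0 x ≤ 0)
    (hgrowth : ∀ t ∈ Set.Icc 0 T, ∀ x, u t x ≤ C * Real.exp (a * ‖x‖)) :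
    ∀ t ∈ Set.Icc 0 T, ∀ x, u t x ≤ 0 := by
  intro t₁ ht₁ x₁
  by_contra! hpos
  -- Half the Laplacian of `ψ` is `2a² ψ`, and the zeroth-order term contributes `b`; the extra `1`
  -- makes `e^{ct} ψ` a strict supersolution.
  set c : ℝ := 2 * a ^ 2 + b + 1 with hc
  set ψ := coshBarrier (2 * a) with hψ
  have hψpos : ∀ x, 0 < ψ x := coshBarrier_pos _
  obtain ⟨δ, hδ, hδ₁⟩ : ∃ δ > 0, δ * (Real.exp (c * t₁) * ψ x₁) < u t₁ x₁ := by
    have hB : 0 < Real.exp (c * t₁) * ψ x₁ := mul_pos (Real.exp_pos _) (hψpos _)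
    generalize Real.exp (c * t₁) * ψ x₁ = B at hB
    refine ⟨u t₁ x₁ / B / 2, by positivity, ?_⟩
    rw [show u t₁ x₁ / B / 2 * B = u t₁ x₁ / 2 by field_simp]
    linarith
  set Φ : ℝ → Plane → ℝ := fun t x => u t x - δ * (Real.exp (c * t) * ψ x) with hΦ
  -- The factor `e^{-bt}` removes the zeroth-order term `b Φ`, so no sign of `b` is needed. The
  -- point of maximum of `φ` also maximises `Φ` in space.
  set φ : ℝ → Plane → ℝ := fun t x => Real.exp (-b * t) * Φ t x with hφ
  -- outside a large ball the barrier dominates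
  obtain ⟨R, hR⟩ : ∃ R : ℝ, ∀ t ∈ Set.Icc 0 t₁, ∀ x : Plane, R ≤ ‖x‖ → Φ t x < 0 := by
    set e₀ := Real.exp (-|c| * t₁) with he₀
    have htend : Filter.Tendsto (fun r : ℝ => δ * e₀ / 2 * Real.exp (1 / 3 * a * r)) 
        Filter.atTop Filter.atTop := by
      refine Filter.Tendsto.const_mul_atTop (by positivity) (Real.tendsto_exp_atTop.comp ?_)
      exact Filter.tendsto_id.const_mul_atTop (by positivity)
    obtain ⟨R, hR⟩ := Filter.eventually_atTop.1 (htend.eventually_gt_atTop C)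
    refine ⟨R, fun t ht x hx => ?_⟩
    have h1 := hR ‖x‖ hx
    have h2 := hgrowth t ⟨ht.1, ht.2.trans ht₁.2⟩ x
    have h3 := exp_le_coshBarrier ha.le x
    have h4 : e₀ ≤ Real.exp (c * t) := by
      refine Real.exp_le_exp.2 ?_
      have : -|c| ≤ c := neg_abs_le c
      nlinarith [abs_nonneg c, ht.1, ht.2]
    have h5 : Real.exp (4 / 3 * a * ‖x‖) = Real.exp (1 / 3 * a * ‖x‖) * Real.exp (a * ‖x‖) := by
      rw [← Real.exp_add]; congr 1; ring
    have h6 : C * Real.exp (a * ‖x‖)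
        < δ * e₀ / 2 * Real.exp (1 / 3 * a * ‖x‖) * Real.exp (a * ‖x‖) := by
      gcongr
    have h7 : δ * e₀ / 2 * Real.exp (1 / 3 * a * ‖x‖) * Real.exp (a * ‖x‖)
        ≤ δ * (Real.exp (c * t) * ψ x) := by
      calc _ = δ * (e₀ * (Real.exp (4 / 3 * a * ‖x‖) / 2)) := by rw [h5]; ring
        _ ≤ δ * (Real.exp (c * t) * ψ x) := by
          gcongr
          linarith
    simp only [hΦ]
    linarith
  have hx₁R : ‖x₁‖ < R := by
    by_contra! h
    have := hR t₁ ⟨ht₁.1, le_rfl⟩ x₁ h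
    simp only [hΦ] at this
    linarith
  have hψc : Continuous ψ := (contDiff_coshBarrier (n := 0) _).continuous
  have hK : IsCompact (Set.Icc (0 : ℝ) t₁ ×ˢ Metric.closedBall (0 : Plane) R) :=
    isCompact_Icc.prod (isCompact_closedBall _ _)
  have hφc : ContinuousOn (fun p : ℝ × Plane => φ p.1 p.2)
      (Set.Icc (0 : ℝ) t₁ ×ˢ Metric.closedBall (0 : Plane) R) := by
    have h1 : ContinuousOn (fun p : ℝ × Plane => u p.1 p.2)
        (Set.Icc (0 : ℝ) t₁ ×ˢ Metric.closedBall (0 : Plane) R) :=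
      hcont.mono (Set.prod_mono (Set.Icc_subset_Icc_right ht₁.2) (Set.subset_univ _))
    have h2 : Continuous fun p : ℝ × Plane => δ * (Real.exp (c * p.1) * ψ p.2) := by fun_prop
    have h3 : Continuous fun p : ℝ × Plane => Real.exp (-b * p.1) := by fun_prop
    exact h3.continuousOn.mul (h1.sub h2.continuousOn)
  obtain ⟨⟨t₀, x₀⟩, ⟨ht₀, hx₀⟩, hmax⟩ := hK.exists_isMaxOn
    ⟨(t₁, x₁), ⟨⟨ht₁.1, le_rfl⟩, by simpa using hx₁R.le⟩⟩ hφc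
  simp only at ht₀ hx₀
  have hmax' : ∀ t ∈ Set.Icc 0 t₁, ∀ x : Plane, ‖x‖ ≤ R → φ t x ≤ φ t₀ x₀ := fun t ht x hx =>
    hmax (show (t, x) ∈ _ from ⟨ht, by simpa using hx⟩)
  have hφpos : 0 < φ t₀ x₀ :=
    lt_of_lt_of_le (mul_pos (Real.exp_pos _) (by simp only [hΦ]; linarith))
      (hmax' t₁ ⟨ht₁.1, le_rfl⟩ x₁ hx₁R.le)
  have hΦpos : 0 < Φ t₀ x₀ := pos_of_mul_pos_right hφpos (Real.exp_pos _).le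
  have hBpos : 0 < δ * (Real.exp (c * t₀) * ψ x₀) :=
    mul_pos hδ (mul_pos (Real.exp_pos _) (hψpos _))
  have hupos : 0 < u t₀ x₀ := by simp only [hΦ] at hΦpos; linarith
  have ht₀pos : 0 < t₀ := by
    rcases ht₀.1.lt_or_eq with h | h
    · exact h
    · rw [← h] at hupos
      exact absurd (hinit x₀) (not_le.2 hupos)
  have ht₀T : t₀ ∈ Set.Ioc 0 T := ⟨ht₀pos, ht₀.2.trans ht₁.2⟩
  have hx₀R : ‖x₀‖ < R := by
    by_contra! h
    linarith [hR t₀ ht₀ x₀ h]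
  -- the time derivative
  have hexp : ∀ k : ℝ, HasDerivAt (fun s : ℝ => Real.exp (k * s)) (k * Real.exp (k * t₀)) t₀ :=
    fun k => by
      have h1 : HasDerivAt (fun s : ℝ => k * s) k t₀ := by
        simpa using (hasDerivAt_id t₀).const_mul k
      exact h1.exp.congr_deriv (by ring)
  have hΦt : HasDerivAt (fun s => Φ s x₀)
      (u' t₀ x₀ - δ * (c * Real.exp (c * t₀) * ψ x₀)) t₀ :=
    (hderiv t₀ ht₀T x₀).sub (((hexp c).mul_const (ψ x₀)).const_mul δ)
  have hφt := (hexp (-b)).mul hΦt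
  have h1 := deriv_nonneg_of_isMaxOn_Icc ht₀pos hφt
    (fun s hs => hmax' s ⟨hs.1, hs.2.trans ht₀.2⟩ x₀ hx₀R.le)
  have h1' : 0 ≤ u' t₀ x₀ - δ * (c * Real.exp (c * t₀) * ψ x₀) - b * Φ t₀ x₀ := by
    refine (mul_nonneg_iff_of_pos_left (Real.exp_pos (-b * t₀))).1 (h1.trans_eq ?_)
    ring
  -- the Laplacian
  have hΦs : ContDiff ℝ 2 (Φ t₀) :=
    (hsmooth t₀ ht₀T).sub (contDiff_const.mul (contDiff_const.mul (contDiff_coshBarrier _)))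
  have hloc : IsLocalMax (Φ t₀) x₀ := by
    have : ∀ᶠ x in nhds x₀, ‖x‖ < R := continuous_norm.continuousAt.eventually_lt_const hx₀R
    filter_upwards [this] with x hx
    exact le_of_mul_le_mul_left (hmax' t₀ ht₀ x hx.le) (Real.exp_pos _)
  have h2 := laplacian_nonpos_of_isLocalMax hΦs hloc
  have h3 : (Δ (Φ t₀)) x₀ = (Δ (u t₀)) x₀ - δ * Real.exp (c * t₀) * ((2 * a) ^ 2 * ψ x₀) := by
    have e1 : Φ t₀ = u t₀ - (δ * Real.exp (c * t₀)) • ψ := by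
      funext x; simp [hΦ, mul_assoc]
    have e2 : ContDiffAt ℝ 2 ψ x₀ := (contDiff_coshBarrier _).contDiffAt
    have e3 : ContDiffAt ℝ 2 ((δ * Real.exp (c * t₀)) • ψ) x₀ :=
      e2.const_smul (δ * Real.exp (c * t₀))
    rw [e1, ((hsmooth t₀ ht₀T).contDiffAt).laplacian_sub e3,
      InnerProductSpace.laplacian_smul _ e2, hψ, laplacian_coshBarrier, smul_eq_mul]
  have h4 := hineq t₀ ht₀T x₀ hupos
  have h5 : Φ t₀ x₀ = u t₀ x₀ - δ * (Real.exp (c * t₀) * ψ x₀) := rfl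
  rw [h5] at h1'
  rw [h3] at h2
  rw [hc] at h1' h2 hBpos
  -- At the maximum, `0 ≤ ∂_tΦ - bΦ ≤ ½ΔΦ - δ e^{ct}ψ < 0`, a contradiction.
  nlinarith

/-! ### Gaussian integrals on the plane -/

lemma integrable_exp_neg_mul_sq_norm {b : ℝ} (hb : 0 < b) :
    Integrable (fun y : Plane => Real.exp (-b * ‖y‖ ^ 2)) := by
  have h := (GaussianFourier.integrable_cexp_neg_mul_sq_norm_add (V := Plane) (b := (b : ℂ))
    (by simpa using hb) 0 0).norm
  refine h.congr (ae_of_all _ fun y => ?_)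
  simp only [Complex.norm_exp]
  congr 1
  simp [← Complex.ofReal_pow]

lemma integrable_exp_neg_mul_sq_norm_add {b : ℝ} (hb : 0 < b) (c : ℝ) :
    Integrable (fun y : Plane => Real.exp (-b * ‖y‖ ^ 2 + c * ‖y‖)) := by
  -- Half of the quadratic decay absorbs the linear term by completing the square, at the cost of
  -- the constant `e^{c²/(2b)}`.
  refine ((integrable_exp_neg_mul_sq_norm (half_pos hb)).const_mul
    (Real.exp (c ^ 2 / (2 * b)))).mono' (by fun_prop) (ae_of_all _ fun y => ?_)
  rw [Real.norm_eq_abs, abs_of_pos (Real.exp_pos _), ← Real.exp_add]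
  refine Real.exp_le_exp.2 ?_
  have h : c ^ 2 / (2 * b) + -(b / 2) * ‖y‖ ^ 2 - (-b * ‖y‖ ^ 2 + c * ‖y‖)
      = (c - b * ‖y‖) ^ 2 / (2 * b) := by field_simp; ring
  have : 0 ≤ (c - b * ‖y‖) ^ 2 / (2 * b) := by positivity
  linarith

lemma heatKernel_nonneg {t : ℝ} (ht : 0 ≤ t) (x : Plane) : 0 ≤ heatKernel t x := by
  unfold heatKernel; positivity

lemma heatKernel_neg (t : ℝ) (x : Plane) : heatKernel t (-x) = heatKernel t x := by
  simp [heatKernel]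

lemma heatKernel_sub_comm (t : ℝ) (x y : Plane) : heatKernel t (x - y) = heatKernel t (y - x) := by
  rw [← neg_sub, heatKernel_neg]

lemma integral_exp_neg_mul_sq_norm {b : ℝ} (hb : 0 < b) :
    ∫ y : Plane, Real.exp (-b * ‖y‖ ^ 2) = Real.pi / b := by
  rw [GaussianFourier.integral_rexp_neg_mul_sq_norm hb]
  simp

lemma heatKernel_eq (t : ℝ) : heatKernel t =
    fun x => 1 / (2 * Real.pi * t) * Real.exp (-(1 / (2 * t)) * ‖x‖ ^ 2) := by
  funext x; unfold heatKernel; congr 2; ring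

lemma integrable_heatKernel {t : ℝ} (ht : 0 < t) : Integrable (heatKernel t) := by
  rw [heatKernel_eq]
  exact (integrable_exp_neg_mul_sq_norm (by positivity)).const_mul _

lemma integral_heatKernel {t : ℝ} (ht : 0 < t) : ∫ x, heatKernel t x = 1 := by
  rw [heatKernel_eq, integral_const_mul, integral_exp_neg_mul_sq_norm (by positivity)]
  field_simp

/-- The semigroup property of the heat kernel. -/
lemma integral_heatKernel_mul_heatKernel {s t : ℝ} (hs : 0 < s) (ht : 0 < t) (a b : Plane) :
    ∫ y, heatKernel s (y - a) * heatKernel t (y - b) = heatKernel (s + t) (a - b) := by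
  -- Completing the square: the product of the two Gaussians is a Gaussian in `y` centred at the
  -- weighted mean `c`, with variance parameter `st/(s+t)`, times a factor free of `y`.
  set c : Plane := (t / (s + t)) • a + (s / (s + t)) • b with hc
  have hst : 0 < s + t := by positivity
  have key : ∀ y : Plane, heatKernel s (y - a) * heatKernel t (y - b)
      = heatKernel (s + t) (a - b) * heatKernel (s * t / (s + t)) (y - c) := by
    intro y
    have e1 : y - a = (y - c) - (s / (s + t)) • (a - b) := by
      rw [hc]
      have : a = (t / (s + t)) • a + (s / (s + t)) • a := by
        rw [← add_smul, ← add_div, add_comm t s, div_self hst.ne', one_smul]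
      nth_rewrite 1 [this]
      rw [smul_sub]; abel
    have e2 : y - b = (y - c) + (t / (s + t)) • (a - b) := by
      rw [hc]
      have : b = (t / (s + t)) • b + (s / (s + t)) • b := by
        rw [← add_smul, ← add_div, add_comm t s, div_self hst.ne', one_smul]
      nth_rewrite 1 [this]
      rw [smul_sub]; abel
    generalize y - c = p at e1 e2
    generalize a - b = q at e1 e2 ⊢
    rw [e1, e2]
    unfold heatKernel
    rw [mul_mul_mul_comm, mul_mul_mul_comm (1 / (2 * Real.pi * (s + t))), ← Real.exp_add,
      ← Real.exp_add, norm_sub_sq_real, norm_add_sq_real, inner_smul_right, inner_smul_right,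
      norm_smul, norm_smul, Real.norm_of_nonneg (by positivity : 0 ≤ s / (s + t)),
      Real.norm_of_nonneg (by positivity : 0 ≤ t / (s + t))]
    congr 1
    · field_simp
    · congr 1
      field_simp
      ring
  simp_rw [key]
  rw [integral_const_mul, integral_sub_right_eq_self (heatKernel (s * t / (s + t))) c,
    integral_heatKernel (by positivity), mul_one]

/-- The standard Gaussian measure on the plane. -/
def gaussPlane : Measure Plane :=
  volume.withDensity fun z => ENNReal.ofReal (heatKernel 1 z)

lemma measurable_heatKernel (t : ℝ) : Measurable (heatKernel t) :=
  (contDiff_heatKernel t).continuous.measurable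

lemma integral_gaussPlane (h : Plane → ℝ) :
    ∫ z, h z ∂gaussPlane = ∫ z, heatKernel 1 z * h z := by
  unfold gaussPlane
  rw [integral_withDensity_eq_integral_toReal_smul (by
    exact (measurable_heatKernel 1).ennreal_ofReal) (ae_of_all _ fun z => ENNReal.ofReal_lt_top)]
  refine integral_congr_ae (ae_of_all _ fun z => ?_)
  simp [ENNReal.toReal_ofReal (heatKernel_nonneg zero_le_one z)]

lemma integrable_gaussPlane_iff (h : Plane → ℝ) :
    Integrable h gaussPlane ↔ Integrable fun z => heatKernel 1 z * h z := by
  unfold gaussPlane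
  rw [integrable_withDensity_iff_integrable_smul' ((measurable_heatKernel 1).ennreal_ofReal)
    (ae_of_all _ fun z => ENNReal.ofReal_lt_top)]
  refine integrable_congr (ae_of_all _ fun z => ?_)
  simp [ENNReal.toReal_ofReal (heatKernel_nonneg zero_le_one z)]

instance : IsProbabilityMeasure gaussPlane := by
  constructor
  unfold gaussPlane
  rw [withDensity_apply _ MeasurableSet.univ, Measure.restrict_univ,
    ← ofReal_integral_eq_lintegral_ofReal (integrable_heatKernel one_pos)
      (ae_of_all _ fun z => heatKernel_nonneg zero_le_one z), integral_heatKernel one_pos]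
  simp

lemma integrable_exp_norm_gaussPlane (c : ℝ) :
    Integrable (fun z : Plane => Real.exp (c * ‖z‖)) gaussPlane := by
  rw [integrable_gaussPlane_iff]
  have := (integrable_exp_neg_mul_sq_norm_add (b := 1 / 2) (by norm_num) c).const_mul
    (1 / (2 * Real.pi))
  refine this.congr (ae_of_all _ fun z => ?_)
  simp only [heatKernel_eq, Real.exp_add]
  ring_nf

/-- The heat flow as a Gaussian average. -/
lemma heatFlow_eq_integral_gaussPlane (m : ℝ) {t : ℝ} (ht : 0 ≤ t) (g : Plane → ℝ) (x : Plane) :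
    heatFlow m t g x = Real.exp (m * t) * ∫ z, g (x - Real.sqrt t • z) ∂gaussPlane := by
  rcases ht.eq_or_lt with rfl | ht
  · simp [heatFlow]
  · rw [heatFlow, if_neg ht.ne', integral_gaussPlane]
    unfold massHeatKernel
    simp_rw [mul_assoc]
    rw [integral_const_mul]
    congr 1
    have h1 : ∫ y, heatKernel t (x - y) * g y = ∫ y, heatKernel t y * g (x - y) := by
      rw [← integral_sub_left_eq_self _ volume x]
      simp
    have h2 := Measure.integral_comp_smul (μ := (volume : Measure Plane))
      (fun y => heatKernel t y * g (x - y)) (Real.sqrt t)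
    -- In dimension two the Jacobian of `z ↦ √t z` is `t`.
    have h3 : |(Real.sqrt t ^ Module.finrank ℝ Plane)⁻¹| = t⁻¹ := by
      rw [finrank_euclideanSpace_fin, Real.sq_sqrt ht.le, abs_of_pos (by positivity)]
    rw [h3, smul_eq_mul] at h2
    rw [h1, ← mul_right_inj' (inv_ne_zero ht.ne'), ← h2, ← integral_const_mul]
    refine integral_congr_ae (ae_of_all _ fun z => ?_)
    simp only [heatKernel, norm_smul, Real.norm_of_nonneg (Real.sqrt_nonneg t), mul_pow,
      Real.sq_sqrt ht.le]
    have h4 : -(t * ‖z‖ ^ 2) / (2 * t) = -‖z‖ ^ 2 / (2 * 1) := by field_simp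
    rw [h4]
    field_simp

/-! ### The heat flow of functions of exponential growth -/

/-- Continuous functions of at most exponential growth. -/
structure TameFun (h : Plane → ℝ) : Prop where
  continuous : Continuous h
  bound : ∃ C ≥ 0, ∃ a > 0, ∀ y, |h y| ≤ C * Real.exp (a * ‖y‖)

lemma TameFun.abs {h : Plane → ℝ} (H : TameFun h) : TameFun fun y => |h y| :=
  ⟨H.continuous.abs, by simpa using H.bound⟩

/-- Derivatives of the heat flow bring down coordinates `y i`; raising the exponential rate by one
absorbs each of them. -/
lemma TameFun.coord_mul {h : Plane → ℝ} (H : TameFun h) (i : Fin 2) :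
    TameFun fun y => y i * h y := by
  obtain ⟨C, hC, a, ha, hb⟩ := H.bound
  have hc : Continuous fun y : Plane => y i := (EuclideanSpace.proj (𝕜 := ℝ) i).continuous
  refine ⟨hc.mul H.continuous, C, hC, a + 1, by positivity, fun y => ?_⟩
  have h1 : |y i| ≤ Real.exp ‖y‖ := by
    have := PiLp.norm_apply_le y i
    rw [Real.norm_eq_abs] at this
    linarith [Real.add_one_le_exp ‖y‖]
  rw [abs_mul]
  calc |y i| * |h y| ≤ Real.exp ‖y‖ * (C * Real.exp (a * ‖y‖)) := by
        gcongr; exact hb y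
    _ = _ := by rw [add_mul, Real.exp_add, one_mul]; ring

lemma TameFun.integrable_gaussPlane {h : Plane → ℝ} (H : TameFun h) (x : Plane) (s : ℝ) :
    Integrable (fun z => h (x - s • z)) gaussPlane := by
  obtain ⟨C, hC, a, ha, hb⟩ := H.bound
  refine ((integrable_exp_norm_gaussPlane (a * |s|)).const_mul
    (C * Real.exp (a * ‖x‖))).mono' ?_ (ae_of_all _ fun z => ?_)
  · exact (H.continuous.comp (by fun_prop)).aestronglyMeasurable
  · rw [Real.norm_eq_abs]
    refine (hb _).trans ?_
    rw [mul_assoc, ← Real.exp_add]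
    gcongr
    have : ‖x - s • z‖ ≤ ‖x‖ + |s| * ‖z‖ := by
      refine (norm_sub_le _ _).trans ?_
      rw [norm_smul, Real.norm_eq_abs]
    nlinarith

/-- The Gaussian average is insensitive to the degeneration of the kernel at `t = 0`, so dominated
convergence gives continuity up to the initial time. -/
lemma TameFun.continuousOn_heatFlow {g : Plane → ℝ} (hg : TameFun g) (m : ℝ) :
    ContinuousOn (fun p : ℝ × Plane => heatFlow m p.1 g p.2) (Set.Ici 0 ×ˢ Set.univ) := by
  have h1 : Continuous fun p : ℝ × Plane =>
      Real.exp (m * p.1) * ∫ z, g (p.2 - Real.sqrt p.1 • z) ∂gaussPlane := by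
    refine (by fun_prop : Continuous fun p : ℝ × Plane => Real.exp (m * p.1)).mul ?_
    rw [continuous_iff_continuousAt]
    intro p₀
    obtain ⟨C, hC, a, ha, hb⟩ := hg.bound
    have hs : Continuous fun p : ℝ × Plane => Real.sqrt p.1 :=
      Real.continuous_sqrt.comp continuous_fst
    refine continuousAt_of_dominated
      (bound := fun z => C * Real.exp (a * (‖p₀.2‖ + 1)) *
        Real.exp (a * (Real.sqrt p₀.1 + 1) * ‖z‖)) ?_ ?_ ?_ ?_
    · exact Filter.Eventually.of_forall fun p =>
        (hg.continuous.comp (by fun_prop)).aestronglyMeasurable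
    · have e1 : ∀ᶠ p : ℝ × Plane in nhds p₀, ‖p.2‖ < ‖p₀.2‖ + 1 :=
        (continuous_snd.norm.continuousAt).eventually_lt_const (by simp)
      have e2 : ∀ᶠ p : ℝ × Plane in nhds p₀, Real.sqrt p.1 < Real.sqrt p₀.1 + 1 :=
        hs.continuousAt.eventually_lt_const (by simp)
      filter_upwards [e1, e2] with p hp1 hp2
      refine ae_of_all _ fun z => ?_
      rw [Real.norm_eq_abs]
      refine (hb _).trans ?_
      rw [mul_assoc, ← Real.exp_add]
      gcongr
      have : ‖p.2 - Real.sqrt p.1 • z‖ ≤ ‖p.2‖ + Real.sqrt p.1 * ‖z‖ := by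
        refine (norm_sub_le _ _).trans ?_
        rw [norm_smul, Real.norm_of_nonneg (Real.sqrt_nonneg _)]
      have h3 : Real.sqrt p.1 * ‖z‖ ≤ (Real.sqrt p₀.1 + 1) * ‖z‖ := by gcongr
      have : ‖p.2 - Real.sqrt p.1 • z‖ ≤ ‖p₀.2‖ + 1 + (Real.sqrt p₀.1 + 1) * ‖z‖ := by linarith
      calc _ ≤ a * (‖p₀.2‖ + 1 + (Real.sqrt p₀.1 + 1) * ‖z‖) := by gcongr
        _ = _ := by ring
    · exact (integrable_exp_norm_gaussPlane _).const_mul _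
    · refine ae_of_all _ fun z => (hg.continuous.comp ?_).continuousAt
      fun_prop
  exact h1.continuousOn.congr fun p hp => heatFlow_eq_integral_gaussPlane m hp.1 g p.2

lemma TameFun.expGrowth_heatFlow {g : Plane → ℝ} (hg : TameFun g) (m : ℝ) :
    ExpGrowth fun t => heatFlow m t g := by
  intro T
  obtain ⟨C, hC, a, ha, hb⟩ := hg.bound
  refine ⟨a, ha, Real.exp (|m| * T) * (C * ∫ z, Real.exp (a * Real.sqrt T * ‖z‖) ∂gaussPlane),
    fun t ht x => ?_⟩
  beta_reduce
  rw [heatFlow_eq_integral_gaussPlane m ht.1, abs_mul, abs_of_pos (Real.exp_pos _), mul_assoc]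
  refine mul_le_mul (Real.exp_le_exp.2 ?_) ?_ (abs_nonneg _) (Real.exp_nonneg _)
  · exact mul_le_mul (le_abs_self m) ht.2 ht.1 (abs_nonneg m)
  · rw [← Real.norm_eq_abs]
    have h1 := norm_integral_le_of_norm_le (f := fun z => g (x - Real.sqrt t • z))
      (((integrable_exp_norm_gaussPlane (a * Real.sqrt T)).const_mul C).const_mul
        (Real.exp (a * ‖x‖))) (ae_of_all _ fun z => ?_)
    · rw [integral_const_mul, integral_const_mul] at h1
      linarith
    · rw [Real.norm_eq_abs]
      refine (hb _).trans ?_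
      rw [mul_left_comm, ← Real.exp_add]
      gcongr
      have h2 : ‖x - Real.sqrt t • z‖ ≤ ‖x‖ + Real.sqrt t * ‖z‖ := by
        refine (norm_sub_le _ _).trans ?_
        rw [norm_smul, Real.norm_of_nonneg (Real.sqrt_nonneg _)]
      have h3 : Real.sqrt t * ‖z‖ ≤ Real.sqrt T * ‖z‖ := by
        gcongr; exact ht.2
      calc _ ≤ a * (‖x‖ + Real.sqrt T * ‖z‖) := by gcongr; linarith
        _ = _ := by ring

/-- The statistic `y ↦ ((α, β) ↦ -α |y|² + ⟨y, β⟩)` of the Gaussian family. -/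
def gaussStat (y : Plane) : ℝ × Plane →L[ℝ] ℝ :=
  (-‖y‖ ^ 2) • ContinuousLinearMap.fst ℝ ℝ Plane
    + (innerSL ℝ y).comp (ContinuousLinearMap.snd ℝ ℝ Plane)

lemma gaussStat_apply (y : Plane) (θ : ℝ × Plane) :
    gaussStat y θ = -θ.1 * ‖y‖ ^ 2 + inner ℝ y θ.2 := by
  simp [gaussStat]; ring

lemma continuous_gaussStat : Continuous gaussStat := by
  unfold gaussStat
  refine ((continuous_norm.pow 2).neg.smul continuous_const).add ?_
  exact ((innerSL ℝ (E := Plane)).continuous).clm_comp continuous_const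

lemma norm_gaussStat_le (y : Plane) : ‖gaussStat y‖ ≤ ‖y‖ ^ 2 + ‖y‖ := by
  refine ContinuousLinearMap.opNorm_le_bound _ (by positivity) fun θ => ?_
  rw [gaussStat_apply, Real.norm_eq_abs]
  have h1 : |θ.1| ≤ ‖θ‖ := norm_fst_le θ
  have h2 : |inner ℝ y θ.2| ≤ ‖y‖ * ‖θ‖ :=
    (abs_real_inner_le_norm _ _).trans (by gcongr; exact norm_snd_le θ)
  calc |-θ.1 * ‖y‖ ^ 2 + inner ℝ y θ.2| ≤ |-θ.1 * ‖y‖ ^ 2| + |inner ℝ y θ.2| := abs_add_le _ _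
    _ ≤ ‖θ‖ * ‖y‖ ^ 2 + ‖y‖ * ‖θ‖ := by
      rw [abs_mul, abs_neg, abs_of_nonneg (by positivity : 0 ≤ ‖y‖ ^ 2)]
      gcongr
    _ = _ := by ring

/-- The margin `θ.1 / 2` spends half of the quadratic decay; what is left still beats every linear
exponent. -/
lemma TameFun.expIntegrableAt {h : Plane → ℝ} (H : TameFun h) {θ : ℝ × Plane} (hθ : 0 < θ.1) :
    ExpIntegrableAt volume gaussStat h θ := by
  obtain ⟨C, hC, a, ha, hb⟩ := H.bound
  refine ⟨θ.1 / 2, by positivity, ((integrable_exp_neg_mul_sq_norm_add (half_pos hθ)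
    (‖θ.2‖ + θ.1 / 2 + a)).const_mul C).mono' ?_ (ae_of_all _ fun y => ?_)⟩
  · have h1 : Continuous fun y => gaussStat y θ := continuous_gaussStat.clm_apply continuous_const
    exact ((Real.continuous_exp.comp (h1.add (continuous_const.mul
      continuous_gaussStat.norm))).mul H.continuous.norm).aestronglyMeasurable
  · rw [Real.norm_eq_abs, abs_of_nonneg (by positivity), Real.norm_eq_abs]
    have h1 : θ.1 / 2 * ‖gaussStat y‖ ≤ θ.1 / 2 * (‖y‖ ^ 2 + ‖y‖) := by
      gcongr; exact norm_gaussStat_le y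
    have h2 : inner ℝ y θ.2 ≤ ‖y‖ * ‖θ.2‖ := real_inner_le_norm _ _
    calc Real.exp (gaussStat y θ + θ.1 / 2 * ‖gaussStat y‖) * |h y|
        ≤ Real.exp (-(θ.1 / 2) * ‖y‖ ^ 2 + (‖θ.2‖ + θ.1 / 2) * ‖y‖)
          * (C * Real.exp (a * ‖y‖)) := by
          refine mul_le_mul (Real.exp_le_exp.2 ?_) (hb y) (abs_nonneg _) (Real.exp_nonneg _)
          rw [gaussStat_apply]; linarith
      _ = _ := by
        rw [mul_left_comm, ← Real.exp_add]; congr 2; ring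

/-- The unnormalised heat flow as an exponential integral. -/
def heatExp (h : Plane → ℝ) (t : ℝ) (x : Plane) : ℝ :=
  expIntegral volume gaussStat h (1 / (2 * t), t⁻¹ • x)

/-- Expanding `|x - y|²` leaves `(t, x)` in the integral only through the natural parameters
`1/(2t)` and `x/t`. Joint smoothness in `(t, x)` and all derivatives then follow from those of
exponential integrals. -/
lemma heatFlow_eq_heatExp (m : ℝ) {t : ℝ} (ht : 0 < t) (g : Plane → ℝ) (x : Plane) :
    heatFlow m t g x = Real.exp (m * t) * (heatKernel t x * heatExp g t x) := by
  rw [heatFlow, if_neg ht.ne', heatExp, expIntegral, ← integral_const_mul, ← integral_const_mul]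
  refine integral_congr_ae (ae_of_all _ fun y => ?_)
  simp only [massHeatKernel, heatKernel, gaussStat_apply, smul_eq_mul]
  rw [norm_sub_sq_real, inner_smul_right, real_inner_comm]
  have h1 : Real.exp (-(‖x‖ ^ 2 - 2 * inner ℝ y x + ‖y‖ ^ 2) / (2 * t))
      = Real.exp (-‖x‖ ^ 2 / (2 * t)) *
        Real.exp (-(1 / (2 * t)) * ‖y‖ ^ 2 + t⁻¹ * inner ℝ y x) := by
    rw [← Real.exp_add]; congr 1; field_simp; ring
  rw [real_inner_comm] at h1 ⊢
  rw [h1]; ring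

lemma TameFun.hasDerivAt_heatExp_line {h : Plane → ℝ} (H : TameFun h) {t : ℝ} (ht : 0 < t)
    (x : Plane) (i : Fin 2) (r : ℝ) :
    HasDerivAt (fun r : ℝ => heatExp h t (x + r • stdVec i))
      (t⁻¹ * heatExp (fun y => y i * h y) t (x + r • stdVec i)) r := by
  obtain ⟨L, hL, hLv⟩ := hasFDerivAt_expIntegral_apply (μ := volume) (S := gaussStat) (h := h)
    (θ := (1 / (2 * t), t⁻¹ • (x + r • stdVec i))) continuous_gaussStat.aestronglyMeasurable
    H.continuous.aestronglyMeasurable (H.expIntegrableAt (by positivity))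
  have hp : HasDerivAt (fun r : ℝ => ((1 / (2 * t), t⁻¹ • (x + r • stdVec i)) : ℝ × Plane))
      (0, t⁻¹ • stdVec i) r := by
    refine (hasDerivAt_const r (1 / (2 * t))).prodMk ?_
    have h1 : HasDerivAt (fun r : ℝ => x + r • stdVec i) (stdVec i) r := by
      simpa using ((hasDerivAt_id r).smul_const (stdVec i)).const_add x
    exact h1.const_smul t⁻¹
  refine (hL.comp_hasDerivAt r hp).congr_deriv ?_
  rw [hLv, heatExp, expIntegral, expIntegral, ← integral_const_mul]
  refine integral_congr_ae (ae_of_all _ fun y => ?_)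
  simp only [gaussStat_apply, inner_smul_right, stdVec, smul_eq_mul]
  rw [EuclideanSpace.inner_single_right]
  simp
  ring

lemma TameFun.integrable_heatExp {h : Plane → ℝ} (H : TameFun h) {t : ℝ} (ht : 0 < t)
    (x : Plane) :
    Integrable (fun y => Real.exp (gaussStat y (1 / (2 * t), t⁻¹ • x)) • h y) :=
  (H.expIntegrableAt (θ := (1 / (2 * t), t⁻¹ • x)) (by positivity)).integrable
    continuous_gaussStat.aestronglyMeasurable H.continuous.aestronglyMeasurable

lemma TameFun.hasDerivAt_heatExp_time {h : Plane → ℝ} (H : TameFun h) {t : ℝ} (ht : 0 < t)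
    (x : Plane) :
    HasDerivAt (fun s : ℝ => heatExp h s x)
      (∑ i, (1 / (2 * t ^ 2) * heatExp (fun y => y i * (y i * h y)) t x
        - x i / t ^ 2 * heatExp (fun y => y i * h y) t x)) t := by
  obtain ⟨L, hL, hLv⟩ := hasFDerivAt_expIntegral_apply (μ := volume) (S := gaussStat) (h := h)
    (θ := (1 / (2 * t), t⁻¹ • x)) continuous_gaussStat.aestronglyMeasurable
    H.continuous.aestronglyMeasurable (H.expIntegrableAt (by positivity))
  have hp : HasDerivAt (fun s : ℝ => ((1 / (2 * s), s⁻¹ • x) : ℝ × Plane))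
      (-(1 / (2 * t ^ 2)), (-(t ^ 2)⁻¹) • x) t := by
    refine HasDerivAt.prodMk ?_ ((hasDerivAt_inv ht.ne').smul_const x)
    have h1 : HasDerivAt (fun s : ℝ => 1 / 2 * s⁻¹) (1 / 2 * (-(t ^ 2)⁻¹)) t :=
      (hasDerivAt_inv ht.ne').const_mul _
    have h2 : (fun s : ℝ => 1 / 2 * s⁻¹) = fun s => 1 / (2 * s) := by
      funext s; rw [one_div, one_div, mul_inv]
    rw [h2] at h1
    exact h1.congr_deriv (by field_simp)
  refine (hL.comp_hasDerivAt t hp).congr_deriv ?_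
  rw [hLv]
  have hi : ∀ i, Integrable (fun y : Plane =>
      1 / (2 * t ^ 2) * (Real.exp (gaussStat y (1 / (2 * t), t⁻¹ • x)) • (y i * (y i * h y)))
      - x i / t ^ 2 * (Real.exp (gaussStat y (1 / (2 * t), t⁻¹ • x)) • (y i * h y))) := fun i =>
    ((((H.coord_mul i).coord_mul i).integrable_heatExp ht x).const_mul _).sub
      (((H.coord_mul i).integrable_heatExp ht x).const_mul _)
  have e : ∀ i, 1 / (2 * t ^ 2) * heatExp (fun y => y i * (y i * h y)) t x
        - x i / t ^ 2 * heatExp (fun y => y i * h y) t x = ∫ y : Plane,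
      (1 / (2 * t ^ 2) * (Real.exp (gaussStat y (1 / (2 * t), t⁻¹ • x)) • (y i * (y i * h y)))
      - x i / t ^ 2 * (Real.exp (gaussStat y (1 / (2 * t), t⁻¹ • x)) • (y i * h y))) := fun i => by
    rw [integral_sub ((((H.coord_mul i).coord_mul i).integrable_heatExp ht x).const_mul _)
      (((H.coord_mul i).integrable_heatExp ht x).const_mul _), integral_const_mul,
      integral_const_mul]
    rfl
  simp_rw [e]
  rw [← integral_finsetSum _ fun i _ => hi i, expIntegral]
  refine integral_congr_ae (ae_of_all _ fun y => ?_)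
  simp only [gaussStat_apply, smul_eq_mul, Fin.sum_univ_two, inner_smul_right]
  have h1 : ‖y‖ ^ 2 = y 0 ^ 2 + y 1 ^ 2 := by rw [EuclideanSpace.norm_sq_eq]; simp
  have h2 : inner ℝ y x = y 0 * x 0 + y 1 * x 1 := by
    rw [PiLp.inner_apply, Fin.sum_univ_two]; simp [mul_comm]
  rw [h1, h2]
  field_simp
  ring

lemma hasDerivAt_heatKernel_line {t : ℝ} (ht : 0 < t) (x : Plane) (i : Fin 2) (r : ℝ) :
    HasDerivAt (fun r : ℝ => heatKernel t (x + r • stdVec i))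
      (-(x i + r) / t * heatKernel t (x + r • stdVec i)) r := by
  have h0 : ∀ r : ℝ, ‖x + r • stdVec i‖ ^ 2 = ‖x‖ ^ 2 + (2 * x i * r + r ^ 2) := fun r => by
    rw [norm_add_sq_real, inner_smul_right, EuclideanSpace.inner_single_right, norm_smul, mul_pow]
    simp
    ring
  have h1 : HasDerivAt (fun r : ℝ => -‖x + r • stdVec i‖ ^ 2 / (2 * t))
      (-(2 * x i + 2 * r) / (2 * t)) r := by
    simp_rw [h0]
    have h3 : HasDerivAt (fun r : ℝ => 2 * x i * r + r ^ 2) (2 * x i + 2 * r) r := by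
      exact (((hasDerivAt_id r).const_mul (2 * x i)).add (hasDerivAt_pow 2 r)).congr_deriv
        (by simp)
    exact ((h3.const_add (‖x‖ ^ 2)).neg).div_const (2 * t)
  unfold heatKernel
  refine (h1.exp.const_mul (1 / (2 * Real.pi * t))).congr_deriv ?_
  field_simp

lemma hasDerivAt_heatKernel_time {t : ℝ} (ht : 0 < t) (x : Plane) :
    HasDerivAt (fun s : ℝ => heatKernel s x)
      ((‖x‖ ^ 2 / (2 * t ^ 2) - 1 / t) * heatKernel t x) t := by
  have h1 : HasDerivAt (fun s : ℝ => 1 / (2 * Real.pi * s)) (-1 / (2 * Real.pi * t ^ 2)) t := by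
    have := ((hasDerivAt_inv ht.ne').const_mul (1 / (2 * Real.pi)))
    have h2 : (fun s : ℝ => 1 / (2 * Real.pi) * s⁻¹) = fun s => 1 / (2 * Real.pi * s) := by
      funext s; rw [one_div, one_div, mul_inv (2 * Real.pi)]
    rw [h2] at this
    exact this.congr_deriv (by field_simp)
  have h3 : HasDerivAt (fun s : ℝ => -‖x‖ ^ 2 / (2 * s)) (‖x‖ ^ 2 / (2 * t ^ 2)) t := by
    have := ((hasDerivAt_inv ht.ne').const_mul (-‖x‖ ^ 2 / 2))
    have h2 : (fun s : ℝ => -‖x‖ ^ 2 / 2 * s⁻¹) = fun s => -‖x‖ ^ 2 / (2 * s) := by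
      funext s; rw [← div_eq_mul_inv, div_div]
    rw [h2] at this
    exact this.congr_deriv (by field_simp)
  unfold heatKernel
  refine (h1.mul h3.exp).congr_deriv ?_
  field_simp
  ring

lemma TameFun.contDiffOn_heatFlow {g : Plane → ℝ} (hg : TameFun g) (m : ℝ) :
    ContDiffOn ℝ (⊤ : ℕ∞) (fun p : ℝ × Plane => heatFlow m p.1 g p.2) (Set.Ioi 0 ×ˢ Set.univ) := by
  have h0 : ContDiffOn ℝ (⊤ : ℕ∞) (expIntegral volume gaussStat g) {θ | 0 < θ.1} :=
    contDiffOn_expIntegral continuous_gaussStat.aestronglyMeasurable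
      hg.continuous.aestronglyMeasurable fun θ hθ => hg.expIntegrableAt hθ
  have hne : ∀ p ∈ (Set.Ioi 0 ×ˢ Set.univ : Set (ℝ × Plane)), p.1 ≠ 0 := fun p hp =>
    (show 0 < p.1 from hp.1).ne'
  have h1 : ContDiffOn ℝ (⊤ : ℕ∞) (fun p : ℝ × Plane => ((1 / (2 * p.1), p.1⁻¹ • p.2) : ℝ × Plane))
      (Set.Ioi 0 ×ˢ Set.univ) := by
    refine ContDiffOn.prodMk ?_ ((contDiff_fst.contDiffOn.inv hne).smul contDiff_snd.contDiffOn)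
    exact contDiffOn_const.div (contDiff_const.mul contDiff_fst).contDiffOn
      fun p hp => mul_ne_zero two_ne_zero (hne p hp)
  have h2 : ContDiffOn ℝ (⊤ : ℕ∞) (fun p : ℝ × Plane => heatExp g p.1 p.2)
      (Set.Ioi 0 ×ˢ Set.univ) :=
    h0.comp h1 fun p hp => by
      have : 0 < p.1 := hp.1
      simp only [Set.mem_ofPred_eq]; positivity
  have h3 : ContDiffOn ℝ (⊤ : ℕ∞) (fun p : ℝ × Plane => heatKernel p.1 p.2)
      (Set.Ioi 0 ×ˢ Set.univ) := by
    unfold heatKernel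
    refine ContDiffOn.mul ?_ (Real.contDiff_exp.comp_contDiffOn ?_)
    · exact contDiffOn_const.div (contDiff_const.mul contDiff_fst).contDiffOn
        fun p hp => mul_ne_zero (by positivity) (hne p hp)
    · exact (((contDiff_norm_sq ℝ).comp contDiff_snd).neg).contDiffOn.div
        (contDiff_const.mul contDiff_fst).contDiffOn
        fun p hp => mul_ne_zero two_ne_zero (hne p hp)
  have h4 : ContDiffOn ℝ (⊤ : ℕ∞) (fun p : ℝ × Plane => Real.exp (m * p.1))
      (Set.Ioi 0 ×ˢ Set.univ) :=
    (Real.contDiff_exp.comp (contDiff_const.mul contDiff_fst)).contDiffOn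
  exact (h4.mul (h3.mul h2)).congr fun p hp => heatFlow_eq_heatExp m hp.1 g p.2

lemma TameFun.contDiff_heatFlow {g : Plane → ℝ} (hg : TameFun g) (m : ℝ) {t : ℝ} (ht : 0 < t) :
    ContDiff ℝ (⊤ : ℕ∞) (heatFlow m t g) := by
  have h1 : ContDiff ℝ (⊤ : ℕ∞) fun x : Plane => (t, x) := contDiff_prodMk_right t
  rw [← contDiffOn_univ]
  exact (hg.contDiffOn_heatFlow m).comp h1.contDiffOn fun x _ => ⟨ht, Set.mem_univ _⟩

/-- The heat flow solves the massive heat equation. -/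
lemma TameFun.hasDerivAt_heatFlow {g : Plane → ℝ} (hg : TameFun g) (m : ℝ) {t : ℝ} (ht : 0 < t)
    (x : Plane) : HasDerivAt (fun s => heatFlow m s g x)
      (1 / 2 * (Δ (heatFlow m t g)) x + m * heatFlow m t g x) t := by
  set E := Real.exp (m * t) with hE
  have hd : ∀ i (r : ℝ), HasDerivAt (fun r : ℝ => heatFlow m t g (x + r • stdVec i))
      (E * (-(x i + r) / t * heatKernel t (x + r • stdVec i) * heatExp g t (x + r • stdVec i)
        + heatKernel t (x + r • stdVec i)
          * (t⁻¹ * heatExp (fun y => y i * g y) t (x + r • stdVec i)))) r := fun i r => by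
    simp_rw [heatFlow_eq_heatExp m ht]
    exact ((hasDerivAt_heatKernel_line ht x i r).mul
      (hg.hasDerivAt_heatExp_line ht x i r)).const_mul _
  have hdd : ∀ i, HasDerivAt (fun r : ℝ =>
      (E * (-(x i + r) / t * heatKernel t (x + r • stdVec i) * heatExp g t (x + r • stdVec i)
        + heatKernel t (x + r • stdVec i)
          * (t⁻¹ * heatExp (fun y => y i * g y) t (x + r • stdVec i)))))
      (E * heatKernel t x * ((x i ^ 2 / t ^ 2 - 1 / t) * heatExp g t x
        - 2 * x i / t ^ 2 * heatExp (fun y => y i * g y) t x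
        + 1 / t ^ 2 * heatExp (fun y => y i * (y i * g y)) t x)) 0 := fun i => by
    have k1 := hasDerivAt_heatKernel_line ht x i 0
    have k2 := hg.hasDerivAt_heatExp_line ht x i 0
    have k3 := (hg.coord_mul i).hasDerivAt_heatExp_line ht x i 0
    have k4 : HasDerivAt (fun r : ℝ => -(x i + r) / t) (-1 / t) 0 := by
      simpa using (((hasDerivAt_id (0 : ℝ)).const_add (x i)).neg).div_const t
    refine ((((k4.mul k1).mul k2).add (k1.mul (k3.const_mul t⁻¹))).const_mul E).congr_deriv ?_
    simp only [Pi.mul_apply, zero_smul, add_zero]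
    field_simp
    ring
  have hlap : (Δ (heatFlow m t g)) x = ∑ i, (E * heatKernel t x *
      ((x i ^ 2 / t ^ 2 - 1 / t) * heatExp g t x
        - 2 * x i / t ^ 2 * heatExp (fun y => y i * g y) t x
        + 1 / t ^ 2 * heatExp (fun y => y i * (y i * g y)) t x)) :=
    laplacian_eq_sum_of_hasDerivAt (contDiff_infty.1 (hg.contDiff_heatFlow m ht) 2)
      hd hdd
  have htime : HasDerivAt (fun s => Real.exp (m * s) * (heatKernel s x * heatExp g s x))
      (m * E * (heatKernel t x * heatExp g t x) + E *
        ((‖x‖ ^ 2 / (2 * t ^ 2) - 1 / t) * heatKernel t x * heatExp g t x + heatKernel t x *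
          (∑ i, (1 / (2 * t ^ 2) * heatExp (fun y => y i * (y i * g y)) t x
        - x i / t ^ 2 * heatExp (fun y => y i * g y) t x)))) t := by
    have h1 : HasDerivAt (fun s : ℝ => Real.exp (m * s)) (m * E) t := by
      have h2 : HasDerivAt (fun s : ℝ => m * s) m t := by
        simpa using (hasDerivAt_id t).const_mul m
      exact h2.exp.congr_deriv (mul_comm _ _)
    exact h1.mul ((hasDerivAt_heatKernel_time ht x).mul (hg.hasDerivAt_heatExp_time ht x))
  have hcongr : (fun s => heatFlow m s g x) =ᶠ[nhds t]
      fun s => Real.exp (m * s) * (heatKernel s x * heatExp g s x) := by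
    filter_upwards [lt_mem_nhds ht] with s hs using heatFlow_eq_heatExp m hs g x
  refine (htime.congr_of_eventuallyEq hcongr).congr_deriv ?_
  -- Both sides are now combinations of `heatExp` for the weights `g`, `y i * g` and `y i * (y i *
  -- g)`, and the coefficients agree.
  rw [hlap, heatFlow_eq_heatExp m ht]
  have h1 : ‖x‖ ^ 2 = x 0 ^ 2 + x 1 ^ 2 := by rw [EuclideanSpace.norm_sq_eq]; simp
  simp only [Fin.sum_univ_two]
  rw [h1]
  field_simp
  ring

/-! ### Mollified tempered distributions -/

lemma exists_bound_schwartz (φ : 𝓢(Plane, ℝ)) (k n : ℕ) :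
    ∃ A ≥ 0, ∀ z, (1 + ‖z‖) ^ k * ‖iteratedFDeriv ℝ n φ z‖ ≤ A :=
  ⟨2 ^ k * ((Finset.Iic (k, n)).sup fun m => SchwartzMap.seminorm ℝ m.1 m.2) φ, by positivity,
    fun z => SchwartzMap.one_add_le_sup_seminorm_apply (𝕜 := ℝ) (m := (k, n)) le_rfl le_rfl φ z⟩

lemma norm_pow_le_mul (y x : Plane) {ρ : ℝ} (hx : ‖x‖ ≤ ρ) (k : ℕ) :
    ‖y‖ ^ k ≤ (1 + ρ) ^ k * (1 + ‖y - x‖) ^ k := by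
  rw [← mul_pow]
  refine pow_le_pow_left₀ (norm_nonneg _) ?_ _
  have h1 : ‖y‖ ≤ ‖y - x‖ + ‖x‖ := by simpa using norm_add_le (y - x) x
  nlinarith [norm_nonneg (y - x), norm_nonneg x]

lemma coe_compSubConstCLM (φ : 𝓢(Plane, ℝ)) (x : Plane) :
    ⇑(SchwartzMap.compSubConstCLM ℝ x φ) = fun y => φ (y - x) := rfl

/-- The growth in `x` is in fact polynomial, of degree `k`; the exponential form makes it uniform
over the seminorms. -/
lemma exists_seminorm_translate_le (φ : 𝓢(Plane, ℝ)) (k n : ℕ) :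
    ∃ A ≥ 0, ∀ x, SchwartzMap.seminorm ℝ k n (SchwartzMap.compSubConstCLM ℝ x φ)
      ≤ A * Real.exp ‖x‖ := by
  obtain ⟨A, hA, hb⟩ := exists_bound_schwartz φ k n
  refine ⟨A * (k.factorial * Real.exp 1), by positivity, fun x => ?_⟩
  have h1 : (1 + ‖x‖) ^ k ≤ k.factorial * Real.exp 1 * Real.exp ‖x‖ := by
    have := Real.pow_div_factorial_le_exp (1 + ‖x‖) (by positivity) k
    rw [div_le_iff₀ (by positivity), Real.exp_add] at this
    linarith
  refine SchwartzMap.seminorm_le_bound ℝ k n _ (by positivity) fun y => ?_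
  rw [coe_compSubConstCLM, iteratedFDeriv_comp_sub]
  calc ‖y‖ ^ k * ‖iteratedFDeriv ℝ n φ (y - x)‖
      ≤ ((1 + ‖x‖) ^ k * (1 + ‖y - x‖) ^ k) * ‖iteratedFDeriv ℝ n φ (y - x)‖ := by
        gcongr; exact norm_pow_le_mul y x le_rfl k
    _ = (1 + ‖x‖) ^ k * ((1 + ‖y - x‖) ^ k * ‖iteratedFDeriv ℝ n φ (y - x)‖) := by ring
    _ ≤ (k.factorial * Real.exp 1 * Real.exp ‖x‖) * A := by
      gcongr; exact hb _
    _ = _ := by ring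

/-- Mean value inequality for the `n`-th derivative along the segment from `y - x₀` to `y - x`,
costing one more derivative. It makes translation continuous into the Schwartz space, hence
mollified distributions continuous. -/
lemma exists_seminorm_translate_sub_le (φ : 𝓢(Plane, ℝ)) (k n : ℕ) :
    ∃ A ≥ 0, ∀ x x₀, SchwartzMap.seminorm ℝ k n
      (SchwartzMap.compSubConstCLM ℝ x φ - SchwartzMap.compSubConstCLM ℝ x₀ φ)
      ≤ A * (1 + (‖x‖ + ‖x₀‖)) ^ k * ‖x - x₀‖ := by
  obtain ⟨A, hA, hb⟩ := exists_bound_schwartz φ k (n + 1)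
  refine ⟨A, hA, fun x x₀ => ?_⟩
  refine SchwartzMap.seminorm_le_bound ℝ k n _ (by positivity) fun y => ?_
  have e : ⇑(SchwartzMap.compSubConstCLM ℝ x φ - SchwartzMap.compSubConstCLM ℝ x₀ φ)
      = (fun y => φ (y - x)) - fun y => φ (y - x₀) := rfl
  have hs : ∀ x : Plane, ContDiffAt ℝ n (fun y => φ (y - x)) y := fun x =>
    ((φ.smooth n).comp (contDiff_id.sub contDiff_const)).contDiffAt
  rw [e, iteratedFDeriv_sub_apply (hs x) (hs x₀), iteratedFDeriv_comp_sub,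
    iteratedFDeriv_comp_sub]
  have hdiff : Differentiable ℝ (iteratedFDeriv ℝ n φ) :=
    (φ.smooth (n + 1)).differentiable_iteratedFDeriv (by exact_mod_cast Nat.lt_succ_self n)
  have hmv := (convex_segment (𝕜 := ℝ) (y - x₀) (y - x)).norm_image_sub_le_of_norm_fderiv_le (𝕜 := ℝ)
    (f := fun z => ‖y‖ ^ k • iteratedFDeriv ℝ n φ z) (C := A * (1 + (‖x‖ + ‖x₀‖)) ^ k)
    (fun z _ => (hdiff z).const_smul (‖y‖ ^ k)) (fun z hz => ?_) (left_mem_segment ℝ _ _)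
    (right_mem_segment ℝ _ _)
  · rw [← smul_sub, norm_smul, Real.norm_of_nonneg (by positivity : 0 ≤ ‖y‖ ^ k)] at hmv
    refine hmv.trans_eq ?_
    rw [sub_sub_sub_cancel_left, norm_sub_rev]
  · rw [fderiv_fun_const_smul (hdiff z), norm_smul, norm_fderiv_iteratedFDeriv,
      Real.norm_of_nonneg (by positivity : 0 ≤ ‖y‖ ^ k)]
    obtain ⟨ξ, hξ, rfl⟩ : ∃ ξ : Plane, ‖ξ‖ ≤ ‖x‖ + ‖x₀‖ ∧ y - ξ = z := by
      obtain ⟨a, b, ha, hb, hab, rfl⟩ := hz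
      refine ⟨a • x₀ + b • x, ?_, ?_⟩
      · refine (norm_add_le _ _).trans ?_
        rw [norm_smul, norm_smul, Real.norm_of_nonneg ha, Real.norm_of_nonneg hb]
        nlinarith [norm_nonneg x, norm_nonneg x₀]
      · have : y = a • y + b • y := by rw [← add_smul, hab, one_smul]
        nth_rewrite 1 [this]
        rw [smul_sub, smul_sub]; abel
    calc ‖y‖ ^ k * ‖iteratedFDeriv ℝ (n + 1) φ (y - ξ)‖
        ≤ ((1 + (‖x‖ + ‖x₀‖)) ^ k * (1 + ‖y - ξ‖) ^ k)
          * ‖iteratedFDeriv ℝ (n + 1) φ (y - ξ)‖ := by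
          gcongr; exact norm_pow_le_mul y ξ hξ k
      _ = (1 + (‖x‖ + ‖x₀‖)) ^ k * ((1 + ‖y - ξ‖) ^ k
          * ‖iteratedFDeriv ℝ (n + 1) φ (y - ξ)‖) := by ring
      _ ≤ (1 + (‖x‖ + ‖x₀‖)) ^ k * A := by
        gcongr; exact hb _
      _ = _ := by ring

/-- A tempered distribution has finite order. The sum replaces the supremum of the seminorms so that
it can be estimated term by term. -/
lemma exists_abs_le_sum_seminorm (T : 𝓢(Plane, ℝ) →L[ℝ] ℝ) :
    ∃ s : Finset (ℕ × ℕ), ∃ C ≥ (0 : ℝ), ∀ ψ,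
      |T ψ| ≤ C * ∑ i ∈ s, SchwartzMap.seminorm ℝ i.1 i.2 ψ := by
  obtain ⟨s, C, -, hC⟩ := Seminorm.bound_of_continuous (schwartz_withSeminorms ℝ Plane ℝ)
    ((normSeminorm ℝ ℝ).comp T.toLinearMap) (continuous_norm.comp T.continuous)
  refine ⟨s, C, C.2, fun ψ => ?_⟩
  have h1 := hC ψ
  have h2 : (s.sup (schwartzSeminormFamily ℝ Plane ℝ)) ψ
      ≤ ∑ i ∈ s, SchwartzMap.seminorm ℝ i.1 i.2 ψ := by
    refine Seminorm.finset_sup_apply_le (Finset.sum_nonneg fun i _ => apply_nonneg _ _)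
      fun i hi => ?_
    exact Finset.single_le_sum (f := fun i : ℕ × ℕ => SchwartzMap.seminorm ℝ i.1 i.2 ψ)
      (fun i _ => apply_nonneg _ _) hi
  calc |T ψ| ≤ C * (s.sup (schwartzSeminormFamily ℝ Plane ℝ)) ψ := h1
    _ ≤ _ := by gcongr

lemma tameFun_apply_translate (T : 𝓢(Plane, ℝ) →L[ℝ] ℝ) (φ : 𝓢(Plane, ℝ)) :
    TameFun fun x => T (SchwartzMap.compSubConstCLM ℝ x φ) := by
  obtain ⟨s, C, hC, hT⟩ := exists_abs_le_sum_seminorm T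
  constructor
  · choose A hA hb using fun i : ℕ × ℕ => exists_seminorm_translate_sub_le φ i.1 i.2
    rw [continuous_iff_continuousAt]
    intro x₀
    rw [ContinuousAt, tendsto_iff_norm_sub_tendsto_zero]
    have hlim : Filter.Tendsto (fun x : Plane =>
        C * ∑ i ∈ s, A i * (1 + (‖x‖ + ‖x₀‖)) ^ i.1 * ‖x - x₀‖) (nhds x₀) (nhds 0) := by
      have hc : Continuous fun x : Plane =>
          C * ∑ i ∈ s, A i * (1 + (‖x‖ + ‖x₀‖)) ^ i.1 * ‖x - x₀‖ := by fun_prop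
      simpa using hc.tendsto x₀
    refine squeeze_zero (fun x => norm_nonneg _) (fun x => ?_) hlim
    rw [← map_sub, Real.norm_eq_abs]
    refine (hT _).trans ?_
    gcongr with i
    exact hb i x x₀
  · choose A hA hb using fun i : ℕ × ℕ => exists_seminorm_translate_le φ i.1 i.2
    refine ⟨C * ∑ i ∈ s, A i, mul_nonneg hC (Finset.sum_nonneg fun i _ => hA i), 1, one_pos,
      fun x => ?_⟩
    refine (hT _).trans ?_
    rw [mul_assoc, Finset.sum_mul, one_mul]
    gcongr with i
    exact hb i x

lemma tameFun_mollify (ε : ℝ) (hε : 0 < ε) (T : 𝓢(Plane, ℝ) →L[ℝ] ℝ) :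
    TameFun (mollify ε hε T) :=
  tameFun_apply_translate T _

/-! ### Random continuous functions -/

section Probability

variable {Ω : Type*} [MeasurableSpace Ω] {P : Measure Ω}

/-- A random continuous function with measurable values has a version that is jointly
measurable. -/
lemma exists_measurable_version {X : Ω → Plane → ℝ} (hm : ∀ y, AEMeasurable (fun ω => X ω y) P)
    (hc : ∀ ω, Continuous (X ω)) :
    ∃ X' : Ω → Plane → ℝ, Measurable (Function.uncurry X') ∧ (∀ ω, Continuous (X' ω)) ∧
      ∀ᵐ ω ∂P, X' ω = X ω := by
  classical
  set d := TopologicalSpace.denseSeq Plane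
  -- On a countable dense set the exceptional events can be united into one null set. Paths are set
  -- to zero there, and continuity recovers measurability at every other point as a limit.
  set N₀ : Set Ω := {ω | ∃ n, X ω (d n) ≠ (hm (d n)).mk _ ω} with hN₀
  have hN₀0 : P N₀ = 0 := by
    have h1 : ∀ᵐ ω ∂P, ∀ n, X ω (d n) = (hm (d n)).mk _ ω :=
      ae_all_iff.2 fun n => (hm (d n)).ae_eq_mk
    have h2 := ae_iff.1 h1
    simpa [hN₀, not_forall] using h2
  set N := toMeasurable P N₀
  have hN : MeasurableSet N := measurableSet_toMeasurable _ _
  have hN0 : P N = 0 := by rw [measure_toMeasurable]; exact hN₀0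
  set X' : Ω → Plane → ℝ := fun ω y => if ω ∈ N then 0 else X ω y with hX'
  have hc' : ∀ ω, Continuous (X' ω) := fun ω => by
    by_cases h : ω ∈ N
    · simpa [hX', h] using continuous_const
    · simpa [hX', h] using hc ω
  have hmd : ∀ n, Measurable fun ω => X' ω (d n) := fun n => by
    have : (fun ω => X' ω (d n)) = fun ω => if ω ∈ N then 0 else (hm (d n)).mk _ ω := by
      funext ω
      by_cases h : ω ∈ N
      · simp [hX', h]
      · simp only [hX', h, if_false]
        by_contra hne
        exact h (subset_toMeasurable P N₀ ⟨n, hne⟩)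
    rw [this]
    exact Measurable.ite hN measurable_const (hm (d n)).measurable_mk
  have hmy : ∀ y, Measurable fun ω => X' ω y := fun y => by
    obtain ⟨s, hs, hlim⟩ := mem_closure_iff_seq_limit.1 (TopologicalSpace.denseRange_denseSeq Plane y)
    choose k hk using hs
    refine measurable_of_tendsto_metrizable (f := fun j ω => X' ω (s j)) (fun j => ?_) ?_
    · rw [← hk j]; exact hmd _
    · rw [tendsto_pi_nhds]
      exact fun ω => ((hc' ω).tendsto y).comp hlim
  refine ⟨X', ?_, hc', ?_⟩
  · have := measurable_uncurry_of_continuous_of_measurable (u := fun y ω => X' ω y)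
      (fun ω => hc' ω) hmy
    exact this.comp measurable_swap
  · have : ∀ᵐ ω ∂P, ω ∉ N := measure_eq_zero_iff_ae_notMem.1 hN0
    filter_upwards [this] with ω hω
    funext y
    simp [hX', hω]

/-- The moments `E (1+|Z|)^p` of a centred Gaussian with variance `v`. -/
def gaussMoment (v : NNReal) (p : ℕ) : ℝ := ∫ z, (1 + |z|) ^ p ∂gaussianReal 0 v

lemma integrable_one_add_abs_pow_gaussianReal (v : NNReal) (p : ℕ) :
    Integrable (fun z => (1 + |z|) ^ p) (gaussianReal 0 v) := by
  have h0 : MemLp (fun z : ℝ => |z|) p (gaussianReal 0 v) :=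
    (memLp_id_gaussianReal' (μ := 0) (v := v) p (by simp)).norm
  have h1 : MemLp (fun z : ℝ => 1 + |z|) p (gaussianReal 0 v) :=
    (memLp_const (1 : ℝ)).add h0
  have := h1.integrable_norm_pow'
  refine this.congr (ae_of_all _ fun z => ?_)
  simp only [Real.norm_eq_abs]
  rw [abs_of_nonneg (by positivity)]

lemma integrable_one_add_abs_pow {X : Ω → ℝ} {v : NNReal} (hX : HasLaw X (gaussianReal 0 v) P)
    (p : ℕ) : Integrable (fun ω => (1 + |X ω|) ^ p) P := by
  have h := integrable_one_add_abs_pow_gaussianReal v p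
  rw [← hX.map_eq] at h
  exact h.comp_aemeasurable hX.aemeasurable

lemma integral_one_add_abs_pow {X : Ω → ℝ} {v : NNReal} (hX : HasLaw X (gaussianReal 0 v) P)
    (p : ℕ) : ∫ ω, (1 + |X ω|) ^ p ∂P = gaussMoment v p :=
  hX.integral_comp (f := fun z => (1 + |z|) ^ p)
    (integrable_one_add_abs_pow_gaussianReal v p).aestronglyMeasurable

/-- A random field of continuous functions of exponential growth all of whose values have the same
centred Gaussian law. -/
structure IsTameField (P : Measure Ω) (v : NNReal) (X : Ω → Plane → ℝ) : Prop where
  tame : ∀ ω, TameFun (X ω)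
  law : ∀ y, HasLaw (fun ω => X ω y) (gaussianReal 0 v) P

/-- The Gaussian average of the modulus of a random field. -/
def absAverage {Ω : Type*} (X : Ω → Plane → ℝ) (t : ℝ) (x : Plane) (ω : Ω) : ℝ :=
  ∫ z, |X ω (x - Real.sqrt t • z)| ∂gaussPlane

lemma absAverage_nonneg {Ω : Type*} (X : Ω → Plane → ℝ) (t : ℝ) (x : Plane) (ω : Ω) :
    0 ≤ absAverage X t x ω := integral_nonneg fun _ => abs_nonneg _

variable [IsProbabilityMeasure P] {v : NNReal} {X : Ω → Plane → ℝ}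

lemma measurable_one_add_abs_pow (p : ℕ) : Measurable fun u : ℝ => (1 + |u|) ^ p :=
  (by fun_prop : Continuous fun u : ℝ => (1 + |u|) ^ p).measurable

/-- A jointly measurable version of the rescaled and recentred field. -/
lemma IsTameField.exists_shifted (hX : IsTameField P v X) (t : ℝ) (x : Plane) :
    ∃ Z : Ω → Plane → ℝ, Measurable (Function.uncurry Z) ∧
      (∀ z, HasLaw (fun ω => Z ω z) (gaussianReal 0 v) P) ∧
      (∀ᵐ ω ∂P, Z ω = fun z => X ω (x - Real.sqrt t • z)) ∧
      ∀ p : ℕ, Integrable (Function.uncurry fun ω z => (1 + |Z ω z|) ^ p)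
        (P.prod gaussPlane) := by
  obtain ⟨Z, hm, -, heq⟩ := exists_measurable_version (P := P)
    (X := fun ω z => X ω (x - Real.sqrt t • z)) (fun z => (hX.law _).aemeasurable)
    fun ω => (hX.tame ω).continuous.comp (by fun_prop)
  have hlaw : ∀ z, HasLaw (fun ω => Z ω z) (gaussianReal 0 v) P := fun z =>
    (hX.law (x - Real.sqrt t • z)).congr (by filter_upwards [heq] with ω hω; rw [hω])
  refine ⟨Z, hm, hlaw, heq, fun p => ?_⟩
  have hmeas : Measurable (Function.uncurry fun ω z => (1 + |Z ω z|) ^ p) :=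
    (measurable_one_add_abs_pow p).comp hm
  rw [integrable_prod_iff' hmeas.aestronglyMeasurable]
  refine ⟨ae_of_all _ fun z => integrable_one_add_abs_pow (hlaw z) p, ?_⟩
  have h1 : ∀ z, ∫ ω, ‖Function.uncurry (fun ω z => (1 + |Z ω z|) ^ p) (ω, z)‖ ∂P
      = gaussMoment v p := fun z => by
    rw [← integral_one_add_abs_pow (hlaw z) p]
    refine integral_congr_ae (ae_of_all _ fun ω => ?_)
    simp only [Function.uncurry_apply_pair]
    exact Real.norm_of_nonneg (by positivity)
  simp_rw [h1]
  exact integrable_const _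

lemma IsTameField.aestronglyMeasurable_average (hX : IsTameField P v X) (t : ℝ) (x : Plane) :
    AEStronglyMeasurable (fun ω => ∫ z, X ω (x - Real.sqrt t • z) ∂gaussPlane) P := by
  obtain ⟨Z, hm, -, heq, -⟩ := hX.exists_shifted t x
  refine (hm.stronglyMeasurable.integral_prod_right (ν := gaussPlane)).aestronglyMeasurable.congr ?_
  filter_upwards [heq] with ω hω
  rw [hω]

lemma IsTameField.aestronglyMeasurable_absAverage (hX : IsTameField P v X) (t : ℝ) (x : Plane) :
    AEStronglyMeasurable (absAverage X t x) P := by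
  obtain ⟨Z, hm, -, heq, -⟩ := hX.exists_shifted t x
  have h1 : Measurable (Function.uncurry fun ω z => |Z ω z|) :=
    continuous_abs.measurable.comp hm
  refine (h1.stronglyMeasurable.integral_prod_right (ν := gaussPlane)).aestronglyMeasurable.congr ?_
  filter_upwards [heq] with ω hω
  rw [hω, absAverage]

/-- Moment bounds for Gaussian averages, by Jensen's inequality. -/
lemma IsTameField.absAverage_moment (hX : IsTameField P v X) (t : ℝ) (x : Plane) (p : ℕ) :
    Integrable (fun ω => (1 + absAverage X t x ω) ^ p) P ∧
      ∫ ω, (1 + absAverage X t x ω) ^ p ∂P ≤ gaussMoment v p := by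
  obtain ⟨Z, hm, hlaw, heq, hint⟩ := hX.exists_shifted t x
  have hJ : ∀ᵐ ω ∂P, (1 + absAverage X t x ω) ^ p
      ≤ ∫ z, (1 + |Z ω z|) ^ p ∂gaussPlane := by
    filter_upwards [heq, (hint p).prod_right_ae] with ω hω hi
    have h1 : Integrable (fun z => |Z ω z|) gaussPlane := by
      rw [hω]; exact (hX.tame ω).abs.integrable_gaussPlane x _
    have h2 : 1 + absAverage X t x ω = ∫ z, (1 + |Z ω z|) ∂gaussPlane := by
      rw [integral_add (integrable_const _) h1, absAverage, hω]; simp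
    rw [h2]
    -- Jensen is applied for fixed `ω`, to the probability measure `gaussPlane`.
    exact (convexOn_pow p).map_integral_le (continuous_pow p).continuousOn isClosed_Ici
      (ae_of_all _ fun z => Set.mem_Ici.2 (by positivity)) ((integrable_const _).add h1) hi
  have hint2 := (hint p).integral_prod_left
  have hI : Integrable (fun ω => (1 + absAverage X t x ω) ^ p) P := by
    refine hint2.mono' ((aestronglyMeasurable_const.add
      (hX.aestronglyMeasurable_absAverage t x)).pow p) ?_
    filter_upwards [hJ] with ω hω
    rwa [Real.norm_of_nonneg (pow_nonneg (by linarith [absAverage_nonneg X t x ω]) _)]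
  refine ⟨hI, (integral_mono_ae hI hint2 hJ).trans_eq ?_⟩
  have := integral_integral_swap (hint p)
  simp only [Function.uncurry_apply_pair]
  rw [this]
  -- After Fubini every `z` contributes the same moment, which makes the bound uniform in `t` and
  -- `x`.
  simp_rw [fun z => integral_one_add_abs_pow (hlaw z) p]
  simp

lemma abs_average_le_absAverage {Ω : Type*} (X : Ω → Plane → ℝ) (t : ℝ) (x : Plane) (ω : Ω) :
    |∫ z, X ω (x - Real.sqrt t • z) ∂gaussPlane| ≤ absAverage X t x ω :=
  norm_integral_le_integral_norm (fun z => X ω (x - Real.sqrt t • z))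

lemma IsTameField.memLp_average (hX : IsTameField P v X) (t : ℝ) (x : Plane) :
    MemLp (fun ω => ∫ z, X ω (x - Real.sqrt t • z) ∂gaussPlane) 2 P := by
  rw [memLp_two_iff_integrable_sq (hX.aestronglyMeasurable_average t x)]
  refine (hX.absAverage_moment t x 2).1.mono' ((hX.aestronglyMeasurable_average t x).pow 2)
    (ae_of_all _ fun ω => ?_)
  rw [Real.norm_of_nonneg (sq_nonneg _), ← sq_abs]
  have := abs_average_le_absAverage X t x ω
  exact pow_le_pow_left₀ (abs_nonneg _) (by linarith) 2

/-- The expectation of a Gaussian average against a square integrable random variable. -/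
lemma IsTameField.integral_average_mul (hX : IsTameField P v X) (t : ℝ) (x : Plane) {Y : Ω → ℝ}
    (hY : MemLp Y 2 P) :
    ∫ ω, (∫ z, X ω (x - Real.sqrt t • z) ∂gaussPlane) * Y ω ∂P
      = ∫ z, (∫ ω, X ω (x - Real.sqrt t • z) * Y ω ∂P) ∂gaussPlane := by
  obtain ⟨Z, hm, hlaw, heq, hint1⟩ := hX.exists_shifted t x
  have hint2 : Integrable (fun q : Ω × Plane => Y q.1 ^ 2) (P.prod gaussPlane) :=
    (hY.integrable_sq).comp_fst gaussPlane
  have hYm : AEStronglyMeasurable (fun q : Ω × Plane => Y q.1) (P.prod gaussPlane) :=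
    hY.aestronglyMeasurable.comp_fst
  have hint : Integrable (Function.uncurry fun ω z => Z ω z * Y ω) (P.prod gaussPlane) := by
    refine ((hint1 2).add hint2).mono' (hm.aestronglyMeasurable.mul hYm) (ae_of_all _ fun q => ?_)
    obtain ⟨ω, z⟩ := q
    simp only [Pi.add_apply, Function.uncurry_apply_pair]
    rw [Real.norm_eq_abs, abs_mul, ← sq_abs (Y ω)]
    nlinarith [sq_nonneg (|Z ω z| - |Y ω|), abs_nonneg (Y ω), abs_nonneg (Z ω z)]
  have e1 : ∫ ω, (∫ z, X ω (x - Real.sqrt t • z) ∂gaussPlane) * Y ω ∂P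
      = ∫ ω, (∫ z, Z ω z * Y ω ∂gaussPlane) ∂P := by
    refine integral_congr_ae ?_
    filter_upwards [heq] with ω hω
    rw [hω, integral_mul_const]
  rw [e1, integral_integral_swap hint]
  refine integral_congr_ae (ae_of_all _ fun z => integral_congr_ae ?_)
  filter_upwards [heq] with ω hω
  rw [hω]

end Probability

/-! ### White noise -/

section WhiteNoise

variable {Ω : Type*} [MeasurableSpace Ω] {P : Measure Ω}
  {η : Ω → 𝓢(Plane, ℝ) →L[ℝ] ℝ}

lemma IsWhiteNoise.memLp (hη : IsWhiteNoise P η) (φ : 𝓢(Plane, ℝ)) :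
    MemLp (fun ω => η ω φ) 2 P := by
  have h := memLp_id_gaussianReal' (μ := 0) (v := Real.toNNReal (∫ y, φ y ^ 2)) 2 (by simp)
  rw [← (hη φ).map_eq] at h
  exact h.comp_of_map (hη φ).aemeasurable

lemma IsWhiteNoise.integral_sq (hη : IsWhiteNoise P η) (φ : 𝓢(Plane, ℝ)) :
    ∫ ω, η ω φ ^ 2 ∂P = ∫ y, φ y ^ 2 := by
  have h := (hη φ).variance_eq
  have h0 : ∫ ω, η ω φ ∂P = 0 := by rw [(hη φ).integral_eq, integral_id_gaussianReal]
  rw [variance_id_gaussianReal, variance_of_integral_eq_zero (hη φ).aemeasurable h0] at h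
  rw [h, Real.coe_toNNReal _ (integral_nonneg fun _ => sq_nonneg _)]

lemma schwartz_integrable_mul (φ ψ : 𝓢(Plane, ℝ)) : Integrable fun y => φ y * ψ y :=
  (φ.memLp 2 volume).integrable_mul (ψ.memLp 2 volume)

/-- Polarisation: `η` is linear, and the variances of `φ`, `ψ` and `φ + ψ` are known. -/
lemma IsWhiteNoise.integral_mul (hη : IsWhiteNoise P η) (φ ψ : 𝓢(Plane, ℝ)) :
    ∫ ω, η ω φ * η ω ψ ∂P = ∫ y, φ y * ψ y := by
  have h1 := hη.integral_sq (φ + ψ)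
  have h2 := hη.integral_sq φ
  have h3 := hη.integral_sq ψ
  have i1 : Integrable (fun ω => η ω φ * η ω ψ) P := (hη.memLp φ).integrable_mul (hη.memLp ψ)
  have e1 : ∫ ω, η ω (φ + ψ) ^ 2 ∂P
      = ∫ ω, η ω φ ^ 2 ∂P + 2 * ∫ ω, η ω φ * η ω ψ ∂P + ∫ ω, η ω ψ ^ 2 ∂P := by
    rw [← integral_const_mul, ← integral_add (hη.memLp φ).integrable_sq (i1.const_mul 2),
      ← integral_add ((hη.memLp φ).integrable_sq.fun_add (i1.const_mul 2))
        (hη.memLp ψ).integrable_sq]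
    refine integral_congr_ae (ae_of_all _ fun ω => ?_)
    simp only [map_add]
    ring
  have i2 : Integrable fun y => φ y ^ 2 := by simpa [sq] using schwartz_integrable_mul φ φ
  have i3 : Integrable fun y => ψ y ^ 2 := by simpa [sq] using schwartz_integrable_mul ψ ψ
  have i4 := schwartz_integrable_mul φ ψ
  have e2 : ∫ y, (φ + ψ) y ^ 2 = (∫ y, φ y ^ 2) + 2 * (∫ y, φ y * ψ y) + ∫ y, ψ y ^ 2 := by
    rw [← integral_const_mul, ← integral_add i2 (i4.const_mul 2),
      ← integral_add (i2.fun_add (i4.const_mul 2)) i3]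
    refine integral_congr_ae (ae_of_all _ fun ω => ?_)
    simp only [add_apply]
    ring
  linarith

end WhiteNoise

/-! ### The one-point law of the heat flow of mollified white noise -/

section Law

variable {Ω : Type*} [MeasurableSpace Ω] {P : Measure Ω} {η : Ω → 𝓢(Plane, ℝ) →L[ℝ] ℝ}

/-- The heat kernel centred at a point, as a Schwartz function. -/
def heatBump (s : ℝ) (hs : 0 < s) (a : Plane) : 𝓢(Plane, ℝ) :=
  SchwartzMap.compSubConstCLM ℝ a (heatKernelSchwartz s hs)

lemma heatBump_apply (s : ℝ) (hs : 0 < s) (a y : Plane) :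
    heatBump s hs a y = heatKernel s (y - a) := rfl

lemma integral_heatBump_sq (s : ℝ) (hs : 0 < s) (a : Plane) :
    ∫ y, heatBump s hs a y ^ 2 = 1 / (4 * Real.pi * s) := by
  simp_rw [sq, heatBump_apply]
  rw [integral_heatKernel_mul_heatKernel hs hs, sub_self]
  simp only [heatKernel, norm_zero]
  simp
  ring

lemma IsWhiteNoise.integral_heatBump_mul (hη : IsWhiteNoise P η) {s r : ℝ} (hs : 0 < s)
    (hr : 0 < r) (a b : Plane) :
    ∫ ω, η ω (heatBump s hs a) * η ω (heatBump r hr b) ∂P = heatKernel (s + r) (a - b) := by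
  rw [hη.integral_mul]
  simp_rw [heatBump_apply]
  exact integral_heatKernel_mul_heatKernel hs hr a b

lemma integral_heatKernel_gaussPlane {s t : ℝ} (hs : 0 < s) (ht : 0 ≤ t) (x a : Plane) :
    ∫ z, heatKernel s (x - Real.sqrt t • z - a) ∂gaussPlane = heatKernel (t + s) (x - a) := by
  have h := heatFlow_eq_integral_gaussPlane 0 ht (fun y => heatKernel s (y - a)) x
  simp only [zero_mul, Real.exp_zero, one_mul] at h
  rw [← h]
  rcases ht.eq_or_lt with rfl | ht
  · simp [heatFlow]
  · rw [heatFlow, if_neg ht.ne']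
    simp only [massHeatKernel, zero_mul, Real.exp_zero, one_mul]
    simp_rw [heatKernel_sub_comm t x]
    exact integral_heatKernel_mul_heatKernel ht hs x a

/-- The standard deviation of `G^m_t * η_ε (x)`. -/
def flowStd (m ε t : ℝ) : ℝ := Real.exp (m * t) * Real.sqrt (1 / (4 * Real.pi * (t + ε ^ 2)))

/-- The variance of `η_ε (x)`. -/
def noiseVar (ε : ℝ) : NNReal := Real.toNNReal (1 / (4 * Real.pi * ε ^ 2))

lemma IsWhiteNoise.isTameField (hη : IsWhiteNoise P η) {ε : ℝ} (hε : 0 < ε) :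
    IsTameField P (noiseVar ε) fun ω => mollify ε hε (η ω) := by
  refine ⟨fun ω => tameFun_mollify ε hε (η ω), fun y => ?_⟩
  have h := hη (heatBump (ε ^ 2) (pow_pos hε 2) y)
  rwa [integral_heatBump_sq] at h

variable [IsProbabilityMeasure P]

/-- Formally `η` passes through the integral and the semigroup property applies. Instead of
justifying this exchange pathwise, one computes covariances: with `A` the average and `Z` the
pairing, `E[A²]`, `E[AZ]` and `E[Z²]` all equal `G_{2t+2ε²}(0)`, so `E[(A - Z)²] = 0`. Only Fubini
and the covariance of the noise are needed. -/
lemma IsWhiteNoise.average_ae_eq (hη : IsWhiteNoise P η) {ε : ℝ} (hε : 0 < ε) {t : ℝ}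
    (ht : 0 ≤ t) (x : Plane) :
    (fun ω => ∫ z, mollify ε hε (η ω) (x - Real.sqrt t • z) ∂gaussPlane) =ᵐ[P]
      fun ω => η ω (heatBump (t + ε ^ 2) (by positivity) x) := by
  have hX := hη.isTameField hε
  have hε2 : 0 < ε ^ 2 := pow_pos hε 2
  have hs : 0 < t + ε ^ 2 := by positivity
  set A : Ω → ℝ := fun ω => ∫ z, mollify ε hε (η ω) (x - Real.sqrt t • z) ∂gaussPlane with hA
  set Z : Ω → ℝ := fun ω => η ω (heatBump (t + ε ^ 2) hs x) with hZ
  have hA2 : MemLp A 2 P := hX.memLp_average t x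
  have hZ2 : MemLp Z 2 P := hη.memLp _
  have hg2 : ∀ y, MemLp (fun ω => mollify ε hε (η ω) y) 2 P := fun y =>
    hη.memLp (heatBump (ε ^ 2) hε2 y)
  have e1 : ∫ ω, A ω * Z ω ∂P = heatKernel (2 * t + 2 * ε ^ 2) 0 := by
    rw [hA, hX.integral_average_mul t x hZ2]
    have : ∀ z, ∫ ω, mollify ε hε (η ω) (x - Real.sqrt t • z) * Z ω ∂P
        = heatKernel (ε ^ 2 + (t + ε ^ 2)) (x - Real.sqrt t • z - x) := fun z =>
      hη.integral_heatBump_mul hε2 hs _ _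
    simp_rw [this]
    rw [integral_heatKernel_gaussPlane (by positivity) ht, sub_self]
    congr 1; ring
  have e2 : ∀ y, ∫ ω, A ω * mollify ε hε (η ω) y ∂P = heatKernel (t + 2 * ε ^ 2) (x - y) := by
    intro y
    rw [hA, hX.integral_average_mul t x (hg2 y)]
    have : ∀ z, ∫ ω, mollify ε hε (η ω) (x - Real.sqrt t • z) * mollify ε hε (η ω) y ∂P
        = heatKernel (ε ^ 2 + ε ^ 2) (x - Real.sqrt t • z - y) := fun z =>
      hη.integral_heatBump_mul hε2 hε2 _ _
    simp_rw [this]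
    rw [integral_heatKernel_gaussPlane (by positivity) ht]
    congr 1; ring
  have e3 : ∫ ω, A ω * A ω ∂P = heatKernel (2 * t + 2 * ε ^ 2) 0 := by
    rw [show (∫ ω, A ω * A ω ∂P) = ∫ ω, (∫ z, mollify ε hε (η ω) (x - Real.sqrt t • z)
      ∂gaussPlane) * A ω ∂P from rfl, hX.integral_average_mul t x hA2]
    have : ∀ z, ∫ ω, mollify ε hε (η ω) (x - Real.sqrt t • z) * A ω ∂P
        = heatKernel (t + 2 * ε ^ 2) (x - Real.sqrt t • z - x) := fun z => by
      rw [heatKernel_sub_comm, ← e2]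
      simp_rw [mul_comm]
    simp_rw [this]
    rw [integral_heatKernel_gaussPlane (by positivity) ht, sub_self]
    congr 1; ring
  have e4 : ∫ ω, Z ω * Z ω ∂P = heatKernel (2 * t + 2 * ε ^ 2) 0 := by
    rw [hZ, hη.integral_heatBump_mul hs hs, sub_self]
    congr 1; ring
  have i1 : Integrable (fun ω => A ω * A ω) P := hA2.integrable_mul hA2
  have i2 : Integrable (fun ω => A ω * Z ω) P := hA2.integrable_mul hZ2
  have i3 : Integrable (fun ω => Z ω * Z ω) P := hZ2.integrable_mul hZ2
  have e5 : ∫ ω, (A ω - Z ω) ^ 2 ∂P = 0 := by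
    have : ∀ ω, (A ω - Z ω) ^ 2 = A ω * A ω - 2 * (A ω * Z ω) + Z ω * Z ω := fun ω => by ring
    simp_rw [this]
    have i4 : Integrable (fun ω => A ω * A ω - 2 * (A ω * Z ω)) P :=
      Integrable.sub i1 (Integrable.const_mul i2 2)
    rw [integral_add i4 i3, integral_sub i1 (Integrable.const_mul i2 2),
      integral_const_mul, e1, e3, e4]
    ring
  have e6 := (integral_eq_zero_iff_of_nonneg (fun ω => sq_nonneg (A ω - Z ω))
    (hA2.sub hZ2).integrable_sq).1 e5
  filter_upwards [e6] with ω hω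
  have : (A ω - Z ω) ^ 2 = 0 := hω
  linarith [pow_eq_zero_iff (two_ne_zero) |>.1 this]

/-- The one-point law of the heat flow of mollified white noise. -/
lemma IsWhiteNoise.hasLaw_heatFlow (hη : IsWhiteNoise P η) {ε : ℝ} (hε : 0 < ε) (m : ℝ) {t : ℝ}
    (ht : 0 ≤ t) (x : Plane) :
    HasLaw (fun ω => heatFlow m t (mollify ε hε (η ω)) x)
      ((gaussianReal 0 1).map fun z => flowStd m ε t * z) P := by
  have hs : 0 < t + ε ^ 2 := by positivity
  have h1 := hη (heatBump (t + ε ^ 2) hs x)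
  rw [integral_heatBump_sq] at h1
  have h2 := gaussianReal_const_mul (h1.congr (hη.average_ae_eq hε ht x)) (Real.exp (m * t))
  simp_rw [heatFlow_eq_integral_gaussPlane m ht]
  -- The law is expressed as an image of the standard Gaussian, so that `t` later enters
  -- expectations only through the integrand.
  convert h2 using 1
  rw [gaussianReal_map_const_mul]
  congr 1
  · simp
  · ext
    rw [mul_one, NNReal.coe_mk, NNReal.coe_mul, NNReal.coe_mk,
      Real.coe_toNNReal _ (by positivity), flowStd, mul_pow, Real.sq_sqrt (by positivity)]

end Law

/-! ### Estimates on the nonlinearity -/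

/-- Polynomial bounds on a function and its increments. -/
def PolyLip (C : ℝ) (n : ℕ) (D : ℝ → ℝ) : Prop :=
  ∀ u u', |D u| ≤ C * (1 + |u|) ^ n ∧ |D u - D u'| ≤ C * (1 + |u| + |u'|) ^ n * |u - u'|

lemma PolyLip.add {C₁ C₂ : ℝ} {n₁ n₂ : ℕ} {D₁ D₂ : ℝ → ℝ} (hC₁ : 0 ≤ C₁) (hC₂ : 0 ≤ C₂)
    (h₁ : PolyLip C₁ n₁ D₁) (h₂ : PolyLip C₂ n₂ D₂) :
    PolyLip (C₁ + C₂) (n₁ + n₂) fun u => D₁ u + D₂ u := by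
  intro u u'
  have hu : 1 ≤ 1 + |u| := by linarith [abs_nonneg u]
  have huu : 1 ≤ 1 + |u| + |u'| := by linarith [abs_nonneg u, abs_nonneg u']
  constructor
  · calc |D₁ u + D₂ u| ≤ |D₁ u| + |D₂ u| := abs_add_le _ _
      _ ≤ C₁ * (1 + |u|) ^ n₁ + C₂ * (1 + |u|) ^ n₂ := add_le_add (h₁ u u').1 (h₂ u u').1
      _ ≤ C₁ * (1 + |u|) ^ (n₁ + n₂) + C₂ * (1 + |u|) ^ (n₁ + n₂) := by
        gcongr <;> first | exact hu | omega
      _ = _ := by ring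
  · calc |D₁ u + D₂ u - (D₁ u' + D₂ u')| = |(D₁ u - D₁ u') + (D₂ u - D₂ u')| := by ring_nf
      _ ≤ |D₁ u - D₁ u'| + |D₂ u - D₂ u'| := abs_add_le _ _
      _ ≤ C₁ * (1 + |u| + |u'|) ^ n₁ * |u - u'| + C₂ * (1 + |u| + |u'|) ^ n₂ * |u - u'| :=
        add_le_add (h₁ u u').2 (h₂ u u').2
      _ ≤ C₁ * (1 + |u| + |u'|) ^ (n₁ + n₂) * |u - u'|
          + C₂ * (1 + |u| + |u'|) ^ (n₁ + n₂) * |u - u'| := by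
        gcongr <;> first | exact huu | omega
      _ = _ := by ring

lemma abs_deriv_le_of_memS₁ {L₁ L₂ : ℝ} {F : ℝ → ℝ → ℝ} (hF : MemS₁ L₁ L₂ F) {t : ℝ} (ht : 0 < t)
    (u : ℝ) : |deriv (F t) u| ≤ L₁ := by
  have := norm_deriv_le_of_lipschitz (x₀ := u) (hF.lipschitz t ht)
  rwa [Real.coe_toNNReal _ hF.L₁_nonneg] at this

lemma MemS₁.polyLip {L₁ L₂ : ℝ} {F : ℝ → ℝ → ℝ} (hF : MemS₁ L₁ L₂ F) {t : ℝ} (ht : 0 < t) :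
    PolyLip (L₁ + L₂) 0 (deriv (F t)) := by
  intro u u'
  simp only [pow_zero, mul_one]
  refine ⟨(abs_deriv_le_of_memS₁ hF ht u).trans (by linarith [hF.L₂_nonneg]), ?_⟩
  have h := (hF.lipschitz_deriv t ht).dist_le_mul u u'
  rw [Real.coe_toNNReal _ hF.L₂_nonneg, Real.dist_eq, Real.dist_eq] at h
  refine h.trans ?_
  gcongr
  linarith [hF.L₁_nonneg]

/-- Class `S₂` controls the derivative on `[0, u]` only; evenness of the derivative transfers the
control to negative arguments. -/
lemma deriv_abs_of_odd {h : ℝ → ℝ} (hodd : Function.Odd h) (u : ℝ) :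
    deriv h u = deriv h |u| := by
  rcases abs_choice u with hu | hu
  · rw [hu]
  · rw [hu]
    have h1 : (fun x => h (-x)) = fun x => -h x := funext fun x => hodd x
    have h2 := congrArg (fun k => deriv k u) h1
    simp only [deriv_comp_neg, deriv.fun_neg] at h2
    linarith

/-- Real growth exponents are replaced by natural ones, so that moments of integer order suffice. -/
lemma rpow_le_pow_ceil {γ M q : ℝ} (hγ : 0 ≤ γ) (hM : 0 ≤ M) (hq : M ≤ q) (h1 : 1 ≤ q) :
    M ^ γ ≤ q ^ ⌈γ⌉₊ := by
  calc M ^ γ ≤ q ^ γ := Real.rpow_le_rpow hM hq hγ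
    _ ≤ q ^ (⌈γ⌉₊ : ℝ) := Real.rpow_le_rpow_of_exponent_le h1 (Nat.le_ceil γ)
    _ = _ := Real.rpow_natCast _ _

lemma MemS₂.abs_deriv_sub_le {γ₁ γ₂ l₁ l₂ : ℝ} {F : ℝ → ℝ → ℝ} (hF : MemS₂ γ₁ γ₂ l₁ l₂ F) {t : ℝ}
    (ht : 0 < t) (u u' : ℝ) :
    |deriv (F t) u - deriv (F t) u'| ≤ 2 * l₂ * (1 + |u| + |u'|) ^ ⌈γ₂⌉₊ * |u - u'| := by
  have hodd := hF.odd t ht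
  rw [deriv_abs_of_odd hodd u, deriv_abs_of_odd hodd u']
  set M := max |u| |u'| with hM
  have hM0 : 0 ≤ M := (abs_nonneg u).trans (le_max_left _ _)
  have h := (hF.lipschitzOn_deriv t ht M hM0).dist_le_mul |u| ⟨abs_nonneg _, le_max_left _ _⟩ |u'|
    ⟨abs_nonneg _, le_max_right _ _⟩
  have hl₂ := hF.l₂_nonneg
  rw [Real.coe_toNNReal _ (by positivity), Real.dist_eq, Real.dist_eq] at h
  have hMq : M ≤ 1 + |u| + |u'| :=
    max_le (by linarith [abs_nonneg u']) (by linarith [abs_nonneg u])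
  have hq : 1 ≤ 1 + |u| + |u'| := by linarith [abs_nonneg u, abs_nonneg u']
  have h1 := rpow_le_pow_ceil (zero_le_one.trans hF.one_le_γ₂) hM0 hMq hq
  have h2 : 1 ≤ (1 + |u| + |u'|) ^ ⌈γ₂⌉₊ := one_le_pow₀ hq
  calc _ ≤ l₂ * (1 + M ^ γ₂) * |(|u| - |u'|)| := h
    _ ≤ l₂ * ((1 + |u| + |u'|) ^ ⌈γ₂⌉₊ + (1 + |u| + |u'|) ^ ⌈γ₂⌉₊) * |u - u'| := by
      exact mul_le_mul (by gcongr) (abs_abs_sub_abs_le_abs_sub u u') (abs_nonneg _) (by positivity)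
    _ = _ := by ring

lemma MemS₂.exists_polyLip {γ₁ γ₂ l₁ l₂ : ℝ} {F : ℝ → ℝ → ℝ} (hF : MemS₂ γ₁ γ₂ l₁ l₂ F) :
    ∃ C ≥ 0, ∃ n : ℕ, ∀ t > 0, PolyLip C n (deriv (F t)) := by
  set n := ⌈γ₂⌉₊
  have hl₁ := hF.l₁_nonneg
  have hl₂ := hF.l₂_nonneg
  refine ⟨2 * l₁ + 2 * l₂ * 2 ^ n, by positivity, n + 1, fun t ht u u' => ⟨?_, ?_⟩⟩
  -- The base point `1/2` is interior to `[0, 1]`, where the Lipschitz constant `l₁(1 + 1^γ₁) = 2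
  -- l₁` bounds the derivative. The rest of the growth is an increment of the derivative, which
  -- costs the extra power in `n + 1`.
  · have h0 : |deriv (F t) (1 / 2)| ≤ 2 * l₁ := by
      have := norm_deriv_le_of_lipschitzOn (x₀ := (1 / 2 : ℝ)) (Icc_mem_nhds (by norm_num)
        (by norm_num)) (hF.lipschitzOn t ht 1 zero_le_one)
      rw [Real.one_rpow, Real.coe_toNNReal _ (by positivity)] at this
      rw [Real.norm_eq_abs] at this
      linarith
    have h1 := hF.abs_deriv_sub_le ht u (1 / 2)
    have h2 : |u - 1 / 2| ≤ 1 + |u| := by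
      have := abs_sub u (1 / 2)
      have h3 : |(1 / 2 : ℝ)| = 1 / 2 := abs_of_pos (by norm_num)
      linarith
    have h3 : 1 + |u| + |(1 / 2 : ℝ)| ≤ 2 * (1 + |u|) := by
      rw [abs_of_pos (by norm_num : (0 : ℝ) < 1 / 2)]
      linarith [abs_nonneg u]
    have h4 : 1 ≤ (1 + |u|) ^ (n + 1) := one_le_pow₀ (by linarith [abs_nonneg u])
    have h5 : |deriv (F t) u| ≤ |deriv (F t) (1 / 2)| + |deriv (F t) u - deriv (F t) (1 / 2)| := by
      have := abs_add_le (deriv (F t) (1 / 2)) (deriv (F t) u - deriv (F t) (1 / 2))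
      rwa [add_sub_cancel] at this
    calc |deriv (F t) u| ≤ 2 * l₁ + 2 * l₂ * (1 + |u| + |(1 / 2 : ℝ)|) ^ n * |u - 1 / 2| := by
          linarith
      _ ≤ 2 * l₁ * (1 + |u|) ^ (n + 1) + 2 * l₂ * (2 * (1 + |u|)) ^ n * (1 + |u|) := by
        refine add_le_add (le_mul_of_one_le_right (by positivity) h4) ?_
        gcongr
      _ = _ := by rw [mul_pow, pow_succ]; ring
  · refine (hF.abs_deriv_sub_le ht u u').trans ?_
    have hq : 1 ≤ 1 + |u| + |u'| := by linarith [abs_nonneg u, abs_nonneg u']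
    have h2 : (1 : ℝ) ≤ 2 ^ n := one_le_pow₀ (by norm_num)
    have h3 : (1 + |u| + |u'|) ^ n ≤ (1 + |u| + |u'|) ^ (n + 1) :=
      pow_le_pow_right₀ hq (by omega)
    gcongr
    nlinarith

lemma MemS.exists_polyLip {F : ℝ → ℝ → ℝ} (hF : MemS F) :
    ∃ C ≥ 0, ∃ n : ℕ, ∀ t > 0, PolyLip C n (deriv (F t)) := by
  obtain ⟨F₁, F₂, ⟨L₁, L₂, h₁⟩, ⟨γ₁, γ₂, l₁, l₂, h₂⟩, hsum⟩ := hF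
  obtain ⟨C, hC, n, hn⟩ := h₂.exists_polyLip
  have hL₁ := h₁.L₁_nonneg
  have hL₂ := h₁.L₂_nonneg
  refine ⟨L₁ + L₂ + C, by positivity, 0 + n, fun t ht => ?_⟩
  have e : deriv (F t) = fun u => deriv (F₁ t) u + deriv (F₂ t) u := by
    funext u
    rw [show F t = fun u => F₁ t u + F₂ t u from funext fun u => hsum t ht u]
    exact deriv_fun_add (h₁.differentiable t ht u) (h₂.differentiable t ht u)
  rw [e]
  exact (h₁.polyLip ht).add (by positivity) hC (hn t ht)

lemma MemS.differentiable {F : ℝ → ℝ → ℝ} (hF : MemS F) {t : ℝ} (ht : 0 < t) :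
    Differentiable ℝ (F t) := by
  obtain ⟨F₁, F₂, ⟨L₁, L₂, h₁⟩, ⟨γ₁, γ₂, l₁, l₂, h₂⟩, hsum⟩ := hF
  rw [show F t = fun u => F₁ t u + F₂ t u from funext fun u => hsum t ht u]
  exact (h₁.differentiable t ht).add (h₂.differentiable t ht)

lemma MemS.continuousOn {F : ℝ → ℝ → ℝ} (hF : MemS F) :
    ContinuousOn (fun p : ℝ × ℝ => F p.1 p.2) (Set.Ioi 0 ×ˢ Set.univ) := by
  obtain ⟨F₁, F₂, ⟨L₁, L₂, h₁⟩, ⟨γ₁, γ₂, l₁, l₂, h₂⟩, hsum⟩ := hF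
  exact (h₁.continuousOn.add h₂.continuousOn).congr fun p hp => hsum p.1 hp.1 p.2

/-- Joint continuity of the derivative in the second variable. -/
lemma continuousOn_deriv_of_polyLip {F : ℝ → ℝ → ℝ}
    (hc : ContinuousOn (fun p : ℝ × ℝ => F p.1 p.2) (Set.Ioi 0 ×ˢ Set.univ))
    (hd : ∀ t > 0, Differentiable ℝ (F t)) {C : ℝ} (hC : 0 ≤ C) {n : ℕ}
    (hp : ∀ t > 0, PolyLip C n (deriv (F t))) :
    ContinuousOn (fun p : ℝ × ℝ => deriv (F p.1) p.2) (Set.Ioi 0 ×ˢ Set.univ) := by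
  have hopen : IsOpen (Set.Ioi 0 ×ˢ Set.univ : Set (ℝ × ℝ)) := isOpen_Ioi.prod isOpen_univ
  rintro ⟨t₀, u₀⟩ ⟨ht₀, -⟩
  refine ContinuousAt.continuousWithinAt ?_
  simp only [Set.mem_Ioi] at ht₀
  set K := C * (1 + (|u₀| + 1) + (|u₀| + 2)) ^ n with hK
  have hK0 : 0 ≤ K := by positivity
  -- Only `F` is assumed jointly continuous. Its difference quotients are too, and they approximate
  -- the derivative with an error `K h` uniform in `t`, because the derivative is Lipschitz on
  -- bounded sets uniformly in `t`.
  have hquot : ∀ t > 0, ∀ u, |u| ≤ |u₀| + 1 → ∀ h ∈ Set.Ioc (0 : ℝ) 1,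
      |deriv (F t) u - (F t (u + h) - F t u) / h| ≤ K * h := by
    intro t ht u hu h hh
    obtain ⟨ξ, hξ, hξ'⟩ := exists_deriv_eq_slope (F t) (show u < u + h by linarith [hh.1])
      (hd t ht).continuous.continuousOn (hd t ht).differentiableOn
    rw [add_sub_cancel_left] at hξ'
    rw [← hξ']
    have h1 : |ξ| ≤ |u₀| + 2 := by
      have : |ξ - u| ≤ 1 := by rw [abs_le]; constructor <;> linarith [hξ.1, hξ.2, hh.2]
      have := abs_add_le (ξ - u) u
      rw [sub_add_cancel] at this
      linarith
    have h2 : |u - ξ| ≤ h := by rw [abs_le]; constructor <;> linarith [hξ.1, hξ.2]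
    calc _ ≤ C * (1 + |u| + |ξ|) ^ n * |u - ξ| := (hp t ht u ξ).2
      _ ≤ K * h := by rw [hK]; gcongr
  rw [Metric.continuousAt_iff']
  intro e he
  obtain ⟨h, hh0, hh1, hhe⟩ : ∃ h : ℝ, 0 < h ∧ h ≤ 1 ∧ K * h ≤ e / 4 := by
    refine ⟨min 1 (e / (4 * (K + 1))), by positivity, min_le_left _ _, ?_⟩
    calc K * min 1 (e / (4 * (K + 1))) ≤ (K + 1) * (e / (4 * (K + 1))) := by
          gcongr
          · linarith
          · exact min_le_right _ _
      _ = e / 4 := by field_simp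
  have hQ : ContinuousAt (fun p : ℝ × ℝ => (F p.1 (p.2 + h) - F p.1 p.2) / h) (t₀, u₀) := by
    have c1 : ContinuousAt (fun p : ℝ × ℝ => F p.1 p.2) (t₀, u₀) :=
      hc.continuousAt (hopen.mem_nhds ⟨ht₀, Set.mem_univ _⟩)
    have c2 : ContinuousAt (fun p : ℝ × ℝ => F p.1 p.2) (t₀, u₀ + h) :=
      hc.continuousAt (hopen.mem_nhds ⟨ht₀, Set.mem_univ _⟩)
    have c3 : ContinuousAt (fun p : ℝ × ℝ => (p.1, p.2 + h)) (t₀, u₀) := by fun_prop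
    exact ((ContinuousAt.comp (f := fun p : ℝ × ℝ => (p.1, p.2 + h))
      (g := fun p : ℝ × ℝ => F p.1 p.2) c2 c3).sub c1).div_const h
  have hu : ∀ᶠ p : ℝ × ℝ in nhds (t₀, u₀), |p.2| < |u₀| + 1 :=
    (continuous_snd.abs.continuousAt).eventually_lt_const (by simp)
  have ht : ∀ᶠ p : ℝ × ℝ in nhds (t₀, u₀), 0 < p.1 :=
    continuous_fst.continuousAt.eventually_const_lt ht₀
  filter_upwards [Metric.continuousAt_iff'.1 hQ (e / 2) (by positivity), hu, ht] with p hp1 hp2 hp3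
  rw [Real.dist_eq] at hp1 ⊢
  have a1 := hquot p.1 hp3 p.2 hp2.le h ⟨hh0, hh1⟩
  have a2 := hquot t₀ ht₀ u₀ (by linarith) h ⟨hh0, hh1⟩
  rw [abs_le] at a1 a2
  rw [abs_lt] at hp1 ⊢
  constructor <;> linarith [a1.1, a1.2, a2.1, a2.2, hp1.1, hp1.2]

/-- The properties of `(r, u) ↦ f'(r, u)` needed below. -/
structure TameCoeff (n : ℕ) (D : ℝ → ℝ → ℝ) : Prop where
  continuousOn : ContinuousOn (fun p : ℝ × ℝ => D p.1 p.2) (Set.Ioi 0 ×ˢ Set.univ)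
  polyLip : ∀ r₀ > 0, ∀ R, ∃ C ≥ 0, ∀ r ∈ Set.Icc r₀ R, PolyLip C n (D r)

lemma eq_rescale (f : ℝ → ℝ → ℝ) {t : ℝ} (ht : 0 < t) (u : ℝ) :
    f t u = t ^ (-(3 / 2) : ℝ) * rescale f t (Real.sqrt t * u) := by
  have h1 : Real.sqrt t ≠ 0 := (Real.sqrt_pos.2 ht).ne'
  rw [rescale, ← mul_assoc, ← Real.rpow_add ht, mul_div_cancel_left₀ _ h1]
  simp

/-- The powers combine to `t^{-3/2} t^{1/2} = t⁻¹`, the origin of the factor `1/(t+ε²)` in the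
bounds on `σ`. -/
lemma deriv_eq_rescale (f : ℝ → ℝ → ℝ) {t : ℝ} (ht : 0 < t) (u : ℝ) :
    deriv (f t) u = t⁻¹ * deriv (rescale f t) (Real.sqrt t * u) := by
  rw [show f t = fun u => t ^ (-(3 / 2) : ℝ) * rescale f t (Real.sqrt t * u) from
    funext fun u => eq_rescale f ht u, deriv_const_mul_field,
    deriv_comp_mul_left (Real.sqrt t) (rescale f t) u, smul_eq_mul, ← mul_assoc]
  congr 1
  rw [Real.sqrt_eq_rpow, ← Real.rpow_add ht, ← Real.rpow_neg_one]
  norm_num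

lemma MemSbar.exists_tameCoeff {f : ℝ → ℝ → ℝ} (hf : MemSbar f) :
    ∃ n, TameCoeff n fun r => deriv (f r) := by
  obtain ⟨C, hC, n, hn⟩ := MemS.exists_polyLip hf
  refine ⟨n, ?_, fun r₀ hr₀ R => ?_⟩
  · have h1 := continuousOn_deriv_of_polyLip (MemS.continuousOn hf)
      (fun t ht => MemS.differentiable hf ht) hC hn
    have h2 : ContinuousOn (fun p : ℝ × ℝ => p.1⁻¹ *
        deriv (rescale f p.1) (Real.sqrt p.1 * p.2)) (Set.Ioi 0 ×ˢ Set.univ) := by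
      refine ContinuousOn.mul (continuousOn_fst.inv₀ fun p hp => (show 0 < p.1 from hp.1).ne') ?_
      refine h1.comp (f := fun p : ℝ × ℝ => (p.1, Real.sqrt p.1 * p.2)) ?_
        fun p hp => ⟨hp.1, Set.mem_univ _⟩
      exact Continuous.continuousOn (by fun_prop)
    exact h2.congr fun p hp => deriv_eq_rescale f hp.1 p.2
  -- Rescaling costs one factor `1 + √R` for each of the `n` powers and one more for the increment.
  · refine ⟨r₀⁻¹ * C * (1 + Real.sqrt R) ^ (n + 1), by positivity, fun r hr u u' => ?_⟩
    have hr0 : 0 < r := hr₀.trans_le hr.1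
    have hs : Real.sqrt r ≤ Real.sqrt R := Real.sqrt_le_sqrt hr.2
    have hs0 := Real.sqrt_nonneg r
    have hS0 := Real.sqrt_nonneg R
    have hinv : r⁻¹ ≤ r₀⁻¹ := inv_anti₀ hr₀ hr.1
    have hle : (1 + Real.sqrt R) ^ n ≤ (1 + Real.sqrt R) ^ (n + 1) :=
      pow_le_pow_right₀ (by linarith) (by omega)
    rw [deriv_eq_rescale f hr0 u, deriv_eq_rescale f hr0 u']
    have h := hn r hr0 (Real.sqrt r * u) (Real.sqrt r * u')
    simp only [abs_mul, abs_of_nonneg hs0] at h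
    constructor
    · rw [abs_mul, abs_of_pos (inv_pos.2 hr0)]
      have h3 : 1 + Real.sqrt r * |u| ≤ (1 + Real.sqrt R) * (1 + |u|) := by
        nlinarith [abs_nonneg u]
      calc r⁻¹ * |deriv (rescale f r) (Real.sqrt r * u)|
          ≤ r₀⁻¹ * (C * ((1 + Real.sqrt R) * (1 + |u|)) ^ n) := by
            gcongr
            exact h.1.trans (by gcongr)
        _ = r₀⁻¹ * C * (1 + Real.sqrt R) ^ n * (1 + |u|) ^ n := by rw [mul_pow]; ring
        _ ≤ _ := by gcongr
    · rw [← mul_sub, abs_mul, abs_of_pos (inv_pos.2 hr0)]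
      have h3 : 1 + Real.sqrt r * |u| + Real.sqrt r * |u'|
          ≤ (1 + Real.sqrt R) * (1 + |u| + |u'|) := by
        nlinarith [abs_nonneg u, abs_nonneg u']
      have h4 : |Real.sqrt r * u - Real.sqrt r * u'| ≤ (1 + Real.sqrt R) * |u - u'| := by
        rw [← mul_sub, abs_mul, abs_of_nonneg hs0]
        gcongr
        linarith
      calc r⁻¹ * |deriv (rescale f r) (Real.sqrt r * u) - deriv (rescale f r) (Real.sqrt r * u')|
          ≤ r₀⁻¹ * (C * ((1 + Real.sqrt R) * (1 + |u| + |u'|)) ^ n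
            * ((1 + Real.sqrt R) * |u - u'|)) := by
            gcongr
            exact h.2.trans (by gcongr)
        _ = _ := by rw [mul_pow, pow_succ]; ring

/-- The lower bound on `f'` given by a decomposition of `f`. -/
lemma neg_div_le_deriv {L₁ L₂ γ₁ γ₂ l₁ l₂ : ℝ} {f f₁ f₂ : ℝ → ℝ → ℝ} (h₁ : MemSbar₁ L₁ L₂ f₁)
    (h₂ : MemSbar₂ γ₁ γ₂ l₁ l₂ f₂) (hsum : ∀ t > 0, ∀ u, f t u = f₁ t u + f₂ t u) {t : ℝ}
    (ht : 0 < t) (u : ℝ) : -(L₁ / t) ≤ deriv (f t) u := by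
  have hr : rescale f t = fun u => rescale f₁ t u + rescale f₂ t u := by
    funext u
    simp only [rescale, hsum t ht, mul_add]
  rw [deriv_eq_rescale f ht, hr,
    deriv_fun_add (MemS₁.differentiable h₁ t ht _) (MemS₂.differentiable h₂ t ht _)]
  have a1 := abs_deriv_le_of_memS₁ h₁ ht (Real.sqrt t * u)
  have a2 : 0 ≤ deriv (rescale f₂ t) (Real.sqrt t * u) := (MemS₂.monotone h₂ t ht).deriv_nonneg
  have a3 := (abs_le.1 a1).1
  rw [div_eq_inv_mul, ← mul_neg]
  exact mul_le_mul_of_nonneg_left (by linarith) (inv_nonneg.2 ht.le)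

/-- The monotone part has non-negative derivative and the Lipschitz part costs at most its constant.
The decomposition used is the one of `rescale f` that `MemSbar` provides. -/
lemma MemSbar.exists_neg_div_le_deriv {f : ℝ → ℝ → ℝ} (hf : MemSbar f) :
    ∃ L ≥ 0, ∀ t > 0, ∀ u, -(L / t) ≤ deriv (f t) u := by
  obtain ⟨F₁, F₂, ⟨L₁, L₂, h₁⟩, ⟨γ₁, γ₂, l₁, l₂, h₂⟩, hsum⟩ := hf
  refine ⟨L₁, h₁.L₁_nonneg, fun t ht u => ?_⟩
  rw [deriv_eq_rescale f ht, show rescale f t = fun u => F₁ t u + F₂ t u from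
    funext fun u => hsum t ht u,
    deriv_fun_add (h₁.differentiable t ht _) (h₂.differentiable t ht _)]
  have a1 := abs_deriv_le_of_memS₁ h₁ ht (Real.sqrt t * u)
  have a2 : 0 ≤ deriv (F₂ t) (Real.sqrt t * u) := (h₂.monotone t ht).deriv_nonneg
  have a3 := (abs_le.1 a1).1
  rw [div_eq_inv_mul, ← mul_neg]
  exact mul_le_mul_of_nonneg_left (by linarith) (inv_nonneg.2 ht.le)

/-! ### The ordinary differential equation -/

/-- The rate `a(t, s)` in `σ' = -κ a(t, σ) σ` is continuous and locally Lipschitz in `s`. -/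
structure IsRate (a : ℝ → ℝ → ℝ) : Prop where
  continuousOn : ContinuousOn (fun p : ℝ × ℝ => a p.1 p.2) (Set.Ici 0 ×ˢ Set.univ)
  lipschitz : ∀ T R, ∃ L ≥ 0, ∀ t ∈ Set.Icc 0 T, ∀ s s', |s| ≤ R → |s'| ≤ R →
    |a t s - a t s'| ≤ L * |s - s'|

lemma IsRate.bounded {a : ℝ → ℝ → ℝ} (ha : IsRate a) (T R : ℝ) :
    ∃ A ≥ 0, ∀ t ∈ Set.Icc 0 T, ∀ s, |s| ≤ R → |a t s| ≤ A := by
  have hK : IsCompact (Set.Icc 0 T ×ˢ Set.Icc (-R) R) := isCompact_Icc.prod isCompact_Icc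
  obtain ⟨A, hA⟩ := hK.exists_bound_of_continuousOn (ha.continuousOn.mono
    (Set.prod_mono Set.Icc_subset_Ici_self (Set.subset_univ _)))
  refine ⟨max A 0, le_max_right _ _, fun t ht s hs => ?_⟩
  exact (hA (t, s) ⟨ht, abs_le.1 hs⟩).trans (le_max_left _ _)

lemma hasDerivWithinAt_Ici_of_Icc {g : ℝ → ℝ} {g' T t : ℝ} (ht : t ∈ Set.Ico 0 T)
    (h : HasDerivWithinAt g g' (Set.Icc 0 T) t) : HasDerivWithinAt g g' (Set.Ici t) t :=
  h.mono_of_mem_nhdsWithin (Filter.mem_of_superset (Icc_mem_nhdsGE ht.2)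
    (Set.Icc_subset_Icc_left ht.1))

/-- Grönwall for the difference: two solutions on a compact interval are bounded by a common `R`,
below which `a` is bounded and Lipschitz. No sign of the solutions is needed. -/
lemma IsRate.eqOn {a : ℝ → ℝ → ℝ} (ha : IsRate a) (κ : ℝ) {T : ℝ} {σ τ : ℝ → ℝ} (h0 : σ 0 = τ 0)
    (hσ : ∀ t ∈ Set.Icc 0 T, HasDerivWithinAt σ (-κ * a t (σ t) * σ t) (Set.Icc 0 T) t)
    (hτ : ∀ t ∈ Set.Icc 0 T, HasDerivWithinAt τ (-κ * a t (τ t) * τ t) (Set.Icc 0 T) t) :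
    Set.EqOn σ τ (Set.Icc 0 T) := by
  have hσc : ContinuousOn σ (Set.Icc 0 T) := fun t ht => (hσ t ht).continuousWithinAt
  have hτc : ContinuousOn τ (Set.Icc 0 T) := fun t ht => (hτ t ht).continuousWithinAt
  obtain ⟨R₁, hR₁⟩ := isCompact_Icc.exists_bound_of_continuousOn hσc
  obtain ⟨R₂, hR₂⟩ := isCompact_Icc.exists_bound_of_continuousOn hτc
  set R := max R₁ R₂
  have b1 : ∀ t ∈ Set.Icc 0 T, |σ t| ≤ R := fun t ht => (hR₁ t ht).trans (le_max_left _ _)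
  have b2 : ∀ t ∈ Set.Icc 0 T, |τ t| ≤ R := fun t ht => (hR₂ t ht).trans (le_max_right _ _)
  obtain ⟨L, hL, hLip⟩ := ha.lipschitz T R
  obtain ⟨A, hA, hAb⟩ := ha.bounded T R
  have key := eq_zero_of_abs_deriv_le_mul_abs_self_of_eq_zero_right
    (f := fun t => σ t - τ t) (f' := fun t => -κ * a t (σ t) * σ t - -κ * a t (τ t) * τ t)
    (K := |κ| * (A + L * R)) (a := 0) (b := T) (hσc.sub hτc)
    (fun t ht => (hasDerivWithinAt_Ici_of_Icc ht (hσ t (Set.Ico_subset_Icc_self ht))).sub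
      (hasDerivWithinAt_Ici_of_Icc ht (hτ t (Set.Ico_subset_Icc_self ht)))) (by simp [h0])
    (fun t ht => ?_)
  · exact fun t ht => sub_eq_zero.1 (key t ht)
  · have ht' := Set.Ico_subset_Icc_self ht
    have e : -κ * a t (σ t) * σ t - -κ * a t (τ t) * τ t
        = -κ * (a t (σ t) * (σ t - τ t) + (a t (σ t) - a t (τ t)) * τ t) := by ring
    rw [e, Real.norm_eq_abs, Real.norm_eq_abs, abs_mul, abs_neg, mul_assoc]
    gcongr
    have c1 := hAb t ht' (σ t) (b1 t ht')
    have c2 := hLip t ht' (σ t) (τ t) (b1 t ht') (b2 t ht')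
    calc |a t (σ t) * (σ t - τ t) + (a t (σ t) - a t (τ t)) * τ t|
        ≤ |a t (σ t)| * |σ t - τ t| + |a t (σ t) - a t (τ t)| * |τ t| := by
          rw [← abs_mul, ← abs_mul]; exact abs_add_le _ _
      _ ≤ A * |σ t - τ t| + (L * |σ t - τ t|) * R := by
          gcongr
          exact b2 t ht'
      _ = _ := by ring

/-- Truncation makes the exponential globally Lipschitz, as needed for the equation satisfied by
`log σ`. -/
lemma abs_exp_min_sub_le (K x y : ℝ) :
    |Real.exp (min x K) - Real.exp (min y K)| ≤ Real.exp K * |x - y| := by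
  have aux : ∀ p q : ℝ, p ≤ q → q ≤ K → Real.exp q - Real.exp p ≤ Real.exp K * (q - p) := by
    intro p q hpq hq
    have h1 : Real.exp p = Real.exp q * Real.exp (p - q) := by rw [← Real.exp_add]; congr 1; ring
    have h2 := Real.add_one_le_exp (p - q)
    have h3 : Real.exp q ≤ Real.exp K := Real.exp_le_exp.2 hq
    have h4 := Real.exp_pos q
    rw [h1]
    nlinarith
  have h5 : |min x K - min y K| ≤ |x - y| := by
    have := abs_min_sub_min_le_max x K y K
    simpa using this
  refine le_trans ?_ (mul_le_mul_of_nonneg_left h5 (Real.exp_nonneg K))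
  rcases le_total (min x K) (min y K) with h | h
  · rw [abs_sub_comm, abs_sub_comm (min x K), abs_of_nonneg (sub_nonneg.2 (Real.exp_le_exp.2 h)),
      abs_of_nonneg (sub_nonneg.2 h)]
    exact aux _ _ h (min_le_right _ _)
  · rw [abs_of_nonneg (sub_nonneg.2 (Real.exp_le_exp.2 h)), abs_of_nonneg (sub_nonneg.2 h)]
    exact aux _ _ h (min_le_right _ _)

/-- The unknown is `ρ = log σ`, with `ρ' = -κ a(t, e^ρ)`, which makes positivity automatic.
Truncating `ρ` at `K = κBT` gives a bounded, globally Lipschitz field; since `ρ' ≤ κB`, the solution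
satisfies `ρ ≤ κBt ≤ K` and the truncation is never active. -/
lemma IsRate.exists_on_Icc {a : ℝ → ℝ → ℝ} (ha : IsRate a) {κ B : ℝ} (hκ : 0 ≤ κ) (hB : 0 ≤ B)
    (hlow : ∀ t ≥ 0, ∀ s, -B ≤ a t s) {T : ℝ} (hT : 0 ≤ T) :
    ∃ σ : ℝ → ℝ, σ 0 = 1 ∧ (∀ t ∈ Set.Icc 0 T, 0 < σ t) ∧
      ∀ t ∈ Set.Icc 0 T, HasDerivWithinAt σ (-κ * a t (σ t) * σ t) (Set.Icc 0 T) t := by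
  set K := κ * B * T with hK
  obtain ⟨A, hA, hAb⟩ := ha.bounded T (Real.exp K)
  obtain ⟨L, hL, hLip⟩ := ha.lipschitz T (Real.exp K)
  have hR : ∀ x, |Real.exp (min x K)| ≤ Real.exp K := fun x => by
    rw [abs_of_pos (Real.exp_pos _)]; exact Real.exp_le_exp.2 (min_le_right _ _)
  set c : ℝ → ℝ → ℝ := fun t x => -κ * a t (Real.exp (min x K)) with hc
  -- The truncated field is bounded by `κA` everywhere, so a solution travels at most `κAT`; a ball
  -- of this radius covers the whole interval at once.
  have hPL : IsPicardLindelof c (tmin := 0) (tmax := T) ⟨0, le_rfl, hT⟩ 0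
      (Real.toNNReal (κ * A * T)) 0 (Real.toNNReal (κ * A))
      (Real.toNNReal (κ * (L * Real.exp K))) := by
    constructor
    · intro t ht
      refine LipschitzWith.lipschitzOnWith (LipschitzWith.of_dist_le_mul fun x y => ?_)
      rw [Real.coe_toNNReal _ (by positivity), Real.dist_eq, Real.dist_eq, hc]
      simp only
      rw [← mul_sub, abs_mul, abs_neg, abs_of_nonneg hκ, mul_assoc]
      gcongr
      calc _ ≤ L * |Real.exp (min x K) - Real.exp (min y K)| := hLip t ht _ _ (hR x) (hR y)
        _ ≤ L * (Real.exp K * |x - y|) := by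
          gcongr
          exact abs_exp_min_sub_le K x y
        _ = _ := by ring
    · intro x _
      refine continuousOn_const.mul ?_
      refine ha.continuousOn.comp (f := fun t : ℝ => (t, Real.exp (min x K)))
        (Continuous.continuousOn (by fun_prop)) fun t ht => ⟨ht.1, Set.mem_univ _⟩
    · intro t ht x _
      rw [Real.coe_toNNReal _ (by positivity), Real.norm_eq_abs, hc]
      simp only
      rw [abs_mul, abs_neg, abs_of_nonneg hκ]
      gcongr
      exact hAb t ht _ (hR x)
    · rw [Real.coe_toNNReal _ (by positivity), Real.coe_toNNReal _ (by positivity)]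
      simp [hT]
  obtain ⟨ρ, hρ0, hρ⟩ := hPL.exists_eq_forall_mem_Icc_hasDerivWithinAt₀
  have hρc : ContinuousOn ρ (Set.Icc 0 T) := fun t ht => (hρ t ht).continuousWithinAt
  have hbound : ∀ t ∈ Set.Icc 0 T, ρ t ≤ κ * B * t := by
    refine image_le_of_deriv_right_le_deriv_boundary (f' := fun t => c t (ρ t))
      (B' := fun _ => κ * B) hρc
      (fun t ht => hasDerivWithinAt_Ici_of_Icc ht (hρ t (Set.Ico_subset_Icc_self ht)))
      (by simpa using hρ0.le) (by fun_prop) (fun t _ => ?_) (fun t ht => ?_)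
    · simpa using ((hasDerivAt_id t).const_mul (κ * B)).hasDerivWithinAt
    · have := hlow t ht.1 (Real.exp (min (ρ t) K))
      simp only [hc]
      nlinarith
  have hmin : ∀ t ∈ Set.Icc 0 T, min (ρ t) K = ρ t := fun t ht => by
    refine min_eq_left ((hbound t ht).trans ?_)
    rw [hK]
    gcongr
    exact ht.2
  refine ⟨fun t => Real.exp (ρ t), by simpa using hρ0, fun t _ => Real.exp_pos _, fun t ht => ?_⟩
  have h1 := (hρ t ht).exp
  simp only [hc, hmin t ht] at h1
  exact h1.congr_deriv (by ring)

/-- Uniqueness on bounded intervals makes the solutions on `[0, n]` compatible, so they glue. -/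
theorem IsRate.exists_global {a : ℝ → ℝ → ℝ} (ha : IsRate a) {κ B : ℝ} (hκ : 0 ≤ κ) (hB : 0 ≤ B)
    (hlow : ∀ t ≥ 0, ∀ s, -B ≤ a t s) :
    ∃ σ : ℝ → ℝ, σ 0 = 1 ∧ (∀ t ≥ 0, 0 < σ t) ∧
      ∀ t ∈ Set.Ici 0, HasDerivWithinAt σ (-κ * a t (σ t) * σ t) (Set.Ici 0) t := by
  choose s hs0 hspos hs using fun n : ℕ => ha.exists_on_Icc hκ hB hlow (Nat.cast_nonneg' (α := ℝ) n)
  have hcompat : ∀ n N : ℕ, n ≤ N → Set.EqOn (s n) (s N) (Set.Icc 0 n) := fun n N hn => by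
    have hsub : Set.Icc (0 : ℝ) n ⊆ Set.Icc 0 N := Set.Icc_subset_Icc_right (by exact_mod_cast hn)
    exact ha.eqOn κ (by rw [hs0, hs0]) (hs n) fun t ht => (hs N t (hsub ht)).mono hsub
  set σ : ℝ → ℝ := fun t => s (⌊t⌋₊ + 1) t with hσ
  have hlt : ∀ t : ℝ, t ≤ ((⌊t⌋₊ + 1 : ℕ) : ℝ) := fun t => by
    push_cast; exact (Nat.lt_floor_add_one t).le
  have heq : ∀ (N : ℕ), ∀ t ∈ Set.Icc (0 : ℝ) N, σ t = s N t := fun N t ht => by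
    rcases le_total N (⌊t⌋₊ + 1) with h | h
    · exact (hcompat _ _ h ht).symm
    · exact hcompat _ _ h ⟨ht.1, hlt t⟩
  refine ⟨σ, ?_, fun t ht => hspos _ t ⟨ht, hlt t⟩, fun t ht => ?_⟩
  · rw [heq 0 0 (by simp), hs0]
  · obtain ⟨N, hN⟩ := exists_nat_gt t
    have htN : t ∈ Set.Icc (0 : ℝ) N := ⟨ht, hN.le⟩
    have h1 := (hs N t htN).congr (fun x hx => heq N x hx) (heq N t htN)
    rw [← heq N t htN] at h1
    refine h1.mono_of_mem_nhdsWithin ?_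
    rw [← Set.Ici_inter_Iic]
    exact Filter.inter_mem self_mem_nhdsWithin (mem_nhdsWithin_of_mem_nhds (Iic_mem_nhds hN))

/-! ### The rate given by Gaussian expectations -/

/-- The Gaussian expectation `E[D(t+ε², s G^m_t * η_ε(x))]`. -/
def gaussRate (D : ℝ → ℝ → ℝ) (m ε t s : ℝ) : ℝ :=
  ∫ z, D (t + ε ^ 2) (s * (flowStd m ε t * z)) ∂gaussianReal 0 1

lemma flowStd_nonneg (m ε t : ℝ) : 0 ≤ flowStd m ε t := by unfold flowStd; positivity

lemma continuousOn_flowStd (m : ℝ) {ε : ℝ} (hε : 0 < ε) :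
    ContinuousOn (flowStd m ε) (Set.Ici 0) := by
  unfold flowStd
  refine ContinuousOn.mul (Continuous.continuousOn (by fun_prop)) ?_
  refine Real.continuous_sqrt.comp_continuousOn (continuousOn_const.div
    (Continuous.continuousOn (by fun_prop)) fun t ht => ?_)
  have : 0 ≤ t := ht
  positivity

lemma exists_flowStd_le (m : ℝ) {ε : ℝ} (hε : 0 < ε) (T : ℝ) :
    ∃ Q ≥ 0, ∀ t ∈ Set.Icc 0 T, flowStd m ε t ≤ Q := by
  obtain ⟨Q, hQ⟩ := isCompact_Icc.exists_bound_of_continuousOn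
    ((continuousOn_flowStd m hε).mono fun t ht => ht.1)
  exact ⟨max Q 0, le_max_right _ _, fun t ht =>
    (le_abs_self _).trans ((hQ t ht).trans (le_max_left _ _))⟩

lemma TameCoeff.exists_polyLip {n : ℕ} {D : ℝ → ℝ → ℝ} (hD : TameCoeff n D) {ε : ℝ} (hε : 0 < ε)
    (T : ℝ) : ∃ C ≥ 0, ∀ t ∈ Set.Icc 0 T, PolyLip C n (D (t + ε ^ 2)) := by
  obtain ⟨C, hC, h⟩ := hD.polyLip (ε ^ 2) (pow_pos hε 2) (T + ε ^ 2)
  exact ⟨C, hC, fun t ht => h _ ⟨by linarith [ht.1], by linarith [ht.2]⟩⟩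

lemma TameCoeff.continuous {n : ℕ} {D : ℝ → ℝ → ℝ} (hD : TameCoeff n D) {r : ℝ} (hr : 0 < r) :
    Continuous (D r) := by
  rw [← continuousOn_univ]
  exact hD.continuousOn.comp (f := fun u : ℝ => (r, u)) (by fun_prop)
    fun u _ => ⟨hr, Set.mem_univ _⟩

lemma PolyLip.abs_le_of_abs_le {C : ℝ} (hC : 0 ≤ C) {n : ℕ} {D : ℝ → ℝ} (h : PolyLip C n D)
    {u Q z : ℝ} (hQ : 0 ≤ Q) (hu : |u| ≤ Q * |z|) : |D u| ≤ C * (1 + Q) ^ n * (1 + |z|) ^ n := by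
  refine (h u 0).1.trans ?_
  rw [mul_assoc, ← mul_pow]
  gcongr
  nlinarith [abs_nonneg z]

lemma TameCoeff.integrable_gaussianReal {n : ℕ} {D : ℝ → ℝ → ℝ} (hD : TameCoeff n D) {r : ℝ}
    (hr : 0 < r) (q : ℝ) : Integrable (fun z => D r (q * z)) (gaussianReal 0 1) := by
  obtain ⟨C, hC, h⟩ := hD.polyLip r hr r
  have hp := h r ⟨le_rfl, le_rfl⟩
  refine ((integrable_one_add_abs_pow_gaussianReal 1 n).const_mul (C * (1 + |q|) ^ n)).mono'
    ((hD.continuous hr).comp (by fun_prop)).aestronglyMeasurable (ae_of_all _ fun z => ?_)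
  exact hp.abs_le_of_abs_le hC (abs_nonneg q) (abs_mul q z).le

/-- Continuity is dominated convergence with a polynomial majorant, locally uniform in `(t, s)`. For
the Lipschitz bound, an increment of `D` contributes `n` powers of `1 + |z|` and the change of its
argument one more, hence the moment of order `n + 1`. -/
lemma TameCoeff.isRate_gaussRate {n : ℕ} {D : ℝ → ℝ → ℝ} (hD : TameCoeff n D) (m : ℝ) {ε : ℝ}
    (hε : 0 < ε) : IsRate (gaussRate D m ε) := by
  have hε2 : 0 < ε ^ 2 := pow_pos hε 2
  constructor
  · rintro ⟨t₀, s₀⟩ ⟨ht₀, -⟩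
    simp only [Set.mem_Ici] at ht₀
    obtain ⟨C, hC, hp⟩ := hD.exists_polyLip hε (t₀ + 1)
    obtain ⟨Q, hQ, hQb⟩ := exists_flowStd_le m hε (t₀ + 1)
    refine continuousWithinAt_of_dominated
      (bound := fun z => C * (1 + (|s₀| + 1) * Q) ^ n * (1 + |z|) ^ n) ?_ ?_
      ((integrable_one_add_abs_pow_gaussianReal 1 n).const_mul _) ?_
    · filter_upwards [self_mem_nhdsWithin] with p hp
      have : 0 ≤ p.1 := hp.1
      exact ((hD.continuous (by positivity)).comp (by fun_prop)).aestronglyMeasurable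
    · have e1 : ∀ᶠ p : ℝ × ℝ in nhds (t₀, s₀), p.1 < t₀ + 1 :=
        continuous_fst.continuousAt.eventually_lt_const (by simp)
      have e2 : ∀ᶠ p : ℝ × ℝ in nhds (t₀, s₀), |p.2| < |s₀| + 1 :=
        continuous_snd.abs.continuousAt.eventually_lt_const (by simp)
      filter_upwards [self_mem_nhdsWithin, mem_nhdsWithin_of_mem_nhds e1,
        mem_nhdsWithin_of_mem_nhds e2] with p hp0 hp1 hp2
      have hpt : p.1 ∈ Set.Icc 0 (t₀ + 1) := ⟨hp0.1, le_of_lt hp1⟩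
      refine ae_of_all _ fun z => ?_
      refine (hp p.1 hpt).abs_le_of_abs_le hC (by positivity) ?_
      rw [abs_mul, abs_mul, abs_of_nonneg (flowStd_nonneg _ _ _), mul_assoc]
      exact mul_le_mul (le_of_lt hp2) (mul_le_mul_of_nonneg_right (hQb p.1 hpt) (abs_nonneg z))
        (mul_nonneg (flowStd_nonneg _ _ _) (abs_nonneg z)) (by positivity)
    · refine ae_of_all _ fun z => ?_
      have hstd : ContinuousWithinAt (fun p : ℝ × ℝ => flowStd m ε p.1) (Set.Ici 0 ×ˢ Set.univ)
          (t₀, s₀) :=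
        (continuousOn_flowStd m hε).comp (f := Prod.fst) continuousOn_fst
          (fun p (hp : p ∈ Set.Ici 0 ×ˢ Set.univ) => hp.1) (t₀, s₀) ⟨ht₀, Set.mem_univ _⟩
      have hmap : ContinuousWithinAt (fun p : ℝ × ℝ =>
          (p.1 + ε ^ 2, p.2 * (flowStd m ε p.1 * z))) (Set.Ici 0 ×ˢ Set.univ) (t₀, s₀) :=
        (continuousWithinAt_fst.add continuousWithinAt_const).prodMk
          (continuousWithinAt_snd.mul (hstd.mul continuousWithinAt_const))
      exact ContinuousWithinAt.comp (g := fun p : ℝ × ℝ => D p.1 p.2)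
        (f := fun p : ℝ × ℝ => (p.1 + ε ^ 2, p.2 * (flowStd m ε p.1 * z)))
        (hD.continuousOn _ ⟨by simp only [Set.mem_Ioi]; positivity, Set.mem_univ _⟩) hmap
        fun p hp => ⟨by
          have : 0 ≤ p.1 := hp.1
          simp only [Set.mem_Ioi]; positivity, Set.mem_univ _⟩
  · intro T R
    obtain ⟨C, hC, hp⟩ := hD.exists_polyLip hε T
    obtain ⟨Q, hQ, hQb⟩ := exists_flowStd_le m hε T
    refine ⟨C * (1 + 2 * |R| * Q) ^ n * Q * gaussMoment 1 (n + 1),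
      mul_nonneg (by positivity) (integral_nonneg fun z => by positivity),
      fun t ht s s' hs hs' => ?_⟩
    have hr : 0 < t + ε ^ 2 := by linarith [ht.1]
    have hint : ∀ s : ℝ, Integrable (fun z => D (t + ε ^ 2) (s * (flowStd m ε t * z)))
        (gaussianReal 0 1) := fun s => by
      simpa [mul_assoc] using hD.integrable_gaussianReal hr (s * flowStd m ε t)
    unfold gaussRate
    rw [← integral_sub (hint s) (hint s'), ← Real.norm_eq_abs]
    have hq0 := flowStd_nonneg m ε t
    have hqQ := hQb t ht
    have hb := norm_integral_le_of_norm_le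
      (f := fun z => D (t + ε ^ 2) (s * (flowStd m ε t * z))
        - D (t + ε ^ 2) (s' * (flowStd m ε t * z)))
      ((integrable_one_add_abs_pow_gaussianReal 1 (n + 1)).const_mul
        (C * (1 + 2 * |R| * Q) ^ n * Q * |s - s'|)) (ae_of_all _ fun z => ?_)
    · refine hb.trans_eq ?_
      rw [integral_const_mul, gaussMoment]
      ring
    · rw [Real.norm_eq_abs]
      refine ((hp t ht) _ _).2.trans ?_
      have hR : |s| ≤ |R| := hs.trans (le_abs_self R)
      have hR' : |s'| ≤ |R| := hs'.trans (le_abs_self R)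
      have a1 : ∀ s : ℝ, |s| ≤ |R| → |s * (flowStd m ε t * z)| ≤ |R| * Q * |z| := fun s h => by
        rw [abs_mul, abs_mul, abs_of_nonneg hq0, mul_assoc]
        gcongr
      have a2 : |s * (flowStd m ε t * z) - s' * (flowStd m ε t * z)| ≤ |s - s'| * (Q * (1 + |z|)) := by
        rw [← sub_mul, abs_mul, abs_mul, abs_of_nonneg hq0]
        gcongr
        linarith
      have a3 : 1 + |s * (flowStd m ε t * z)| + |s' * (flowStd m ε t * z)|
          ≤ (1 + 2 * |R| * Q) * (1 + |z|) := by
        have h1 := a1 s hR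
        have h2 := a1 s' hR'
        have h3 : 0 ≤ |R| * Q := by positivity
        nlinarith [abs_nonneg z]
      calc _ ≤ C * ((1 + 2 * |R| * Q) * (1 + |z|)) ^ n * (|s - s'| * (Q * (1 + |z|))) := by
            gcongr
        _ = _ := by rw [mul_pow, pow_succ]; ring

lemma TameCoeff.neg_div_le_gaussRate {n : ℕ} {D : ℝ → ℝ → ℝ} (hD : TameCoeff n D) (m : ℝ) {ε : ℝ}
    (hε : 0 < ε) {L : ℝ} (hL : ∀ r > 0, ∀ u, -(L / r) ≤ D r u) {t : ℝ} (ht : 0 ≤ t) (s : ℝ) :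
    -(L / (t + ε ^ 2)) ≤ gaussRate D m ε t s := by
  have hr : 0 < t + ε ^ 2 := by positivity
  have h1 : Integrable (fun z => D (t + ε ^ 2) (s * (flowStd m ε t * z))) (gaussianReal 0 1) := by
    simpa [mul_assoc] using hD.integrable_gaussianReal hr (s * flowStd m ε t)
  have h2 := integral_mono (integrable_const (-(L / (t + ε ^ 2)))) h1 fun z => hL _ hr _
  simpa [gaussRate] using h2

section Expectation

variable {Ω : Type*} [MeasurableSpace Ω] {P : Measure Ω} [IsProbabilityMeasure P]
  {η : Ω → 𝓢(Plane, ℝ) →L[ℝ] ℝ}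

lemma IsWhiteNoise.integrable_coeff (hη : IsWhiteNoise P η) {ε : ℝ} (hε : 0 < ε) (m : ℝ) {n : ℕ}
    {D : ℝ → ℝ → ℝ} (hD : TameCoeff n D) {t : ℝ} (ht : 0 ≤ t) (s : ℝ) (x : Plane) :
    Integrable (fun ω => D (t + ε ^ 2) (s * heatFlow m t (mollify ε hε (η ω)) x)) P := by
  have hr : 0 < t + ε ^ 2 := by positivity
  have hl := hη.hasLaw_heatFlow hε m ht x
  have h1 : Integrable (fun u => D (t + ε ^ 2) (s * u))
      ((gaussianReal 0 1).map fun z => flowStd m ε t * z) := by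
    have hc : Continuous fun u => D (t + ε ^ 2) (s * u) := (hD.continuous hr).comp (by fun_prop)
    rw [integrable_map_measure hc.aestronglyMeasurable (by fun_prop)]
    simpa [Function.comp_def, mul_assoc] using
      hD.integrable_gaussianReal hr (s * flowStd m ε t)
  rw [← hl.map_eq] at h1
  exact h1.comp_aemeasurable hl.aemeasurable

/-- The point where `x` disappears: the expectation depends only on the one-point law. -/
lemma IsWhiteNoise.integral_coeff (hη : IsWhiteNoise P η) {ε : ℝ} (hε : 0 < ε) (m : ℝ) {n : ℕ}
    {D : ℝ → ℝ → ℝ} (hD : TameCoeff n D) {t : ℝ} (ht : 0 ≤ t) (s : ℝ) (x : Plane) :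
    ∫ ω, D (t + ε ^ 2) (s * heatFlow m t (mollify ε hε (η ω)) x) ∂P = gaussRate D m ε t s := by
  have hr : 0 < t + ε ^ 2 := by positivity
  have hl := hη.hasLaw_heatFlow hε m ht x
  have hc : Continuous fun u => D (t + ε ^ 2) (s * u) := (hD.continuous hr).comp (by fun_prop)
  have h1 := hl.integral_comp (f := fun u => D (t + ε ^ 2) (s * u)) hc.aestronglyMeasurable
  rw [integral_map (by fun_prop) hc.aestronglyMeasurable] at h1
  exact h1

end Expectation

/-! ### Self-similar nonlinearities -/

/-- The statistic `y ↦ (θ ↦ -θ y²)` on the line. -/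
def sqStat (y : ℝ) : ℝ →L[ℝ] ℝ := (-y ^ 2) • ContinuousLinearMap.id ℝ ℝ

lemma continuous_sqStat : Continuous sqStat := by
  unfold sqStat
  exact ((continuous_pow 2).neg).smul continuous_const

lemma norm_sqStat (y : ℝ) : ‖sqStat y‖ = y ^ 2 := by
  rw [sqStat, norm_smul, ContinuousLinearMap.norm_id, mul_one, Real.norm_eq_abs, abs_neg,
    abs_of_nonneg (sq_nonneg y)]

lemma expIntegrableAt_sqStat {C : ℝ} {n : ℕ} {h : ℝ → ℝ} (hC : 0 ≤ C) (hc : Continuous h)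
    (hb : ∀ y, |h y| ≤ C * (1 + |y|) ^ n) {θ : ℝ} (hθ : 0 < θ) :
    ExpIntegrableAt volume sqStat h θ := by
  have hθ4 : 0 < θ / 4 := by positivity
  -- The decay `θ` is split: `θ/2` for the margin, `θ/4` against the polynomial, and `θ/4` for
  -- integrability.
  refine ⟨θ / 2, by positivity, ((integrable_exp_neg_mul_sq hθ4).const_mul
    (C * ((2 / (θ / 4)) ^ n * n.factorial * Real.exp (θ / 4)))).mono' ?_ (ae_of_all _ fun y => ?_)⟩
  · have h1 : Continuous fun y => sqStat y θ := continuous_sqStat.clm_apply continuous_const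
    exact ((Real.continuous_exp.comp (h1.add (continuous_const.mul
      continuous_sqStat.norm))).mul hc.norm).aestronglyMeasurable
  · rw [Real.norm_of_nonneg (by positivity), norm_sqStat, Real.norm_eq_abs]
    have h1 := one_add_pow_mul_exp_le hθ4 n (abs_nonneg y)
    rw [sq_abs] at h1
    have h2 : Real.exp (sqStat y θ + θ / 2 * y ^ 2)
        = Real.exp (-(θ / 4 * y ^ 2)) * Real.exp (-(θ / 4) * y ^ 2) := by
      rw [← Real.exp_add]; congr 1; simp [sqStat]; ring
    calc Real.exp (sqStat y θ + θ / 2 * y ^ 2) * |h y|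
        ≤ (Real.exp (-(θ / 4 * y ^ 2)) * Real.exp (-(θ / 4) * y ^ 2)) * (C * (1 + |y|) ^ n) := by
          rw [h2]; gcongr; exact hb y
      _ = C * ((1 + |y|) ^ n * Real.exp (-(θ / 4 * y ^ 2))) * Real.exp (-(θ / 4) * y ^ 2) := by ring
      _ ≤ _ := by gcongr

/-- Gaussian expectations depend smoothly on the standard deviation. -/
lemma contDiffOn_gaussian_expectation {C : ℝ} {n : ℕ} {h : ℝ → ℝ} (hC : 0 ≤ C)
    (hc : Continuous h) (hb : ∀ y, |h y| ≤ C * (1 + |y|) ^ n) :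
    ContDiffOn ℝ (⊤ : ℕ∞) (fun q => ∫ z, h (q * z) ∂gaussianReal 0 1) (Set.Ioi 0) := by
  -- Substituting `y = q z` moves `q` from the merely continuous `h` into the Gaussian density,
  -- which is an exponential family in `1/(2q²)`.
  have h0 : ContDiffOn ℝ (⊤ : ℕ∞) (expIntegral volume sqStat h) (Set.Ioi 0) :=
    contDiffOn_expIntegral continuous_sqStat.aestronglyMeasurable hc.aestronglyMeasurable
      fun θ hθ => expIntegrableAt_sqStat hC hc hb hθ
  have h1 : ContDiffOn ℝ (⊤ : ℕ∞) (fun q : ℝ => 1 / (2 * q ^ 2)) (Set.Ioi 0) :=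
    contDiffOn_const.div (by fun_prop) fun q hq => by
      have : 0 < q := hq
      positivity
  have h2 : ContDiffOn ℝ (⊤ : ℕ∞) (fun q : ℝ => (Real.sqrt (2 * Real.pi))⁻¹ * q⁻¹) (Set.Ioi 0) :=
    contDiffOn_const.mul (contDiffOn_id.inv fun q hq => (show 0 < q from hq).ne')
  refine (h2.mul (h0.comp h1 fun q hq => ?_)).congr fun q hq => ?_
  · have : 0 < q := hq
    simp only [Set.mem_Ioi]; positivity
  · have hq0 : 0 < q := hq
    have e1 : ∫ z, h (q * z) ∂gaussianReal 0 1
        = ∫ y, h y ∂((gaussianReal 0 1).map (fun z => q * z)) := by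
      rw [integral_map (by fun_prop) hc.aestronglyMeasurable]
    have hv : (NNReal.mk (q ^ 2) (sq_nonneg _) * 1 : NNReal) ≠ 0 := by
      rw [mul_one]
      intro hz
      have := congrArg NNReal.toReal hz
      simp at this
      exact hq0.ne' this
    rw [e1, gaussianReal_map_const_mul, mul_zero, integral_gaussianReal_eq_integral_smul hv]
    simp only [Function.comp_apply]
    rw [expIntegral, ← integral_const_mul]
    refine integral_congr_ae (ae_of_all _ fun y => ?_)
    simp only [gaussianPDFReal, smul_eq_mul, mul_one, sub_zero, NNReal.coe_mk]
    rw [Real.sqrt_mul (by positivity), Real.sqrt_sq hq0.le, mul_inv, mul_assoc]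
    congr 2
    simp only [sqStat]
    rw [show -y ^ 2 / (2 * q ^ 2) = ((-y ^ 2) • ContinuousLinearMap.id ℝ ℝ) (1 / (2 * q ^ 2)) by
      simp; ring]

/-- The self-similar scaling cancels the factor `(t+ε²)^{-1/2}` of the standard deviation, so `t`
enters the rescaled argument only through `e^{mt}`. -/
lemma sqrt_mul_flowStd (m : ℝ) {ε t : ℝ} (hε : 0 < ε) (ht : 0 ≤ t) :
    Real.sqrt (t + ε ^ 2) * flowStd m ε t = Real.exp (m * t) * Real.sqrt (1 / (4 * Real.pi)) := by
  have hr : 0 < t + ε ^ 2 := by positivity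
  rw [flowStd, mul_left_comm, ← Real.sqrt_mul hr.le]
  congr 2
  field_simp

/-- Regularity of the rate in the self-similar case. -/
lemma gaussRate_selfSimilar {f : ℝ → ℝ → ℝ} (hf : MemSbar f) (m : ℝ) {ε : ℝ} (hε : 0 < ε)
    {F : ℝ → ℝ} (hF : ∀ t > 0, ∀ u, f t u = t ^ (-(3 / 2) : ℝ) * F (Real.sqrt t * u)) :
    ∃ A : ℝ → ℝ, ContDiffOn ℝ (⊤ : ℕ∞) A (Set.Ioi 0) ∧ ∀ t ≥ 0, ∀ s,
      gaussRate (fun r => deriv (f r)) m ε t s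
        = (t + ε ^ 2)⁻¹ * A (s * (Real.exp (m * t) * Real.sqrt (1 / (4 * Real.pi)))) := by
  have hresc : ∀ t > 0, rescale f t = F := fun t ht => by
    funext u
    have h1 : Real.sqrt t ≠ 0 := (Real.sqrt_pos.2 ht).ne'
    rw [rescale, hF t ht, ← mul_assoc, ← Real.rpow_add ht, mul_div_cancel₀ _ h1]
    simp
  obtain ⟨C, hC, n, hn⟩ := MemS.exists_polyLip hf
  have hp : PolyLip C n (deriv F) := by
    have := hn 1 one_pos
    rwa [hresc 1 one_pos] at this
  have hcont : Continuous (deriv F) := by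
    have h1 := continuousOn_deriv_of_polyLip (MemS.continuousOn hf)
      (fun t ht => MemS.differentiable hf ht) hC hn
    rw [← hresc 1 one_pos, ← continuousOn_univ]
    exact h1.comp (f := fun u : ℝ => ((1 : ℝ), u)) (by fun_prop)
      fun u _ => ⟨show (0 : ℝ) < 1 from one_pos, Set.mem_univ _⟩
  refine ⟨fun q => ∫ z, deriv F (q * z) ∂gaussianReal 0 1,
    contDiffOn_gaussian_expectation hC hcont fun y => (hp y 0).1, fun t ht s => ?_⟩
  have hr : 0 < t + ε ^ 2 := by positivity
  rw [gaussRate, ← integral_const_mul]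
  refine integral_congr_ae (ae_of_all _ fun z => ?_)
  simp only
  rw [deriv_eq_rescale f hr, hresc _ hr, ← sqrt_mul_flowStd m hε ht]
  congr 2
  ring

/-! ### Comparison -/

/-- The solution `((t+ε²)/ε²)^{κL}` of `E' = κ L (t+ε²)⁻¹ E`, `E(0) = 1`. -/
def growthFactor (κ L ε t : ℝ) : ℝ :=
  Real.exp (κ * L * (Real.log (t + ε ^ 2) - Real.log (ε ^ 2)))

lemma growthFactor_zero (κ L ε : ℝ) : growthFactor κ L ε 0 = 1 := by simp [growthFactor]

lemma hasDerivAt_growthFactor (κ L : ℝ) {ε t : ℝ} (hε : 0 < ε) (ht : 0 ≤ t) :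
    HasDerivAt (growthFactor κ L ε) (κ * (L / (t + ε ^ 2)) * growthFactor κ L ε t) t := by
  have hr : t + ε ^ 2 ≠ 0 := by positivity
  have h1 : HasDerivAt (fun s => κ * L * (Real.log (s + ε ^ 2) - Real.log (ε ^ 2)))
      (κ * L * (1 / (t + ε ^ 2))) t :=
    ((((hasDerivAt_id t).add_const (ε ^ 2)).log hr).sub_const _).const_mul _
  exact h1.exp.congr_deriv (by unfold growthFactor; ring)

lemma continuousOn_growthFactor (κ L : ℝ) {ε : ℝ} (hε : 0 < ε) :
    ContinuousOn (growthFactor κ L ε) (Set.Ici 0) :=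
  fun _ ht => (hasDerivAt_growthFactor κ L hε ht).continuousAt.continuousWithinAt

lemma growthFactor_eq_exp_integral (κ L : ℝ) {ε t : ℝ} (hε : 0 < ε) (ht : 0 ≤ t) :
    growthFactor κ L ε t = Real.exp (κ * L * ∫ s in (0 : ℝ)..t, 1 / (s + ε ^ 2)) := by
  have hpos : ∀ s ∈ Set.uIcc 0 t, 0 < s + ε ^ 2 := fun s hs => by
    rw [Set.uIcc_of_le ht] at hs
    have := hs.1
    positivity
  rw [growthFactor, intervalIntegral.integral_eq_sub_of_hasDerivAt
    (f := fun s => Real.log (s + ε ^ 2)) (f' := fun s => 1 / (s + ε ^ 2))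
    (fun s hs => ((hasDerivAt_id s).add_const (ε ^ 2)).log (hpos s hs).ne')]
  · simp
  · refine ContinuousOn.intervalIntegrable (continuousOn_const.div
      (Continuous.continuousOn (by fun_prop)) fun s hs => (hpos s hs).ne')

/-- The quotient of `σ` by the growth factor has derivative `-κ (a + L/(t+ε²))` times itself, hence
decreases from the value `1`. -/
lemma le_growthFactor {κ L ε : ℝ} (hκ : 0 ≤ κ) (hε : 0 < ε) {a σ : ℝ → ℝ} (h0 : σ 0 = 1)
    (hpos : ∀ t ≥ 0, 0 < σ t) (ha : ∀ t ≥ 0, -(L / (t + ε ^ 2)) ≤ a t)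
    (hσ : ∀ t ∈ Set.Ici 0, HasDerivWithinAt σ (-κ * a t * σ t) (Set.Ici 0) t) :
    ∀ t ≥ 0, σ t ≤ growthFactor κ L ε t := by
  have hq : ∀ t, 0 < growthFactor κ L ε t := fun t => Real.exp_pos _
  have hder : ∀ t > 0, HasDerivAt (fun s => σ s / growthFactor κ L ε s)
      (-κ * (a t + L / (t + ε ^ 2)) * σ t / growthFactor κ L ε t) t := fun t ht => by
    refine (((hσ t ht.le).hasDerivAt (Ici_mem_nhds ht)).div
      (hasDerivAt_growthFactor κ L hε ht.le) (hq t).ne').congr_deriv ?_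
    have := (hq t).ne'
    field_simp
    ring
  have hanti : AntitoneOn (fun s => σ s / growthFactor κ L ε s) (Set.Ici 0) := by
    refine antitoneOn_of_deriv_nonpos (convex_Ici 0) ?_ ?_ ?_
    · exact ContinuousOn.div (fun t ht => (hσ t ht).continuousWithinAt)
        (continuousOn_growthFactor κ L hε) fun t _ => (hq t).ne'
    · rw [interior_Ici]
      exact fun t ht => (hder t ht).differentiableAt.differentiableWithinAt
    · rw [interior_Ici]
      intro t ht
      have ht' : 0 < t := ht
      rw [(hder t ht).deriv]
      have h1 := ha t ht'.le
      have h2 : 0 ≤ κ * (a t + L / (t + ε ^ 2)) * σ t :=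
        mul_nonneg (mul_nonneg hκ (by linarith)) (hpos t ht'.le).le
      refine div_nonpos_of_nonpos_of_nonneg (by linarith) (hq t).le
  intro t ht
  have := hanti (Set.self_mem_Ici) ht ht
  simp only [h0, growthFactor_zero, div_one] at this
  exact (div_le_one (hq t)).1 this

/-- The solution with initial datum `|g|` of the linear equation
`∂_t W = ½ Δ W + (m + κ L (t+ε²)⁻¹) W`. -/
def majorant (κ L ε m : ℝ) (g : Plane → ℝ) (t : ℝ) (x : Plane) : ℝ :=
  growthFactor κ L ε t * heatFlow m t (fun y => |g y|) x

lemma heatFlow_nonneg (m : ℝ) {t : ℝ} (ht : 0 ≤ t) {g : Plane → ℝ} (hg : ∀ y, 0 ≤ g y)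
    (x : Plane) : 0 ≤ heatFlow m t g x := by
  rw [heatFlow_eq_integral_gaussPlane m ht]
  exact mul_nonneg (Real.exp_nonneg _) (integral_nonneg fun z => hg _)

lemma laplacian_const_mul {h : Plane → ℝ} {x : Plane} (hh : ContDiff ℝ 2 h) (c : ℝ) :
    (Δ (fun y => c * h y)) x = c * (Δ h) x := by
  have := InnerProductSpace.laplacian_smul (x := x) c hh.contDiffAt
  simpa [Pi.smul_def] using this

/-- Bounds for solutions of a forced linear equation with potential bounded from below. -/
theorem abs_le_mul_majorant {T κ L ε m : ℝ} (hκ : 0 ≤ κ) (hL : 0 ≤ L) (hε : 0 < ε)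
    {g : Plane → ℝ} (hg : TameFun g) {φ φ' : ℝ → ℝ} (hφ : ∀ t, HasDerivAt φ (φ' t) t)
    (hφ0 : ∀ t, 0 ≤ φ t) {d α r : ℝ → Plane → ℝ}
    (hcont : ContinuousOn (fun p : ℝ × Plane => d p.1 p.2) (Set.Ici 0 ×ˢ Set.univ))
    (hsmooth : ∀ t > 0, ContDiff ℝ 2 (d t))
    (hderiv : ∀ t ∈ Set.Ioc 0 T, ∀ x, HasDerivAt (fun s => d s x)
      (1 / 2 * (Δ (d t)) x + m * d t x - κ * α t x * d t x + r t x) t)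
    (hα : ∀ t ∈ Set.Ioc 0 T, ∀ x, -(L / (t + ε ^ 2)) ≤ α t x)
    (hr : ∀ t ∈ Set.Ioc 0 T, ∀ x, |r t x| ≤ φ' t * majorant κ L ε m g t x)
    (h0 : ∀ x, |d 0 x| ≤ φ 0 * |g x|) (hgrowth : ExpGrowth d) :
    ∀ t ∈ Set.Icc 0 T, ∀ x, |d t x| ≤ φ t * majorant κ L ε m g t x := by
  have hε2 : 0 < ε ^ 2 := pow_pos hε 2
  have hflow := hg.abs
  set H : ℝ → Plane → ℝ := fun t x => heatFlow m t (fun y => |g y|) x with hH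
  set q : ℝ → ℝ := fun t => φ t * growthFactor κ L ε t with hq
  have hqd : ∀ t ≥ 0, HasDerivAt q (φ' t * growthFactor κ L ε t
      + φ t * (κ * (L / (t + ε ^ 2)) * growthFactor κ L ε t)) t := fun t ht =>
    (hφ t).mul (hasDerivAt_growthFactor κ L hε ht)
  obtain ⟨a, ha, C, hC⟩ := hgrowth T
  have key : ∀ c : ℝ, |c| = 1 → ∀ t ∈ Set.Icc 0 T, ∀ x, c * d t x - q t * H t x ≤ 0 := by
    intro c hc
    -- The two signs `c = ±1` give the bound on the modulus. The constant `b` dominates `m +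
    -- κL/(t+ε²)` for all times, and is used only where the function is positive.
    refine maximum_principle (C := C) (b := |m| + κ * (L / ε ^ 2)) ha
      (u' := fun t x => c * (1 / 2 * (Δ (d t)) x + m * d t x - κ * α t x * d t x + r t x)
        - ((φ' t * growthFactor κ L ε t
          + φ t * (κ * (L / (t + ε ^ 2)) * growthFactor κ L ε t)) * H t x
          + q t * (1 / 2 * (Δ (H t)) x + m * H t x)))
      ?_ ?_ ?_ ?_ ?_ ?_
    · have hsub : Set.Icc 0 T ×ˢ (Set.univ : Set Plane) ⊆ Set.Ici 0 ×ˢ Set.univ :=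
        Set.prod_mono Set.Icc_subset_Ici_self subset_rfl
      refine ContinuousOn.sub (continuousOn_const.mul (hcont.mono hsub)) (ContinuousOn.mul ?_
        ((hflow.continuousOn_heatFlow m).mono hsub))
      exact ContinuousOn.comp (g := q) (f := Prod.fst) (t := Set.Ici 0)
        (fun t ht => (hqd t ht).continuousAt.continuousWithinAt) continuousOn_fst
        fun p hp => hp.1.1
    · intro t ht
      exact (contDiff_const.mul (hsmooth t ht.1)).sub
        (contDiff_const.mul (contDiff_infty.1 (hflow.contDiff_heatFlow m ht.1) 2))
    · intro t ht x
      exact ((hderiv t ht x).const_mul c).sub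
        ((hqd t ht.1.le).mul (hflow.hasDerivAt_heatFlow m ht.1 x))
    · intro t ht x hpos
      have hHs : ContDiff ℝ 2 (H t) := contDiff_infty.1 (hflow.contDiff_heatFlow m ht.1) 2
      have hlap : (Δ (fun x => c * d t x - q t * H t x)) x
          = c * (Δ (d t)) x - q t * (Δ (H t)) x := by
        have := (contDiff_const.mul (hsmooth t ht.1) : ContDiff ℝ 2 fun x => c * d t x).contDiffAt
          (x := x) |>.laplacian_sub
          ((contDiff_const.mul hHs : ContDiff ℝ 2 fun x => q t * H t x).contDiffAt)
        rw [laplacian_const_mul (hsmooth t ht.1), laplacian_const_mul hHs] at this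
        exact this
      rw [hlap]
      have ht0 : 0 < t := ht.1
      have hHn : 0 ≤ H t x := heatFlow_nonneg m ht0.le (fun _ => abs_nonneg _) x
      have hEn : 0 ≤ growthFactor κ L ε t := Real.exp_nonneg _
      have hqn : 0 ≤ q t := mul_nonneg (hφ0 t) hEn
      have hqH : 0 ≤ q t * H t x := mul_nonneg hqn hHn
      have hr1 : c * r t x ≤ φ' t * growthFactor κ L ε t * H t x := by
        refine (le_abs_self _).trans ?_
        rw [abs_mul, hc, one_mul, mul_assoc]
        exact hr t ht x
      -- Where the compared function is positive, `c * d` exceeds a non-negative quantity, so the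
      -- lower bound on `α` alone fixes the sign of this term.
      have hα1 : 0 ≤ κ * (α t x + L / (t + ε ^ 2)) * (c * d t x) :=
        mul_nonneg (mul_nonneg hκ (by linarith [hα t ht x])) (by linarith)
      have hb : (m + κ * (L / (t + ε ^ 2))) * (c * d t x - q t * H t x)
          ≤ (|m| + κ * (L / ε ^ 2)) * (c * d t x - q t * H t x) := by
        refine mul_le_mul_of_nonneg_right (add_le_add (le_abs_self m)
          (mul_le_mul_of_nonneg_left ?_ hκ)) hpos.le
        exact div_le_div_of_nonneg_left hL hε2 (by linarith)
      have e : c * (1 / 2 * (Δ (d t)) x + m * d t x - κ * α t x * d t x + r t x)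
        - ((φ' t * growthFactor κ L ε t
          + φ t * (κ * (L / (t + ε ^ 2)) * growthFactor κ L ε t)) * H t x
          + q t * (1 / 2 * (Δ (H t)) x + m * H t x))
        = 1 / 2 * (c * (Δ (d t)) x - q t * (Δ (H t)) x)
          + (m + κ * (L / (t + ε ^ 2))) * (c * d t x - q t * H t x)
          - κ * (α t x + L / (t + ε ^ 2)) * (c * d t x)
          + (c * r t x - φ' t * growthFactor κ L ε t * H t x) := by
        simp only [hq]; ring
      rw [e]
      linarith
    · intro x
      have h1 : q 0 * H 0 x = φ 0 * |g x| := by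
        simp [hq, hH, growthFactor_zero, heatFlow]
      rw [h1]
      have h2 : c * d 0 x ≤ |d 0 x| := by
        refine (le_abs_self _).trans ?_
        rw [abs_mul, hc, one_mul]
      linarith [h0 x]
    · intro t ht x
      have h2 : c * d t x ≤ |d t x| := by
        refine (le_abs_self _).trans ?_
        rw [abs_mul, hc, one_mul]
      have h3 : 0 ≤ q t * H t x := mul_nonneg (mul_nonneg (hφ0 t) (Real.exp_nonneg _))
        (heatFlow_nonneg m ht.1 (fun _ => abs_nonneg _) x)
      linarith [hC t ht x]
  intro t ht x
  have h1 := key 1 (by simp) t ht x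
  have h2 := key (-1) (by simp) t ht x
  rw [majorant, ← mul_assoc, abs_le]
  simp only [hq, hH] at h1 h2
  constructor <;> linarith

/-! ### Regularity -/

lemma contDiffOn_succ_of_hasDerivAt {n : ℕ} {σ b : ℝ → ℝ}
    (hσ : ∀ t > 0, HasDerivAt σ (b t) t) (hb : ContDiffOn ℝ n b (Set.Ioi 0)) :
    ContDiffOn ℝ (n + 1) σ (Set.Ioi 0) := by
  rw [contDiffOn_succ_iff_deriv_of_isOpen isOpen_Ioi]
  refine ⟨fun t ht => (hσ t ht).differentiableAt.differentiableWithinAt, by simp, ?_⟩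
  exact hb.congr fun t ht => (hσ t ht).deriv

lemma continuousOn_iteratedFDeriv_space {h : ℝ → Plane → ℝ}
    (hh : ContDiffOn ℝ (⊤ : ℕ∞) (fun p : ℝ × Plane => h p.1 p.2) (Set.Ioi 0 ×ˢ Set.univ)) (n : ℕ) :
    ContinuousOn (fun p : ℝ × Plane => iteratedFDeriv ℝ n (h p.1) p.2) (Set.Ioi 0 ×ˢ Set.univ) := by
  set H : ℝ × Plane → ℝ := fun p => h p.1 p.2 with hH
  set U : Set (ℝ × Plane) := Set.Ioi 0 ×ˢ Set.univ with hU
  have hUo : IsOpen U := isOpen_Ioi.prod isOpen_univ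
  have hc : ContinuousOn (iteratedFDerivWithin ℝ n H U) U :=
    hh.continuousOn_iteratedFDerivWithin (by exact_mod_cast le_top) hUo.uniqueDiffOn
  refine ((ContinuousMultilinearMap.compContinuousLinearMapL (F := ℝ)
    (fun _ : Fin n => ContinuousLinearMap.inr ℝ ℝ Plane)).continuous.comp_continuousOn hc).congr ?_
  rintro ⟨t, x⟩ ⟨ht, -⟩
  have ht0 : 0 < t := ht
  -- The inclusion `y ↦ (t, y)` is affine. Translating by `(t, 0)` replaces it by the linear map
  -- `inr`, for which iterated derivatives of a composition are explicit.
  set τ : ℝ × Plane → ℝ × Plane := fun p => p + (t, 0) with hτ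
  set V : Set (ℝ × Plane) := τ ⁻¹' U with hV
  have hVo : IsOpen V := hUo.preimage (by fun_prop)
  have hmem : ∀ y : Plane, ContinuousLinearMap.inr ℝ ℝ Plane y ∈ V := fun y => by
    simp [hV, hτ, hU, ht0]
  have hpre : (ContinuousLinearMap.inr ℝ ℝ Plane) ⁻¹' V = Set.univ :=
    Set.eq_univ_of_forall hmem
  have h1 := ContinuousLinearMap.iteratedFDerivWithin_comp_right (f := H ∘ τ) (s := V)
    (ContinuousLinearMap.inr ℝ ℝ Plane) (n := ((⊤ : ℕ∞) : WithTop ℕ∞))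
    (hh.comp (by fun_prop) fun p hp => hp) hVo.uniqueDiffOn (by rw [hpre]; exact uniqueDiffOn_univ)
    (hmem x) (i := n) (by exact_mod_cast le_top)
  rw [hpre, iteratedFDerivWithin_univ] at h1
  have h2 : (H ∘ τ) ∘ (ContinuousLinearMap.inr ℝ ℝ Plane) = h t := by
    funext y; simp [hH, hτ]
  have h3 : iteratedFDerivWithin ℝ n (H ∘ τ) V (ContinuousLinearMap.inr ℝ ℝ Plane x)
      = iteratedFDerivWithin ℝ n H U (t, x) := by
    rw [iteratedFDerivWithin_of_isOpen n hVo (hmem x), iteratedFDerivWithin_of_isOpen n hUo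
      ⟨ht, Set.mem_univ _⟩]
    have := iteratedFDeriv_comp_add_right (𝕜 := ℝ) (f := H) n (t, 0)
      (ContinuousLinearMap.inr ℝ ℝ Plane x)
    simpa [hτ, Function.comp_def] using this
  rw [h2, h3] at h1
  exact h1

lemma TameFun.isRegular_mul_heatFlow {g : Plane → ℝ} (hg : TameFun g) (m : ℝ) {σ : ℝ → ℝ}
    (hσ : ContinuousOn σ (Set.Ici 0)) (hσ1 : ContDiffOn ℝ 1 σ (Set.Ioi 0)) :
    IsRegular fun t x => σ t * heatFlow m t g x where
  continuousOn := ContinuousOn.mul (hσ.comp (f := Prod.fst) continuousOn_fst fun p hp => hp.1)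
    (hg.continuousOn_heatFlow m)
  contDiffOn_one := ContDiffOn.mul (hσ1.comp (f := Prod.fst) contDiffOn_fst fun p hp => hp.1)
    ((hg.contDiffOn_heatFlow m).of_le (by exact_mod_cast le_top))
  contDiff_space t ht := contDiff_const.mul (hg.contDiff_heatFlow m ht)
  continuousOn_space n := by
    refine ContinuousOn.congr (ContinuousOn.smul ((hσ.mono Set.Ioi_subset_Ici_self).comp
      (f := Prod.fst) continuousOn_fst fun p hp => hp.1)
      (continuousOn_iteratedFDeriv_space (h := fun t => heatFlow m t g) (hg.contDiffOn_heatFlow m) n)) ?_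
    rintro ⟨t, x⟩ ⟨ht, -⟩
    exact iteratedFDeriv_const_smul_apply' (a := σ t)
      (((hg.contDiff_heatFlow m ht).of_le (by exact_mod_cast le_top)).contDiffAt)

/-! ### Uniqueness for the McKean–Vlasov equation -/

section Uniqueness

variable {Ω : Type*} [MeasurableSpace Ω] {P : Measure Ω} {m ε : ℝ} {f : ℝ → ℝ → ℝ}
  {X : Ω → Plane → ℝ}

/-- The coefficient `E[f'(t+ε², w(t,x))]`. -/
def meanCoeff (P : Measure Ω) (ε : ℝ) (f : ℝ → ℝ → ℝ) (w : Ω → ℝ → Plane → ℝ) (t : ℝ)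
    (x : Plane) : ℝ :=
  ∫ ω, deriv (f (t + ε ^ 2)) (w ω t x) ∂P

lemma majorant_eq {Ω : Type*} (κ L ε m : ℝ) (X : Ω → Plane → ℝ) {t : ℝ} (ht : 0 ≤ t) (x : Plane) (ω : Ω) :
    majorant κ L ε m (X ω) t x
      = growthFactor κ L ε t * Real.exp (m * t) * absAverage X t x ω := by
  rw [majorant, heatFlow_eq_integral_gaussPlane m ht, absAverage, mul_assoc]

lemma exists_majorant_le {Ω : Type*} (κ L m : ℝ) (hε : 0 < ε) (X : Ω → Plane → ℝ) (T : ℝ) :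
    ∃ M ≥ 0, ∀ t ∈ Set.Icc 0 T, ∀ x ω, majorant κ L ε m (X ω) t x ≤ M * absAverage X t x ω := by
  have hc : ContinuousOn (fun t => growthFactor κ L ε t * Real.exp (m * t)) (Set.Icc 0 T) :=
    ((continuousOn_growthFactor κ L hε).mono fun t ht => ht.1).mul
      (Continuous.continuousOn (by fun_prop))
  obtain ⟨M, hM⟩ := isCompact_Icc.exists_bound_of_continuousOn hc
  refine ⟨max M 0, le_max_right _ _, fun t ht x ω => ?_⟩
  rw [majorant_eq κ L ε m X ht.1]
  exact mul_le_mul_of_nonneg_right ((le_abs_self _).trans ((hM t ht).trans (le_max_left _ _)))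
    (absAverage_nonneg X t x ω)

/-- The field `equation` speaks of `deriv`, which determines a genuine derivative only through the
`C¹` regularity. -/
lemma IsRegular.hasDerivAt {w : ℝ → Plane → ℝ} (hw : IsRegular w) {t : ℝ} (ht : 0 < t)
    (x : Plane) : HasDerivAt (fun s => w s x) (deriv (fun s => w s x) t) t := by
  have h1 : DifferentiableAt ℝ (fun p : ℝ × Plane => w p.1 p.2) (t, x) :=
    ((hw.contDiffOn_one.differentiableOn (by simp)).differentiableAt
      ((isOpen_Ioi.prod isOpen_univ).mem_nhds ⟨ht, Set.mem_univ _⟩))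
  have h2 : DifferentiableAt ℝ (fun s : ℝ => (s, x)) t := by fun_prop
  exact (DifferentiableAt.comp t (g := fun p : ℝ × Plane => w p.1 p.2) (f := fun s : ℝ => (s, x))
    h1 h2).hasDerivAt

lemma IsSolution.hasDerivAt {w : Ω → ℝ → Plane → ℝ} (hw : IsSolution P m ε f X w) :
    ∀ᵐ ω ∂P, ∀ t > 0, ∀ x, HasDerivAt (fun s => w ω s x)
      (1 / 2 * (Δ (w ω t)) x + m * w ω t x
        - 1 / Real.log ε⁻¹ * meanCoeff P ε f w t x * w ω t x) t := by
  filter_upwards [hw.regular, hw.equation] with ω h1 h2 t ht x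
  exact (h1.hasDerivAt ht x).congr_deriv (h2 t ht x)

variable [IsProbabilityMeasure P]

/-- Stability of the coefficient: the increment of `D` costs `n` powers of the Gaussian average and
the closeness of `Y` and `Z` one more. The moment of order `n + 1` is bounded uniformly in `(t, x)`,
so the loss is a constant times `ρ`. -/
lemma IsTameField.abs_integral_sub_le {v : NNReal} (hX : IsTameField P v X) {C M ρ : ℝ}
    (hC : 0 ≤ C) (hM : 0 ≤ M) (hρ : 0 ≤ ρ) {n : ℕ} {D : ℝ → ℝ} (hD : PolyLip C n D) {t : ℝ}
    {x : Plane} {Y Z : Ω → ℝ} (hY : ∀ᵐ ω ∂P, |Y ω| ≤ M * absAverage X t x ω)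
    (hZ : ∀ᵐ ω ∂P, |Z ω| ≤ M * absAverage X t x ω)
    (hYZ : ∀ᵐ ω ∂P, |Y ω - Z ω| ≤ ρ * (M * absAverage X t x ω))
    (hiY : Integrable (fun ω => D (Y ω)) P) (hiZ : Integrable (fun ω => D (Z ω)) P) :
    |∫ ω, D (Y ω) ∂P - ∫ ω, D (Z ω) ∂P|
      ≤ ρ * (C * (1 + 2 * M) ^ n * M * gaussMoment v (n + 1)) := by
  obtain ⟨hi, hle⟩ := hX.absAverage_moment t x (n + 1)
  rw [← integral_sub hiY hiZ, ← Real.norm_eq_abs]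
  have hb := norm_integral_le_of_norm_le (f := fun ω => D (Y ω) - D (Z ω))
    (hi.const_mul (ρ * (C * (1 + 2 * M) ^ n * M))) (by
      filter_upwards [hY, hZ, hYZ] with ω h1 h2 h3
      have hA := absAverage_nonneg X t x ω
      rw [Real.norm_eq_abs]
      refine (hD (Y ω) (Z ω)).2.trans ?_
      have h4 : 1 + |Y ω| + |Z ω| ≤ (1 + 2 * M) * (1 + absAverage X t x ω) := by nlinarith
      have h5 : |Y ω - Z ω| ≤ ρ * (M * (1 + absAverage X t x ω)) :=
        h3.trans (mul_le_mul_of_nonneg_left (mul_le_mul_of_nonneg_left (by linarith) hM) hρ)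
      calc C * (1 + |Y ω| + |Z ω|) ^ n * |Y ω - Z ω|
          ≤ C * ((1 + 2 * M) * (1 + absAverage X t x ω)) ^ n
            * (ρ * (M * (1 + absAverage X t x ω))) :=
            mul_le_mul (mul_le_mul_of_nonneg_left (pow_le_pow_left₀ (by positivity) h4 n) hC) h5
              (abs_nonneg _) (by positivity)
        _ = _ := by rw [mul_pow, pow_succ]; ring)
  refine hb.trans ?_
  rw [integral_const_mul]
  calc _ ≤ ρ * (C * (1 + 2 * M) ^ n * M) * gaussMoment v (n + 1) :=
        mul_le_mul_of_nonneg_left hle (by positivity)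
    _ = _ := by ring

lemma IsSolution.neg_div_le_meanCoeff {w : Ω → ℝ → Plane → ℝ} (hw : IsSolution P m ε f X w)
    (hε : 0 < ε) {L : ℝ} (hL : ∀ r > 0, ∀ u, -(L / r) ≤ deriv (f r) u) {t : ℝ} (ht : 0 ≤ t)
    (x : Plane) : -(L / (t + ε ^ 2)) ≤ meanCoeff P ε f w t x := by
  have h2 := integral_mono (integrable_const (-(L / (t + ε ^ 2)))) (hw.integrable t ht x)
    fun ω => hL _ (by positivity) _
  simpa [meanCoeff] using h2

/-- The comparison with `φ = 1` and no forcing. The growth constants of a solution depend on `ω`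
without any integrability; here they are traded for a majorant with finite moments. -/
lemma IsSolution.ae_abs_le_majorant {v : NNReal} (hX : IsTameField P v X)
    {w : Ω → ℝ → Plane → ℝ} (hw : IsSolution P m ε f X w) (hε : 0 < ε) (hε₁ : ε < 1) {L : ℝ}
    (hL0 : 0 ≤ L) (hL : ∀ r > 0, ∀ u, -(L / r) ≤ deriv (f r) u) (T : ℝ) :
    ∀ᵐ ω ∂P, ∀ t ∈ Set.Icc 0 T, ∀ x,
      |w ω t x| ≤ majorant (1 / Real.log ε⁻¹) L ε m (X ω) t x := by
  have hκ : 0 ≤ 1 / Real.log ε⁻¹ :=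
    one_div_nonneg.2 (Real.log_nonneg ((one_le_inv₀ hε).2 hε₁.le))
  filter_upwards [hw.regular, hw.hasDerivAt, hw.initial, hw.growth] with ω h1 h2 h3 h4 t ht x
  have := abs_le_mul_majorant (T := T) (φ := fun _ => 1) (φ' := fun _ => 0) (r := fun _ _ => 0)
    (α := meanCoeff P ε f w) (d := w ω) hκ hL0 hε (hX.tame ω) (fun t => hasDerivAt_const t 1)
    (fun _ => zero_le_one) h1.continuousOn (fun t ht => contDiff_infty.1 (h1.contDiff_space t ht) 2)
    (fun t ht x => (h2 t ht.1 x).congr_deriv (by ring))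
    (fun t ht x => hw.neg_div_le_meanCoeff hε hL ht.1.le x) (by simp)
    (fun x => by rw [h3 x, one_mul]) h4 t ht x
  simpa using this

/-- Closeness of the coefficients makes the solutions close. -/
lemma IsSolution.ae_abs_sub_le {v : NNReal} (hX : IsTameField P v X)
    {w w' : Ω → ℝ → Plane → ℝ} (hw : IsSolution P m ε f X w) (hw' : IsSolution P m ε f X w')
    (hε : 0 < ε) (hε₁ : ε < 1) {L : ℝ} (hL0 : 0 ≤ L)
    (hL : ∀ r > 0, ∀ u, -(L / r) ≤ deriv (f r) u) {T N b : ℝ} (hN : 0 ≤ N) (hb : 0 < b)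
    (hclose : ∀ t ∈ Set.Icc 0 T, ∀ x,
      |meanCoeff P ε f w t x - meanCoeff P ε f w' t x| ≤ N * Real.exp (b * t)) :
    ∀ᵐ ω ∂P, ∀ t ∈ Set.Icc 0 T, ∀ x, |w ω t x - w' ω t x|
      ≤ 1 / Real.log ε⁻¹ * N / b * Real.exp (b * t)
        * majorant (1 / Real.log ε⁻¹) L ε m (X ω) t x := by
  have hκ : 0 ≤ 1 / Real.log ε⁻¹ :=
    one_div_nonneg.2 (Real.log_nonneg ((one_le_inv₀ hε).2 hε₁.le))
  set κ := 1 / Real.log ε⁻¹ with hκdef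
  filter_upwards [hw.regular, hw.hasDerivAt, hw.initial, hw.growth, hw'.regular, hw'.hasDerivAt,
    hw'.initial, hw'.growth, hw'.ae_abs_le_majorant hX hε hε₁ hL0 hL T]
    with ω r1 d1 i1 g1 r2 d2 i2 g2 hmaj
  have hφ : ∀ t, HasDerivAt (fun t => κ * N / b * Real.exp (b * t)) (κ * N * Real.exp (b * t)) t :=
    fun t => ((((hasDerivAt_id t).const_mul b).exp).const_mul (κ * N / b)).congr_deriv (by
      simp only [id]; field_simp)
  -- The difference solves the linear equation of `w` with forcing `-κ` times the difference of the
  -- coefficients times `w'`. As `w'` lies below the majorant, `φ' = κN e^{bt}` suffices, and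
  -- integrating the exponential gains the factor `1/b`.
  refine abs_le_mul_majorant (T := T) (φ := fun t => κ * N / b * Real.exp (b * t))
    (φ' := fun t => κ * N * Real.exp (b * t))
    (r := fun t x => -(κ * (meanCoeff P ε f w t x - meanCoeff P ε f w' t x) * w' ω t x))
    (α := meanCoeff P ε f w) (d := fun t x => w ω t x - w' ω t x) hκ hL0 hε (hX.tame ω) hφ
    (fun t => by positivity) (r1.continuousOn.sub r2.continuousOn) (fun t ht => ?_)
    (fun t ht x => ?_) (fun t ht x => hw.neg_div_le_meanCoeff hε hL ht.1.le x) (fun t ht x => ?_)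
    (fun x => ?_) ?_
  · exact (contDiff_infty.1 (r1.contDiff_space t ht) 2).sub
      (contDiff_infty.1 (r2.contDiff_space t ht) 2)
  · have hlap : (Δ (fun x => w ω t x - w' ω t x)) x = (Δ (w ω t)) x - (Δ (w' ω t)) x :=
      (contDiff_infty.1 (r1.contDiff_space t ht.1) 2).contDiffAt.laplacian_sub
        (contDiff_infty.1 (r2.contDiff_space t ht.1) 2).contDiffAt
    refine ((d1 t ht.1 x).sub (d2 t ht.1 x)).congr_deriv ?_
    rw [hlap]
    ring
  · have ht' := Set.Ioc_subset_Icc_self ht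
    rw [abs_neg, abs_mul, abs_mul, abs_of_nonneg hκ]
    have := mul_le_mul (hclose t ht' x) (hmaj t ht' x) (abs_nonneg _) (by positivity)
    calc κ * |meanCoeff P ε f w t x - meanCoeff P ε f w' t x| * |w' ω t x|
        = κ * (|meanCoeff P ε f w t x - meanCoeff P ε f w' t x| * |w' ω t x|) := by ring
      _ ≤ κ * (N * Real.exp (b * t) * majorant κ L ε m (X ω) t x) :=
        mul_le_mul_of_nonneg_left this hκ
      _ = _ := by ring
  · rw [i1 x, i2 x, sub_self, abs_zero]
    positivity
  · intro S
    obtain ⟨a₁, ha₁, C₁, h₁⟩ := g1 S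
    obtain ⟨a₂, ha₂, C₂, h₂⟩ := g2 S
    refine ⟨max a₁ a₂, lt_max_of_lt_left ha₁, |C₁| + |C₂|, fun t ht x => ?_⟩
    have e1 : Real.exp (a₁ * ‖x‖) ≤ Real.exp (max a₁ a₂ * ‖x‖) :=
      Real.exp_le_exp.2 (mul_le_mul_of_nonneg_right (le_max_left _ _) (norm_nonneg x))
    have e2 : Real.exp (a₂ * ‖x‖) ≤ Real.exp (max a₁ a₂ * ‖x‖) :=
      Real.exp_le_exp.2 (mul_le_mul_of_nonneg_right (le_max_right _ _) (norm_nonneg x))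
    have b1 := (h₁ t ht x).trans (mul_le_mul (le_abs_self C₁) e1 (Real.exp_nonneg _) (abs_nonneg _))
    have b2 := (h₂ t ht x).trans (mul_le_mul (le_abs_self C₂) e2 (Real.exp_nonneg _) (abs_nonneg _))
    calc |w ω t x - w' ω t x| ≤ |w ω t x| + |w' ω t x| := abs_sub _ _
      _ ≤ _ := by rw [add_mul]; exact add_le_add b1 b2

/-- Two solutions of the McKean–Vlasov equation coincide on bounded time intervals. -/
lemma IsSolution.ae_eq_on_Icc {v : NNReal} (hX : IsTameField P v X)
    {w w' : Ω → ℝ → Plane → ℝ} (hw : IsSolution P m ε f X w) (hw' : IsSolution P m ε f X w')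
    (hε : 0 < ε) (hε₁ : ε < 1) (hf : MemSbar f) (T : ℝ) :
    ∀ᵐ ω ∂P, ∀ t ∈ Set.Icc 0 T, ∀ x, w ω t x = w' ω t x := by
  obtain ⟨n, hD⟩ := hf.exists_tameCoeff
  obtain ⟨L, hL0, hL⟩ := hf.exists_neg_div_le_deriv
  obtain ⟨C, hC, hp⟩ := hD.exists_polyLip hε T
  set κ := 1 / Real.log ε⁻¹ with hκdef
  have hκ : 0 ≤ κ := one_div_nonneg.2 (Real.log_nonneg ((one_le_inv₀ hε).2 hε₁.le))
  obtain ⟨M, hM, hMb⟩ := exists_majorant_le κ L m hε X T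
  have bound : ∀ {u : Ω → ℝ → Plane → ℝ}, IsSolution P m ε f X u → ∀ t ∈ Set.Icc 0 T, ∀ x,
      ∀ᵐ ω ∂P, |u ω t x| ≤ M * absAverage X t x ω := fun hu t ht x => by
    filter_upwards [hu.ae_abs_le_majorant hX hε hε₁ hL0 hL T] with ω h
    exact (h t ht x).trans (hMb t ht x ω)
  set K := C * (1 + 2 * M) ^ n * M * gaussMoment v (n + 1) with hK
  have hK0 : 0 ≤ K := mul_nonneg (by positivity) (integral_nonneg fun z => by positivity)
  have improve : ∀ ρ ≥ 0, ∀ t ∈ Set.Icc 0 T, ∀ x,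
      (∀ᵐ ω ∂P, |w ω t x - w' ω t x| ≤ ρ * (M * absAverage X t x ω)) →
      |meanCoeff P ε f w t x - meanCoeff P ε f w' t x| ≤ ρ * K := fun ρ hρ t ht x h =>
    hX.abs_integral_sub_le hC hM hρ (hp t ht) (bound hw t ht x) (bound hw' t ht x) h
      (hw.integrable t ht.1 x) (hw'.integrable t ht.1 x)
  -- With this weight one round of the estimate multiplies the bound by `κK/b ≤ 1/2`.
  set b := 2 * κ * K + 1 with hb
  have hb0 : 0 < b := by positivity
  have iter : ∀ k : ℕ, ∀ t ∈ Set.Icc 0 T, ∀ x,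
      |meanCoeff P ε f w t x - meanCoeff P ε f w' t x| ≤ 2 * K / 2 ^ k * Real.exp (b * t) := by
    intro k
    induction k with
    | zero =>
      intro t ht x
      -- The iteration starts from the a priori bound: both solutions lie below the majorant, so
      -- they differ by at most twice it.
      have h1 := improve 2 (by norm_num) t ht x (by
        filter_upwards [bound hw t ht x, bound hw' t ht x] with ω h1 h2
        calc |w ω t x - w' ω t x| ≤ |w ω t x| + |w' ω t x| := abs_sub _ _
          _ ≤ _ := by linarith)
      refine h1.trans ?_
      rw [pow_zero, div_one]
      exact le_mul_of_one_le_right (by positivity)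
        (Real.one_le_exp (mul_nonneg hb0.le ht.1))
    | succ k ih =>
      have hN : 0 ≤ 2 * K / 2 ^ k := by positivity
      have h1 := hw.ae_abs_sub_le hX hw' hε hε₁ hL0 hL hN hb0 ih
      intro t ht x
      have hρ : 0 ≤ κ * (2 * K / 2 ^ k) / b * Real.exp (b * t) := by positivity
      refine (improve _ hρ t ht x ?_).trans ?_
      · filter_upwards [h1] with ω h
        exact (h t ht x).trans (mul_le_mul_of_nonneg_left (hMb t ht x ω) hρ)
      · have h2 : κ * K / b ≤ 1 / 2 := by
          rw [div_le_div_iff₀ hb0 two_pos]; linarith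
        calc κ * (2 * K / 2 ^ k) / b * Real.exp (b * t) * K
            = κ * K / b * (2 * K / 2 ^ k * Real.exp (b * t)) := by ring
          _ ≤ 1 / 2 * (2 * K / 2 ^ k * Real.exp (b * t)) :=
            mul_le_mul_of_nonneg_right h2 (by positivity)
          _ = _ := by rw [pow_succ]; field_simp
  have hzero : ∀ t ∈ Set.Icc 0 T, ∀ x,
      |meanCoeff P ε f w t x - meanCoeff P ε f w' t x| ≤ 0 * Real.exp (b * t) := by
    intro t ht x
    rw [zero_mul]
    have hlim : Filter.Tendsto (fun k : ℕ => 2 * K * Real.exp (b * t) * (1 / 2 : ℝ) ^ k)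
        Filter.atTop (nhds (2 * K * Real.exp (b * t) * 0)) :=
      (tendsto_pow_atTop_nhds_zero_of_lt_one (by norm_num) (by norm_num)).const_mul _
    rw [mul_zero] at hlim
    refine ge_of_tendsto' hlim fun k => (iter k t ht x).trans_eq ?_
    rw [one_div, inv_pow]; ring
  filter_upwards [hw.ae_abs_sub_le hX hw' hε hε₁ hL0 hL le_rfl hb0 hzero] with ω h t ht x
  have := h t ht x
  simp only [mul_zero, zero_div, zero_mul] at this
  exact sub_eq_zero.1 (abs_nonpos_iff.1 this)

/-- Uniqueness of solutions of the McKean–Vlasov equation. -/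
theorem IsSolution.ae_eq {v : NNReal} (hX : IsTameField P v X)
    {w w' : Ω → ℝ → Plane → ℝ} (hw : IsSolution P m ε f X w) (hw' : IsSolution P m ε f X w')
    (hε : 0 < ε) (hε₁ : ε < 1) (hf : MemSbar f) :
    ∀ᵐ ω ∂P, ∀ t ≥ 0, ∀ x, w ω t x = w' ω t x := by
  filter_upwards [ae_all_iff.2 fun k : ℕ => hw.ae_eq_on_Icc hX hw' hε hε₁ hf k] with ω h t ht x
  obtain ⟨k, hk⟩ := exists_nat_ge t
  exact h k t ⟨ht, hk⟩ x

end Uniqueness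

/-! ### The explicit solution -/

lemma TameCoeff.abs {n : ℕ} {D : ℝ → ℝ → ℝ} (hD : TameCoeff n D) :
    TameCoeff n fun r u => |D r u| where
  continuousOn := hD.continuousOn.abs
  polyLip r₀ hr₀ R := by
    obtain ⟨C, hC, h⟩ := hD.polyLip r₀ hr₀ R
    refine ⟨C, hC, fun r hr u u' => ⟨?_, (abs_abs_sub_abs_le _ _).trans (h r hr u u').2⟩⟩
    rw [abs_abs]
    exact (h r hr u u').1

section Existence

variable {Ω : Type*} [MeasurableSpace Ω] {P : Measure Ω} [IsProbabilityMeasure P]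
  {η : Ω → 𝓢(Plane, ℝ) →L[ℝ] ℝ}

/-- By the product rule the heat flow supplies the linear part and the scalar equation the nonlinear
one. The rate is only continuous, so `σ` is merely `C¹`, which is all that is required in time. -/
lemma isSolution_mul_heatFlow (hη : IsWhiteNoise P η) (m : ℝ) {ε : ℝ} (hε : 0 < ε) {n : ℕ}
    {f : ℝ → ℝ → ℝ} (hD : TameCoeff n fun r => deriv (f r)) {σ : ℝ → ℝ} (h0 : σ 0 = 1)
    (hσ : ∀ t ∈ Set.Ici 0, HasDerivWithinAt σ (-(1 / Real.log ε⁻¹)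
      * gaussRate (fun r => deriv (f r)) m ε t (σ t) * σ t) (Set.Ici 0) t) :
    IsSolution P m ε f (fun ω => mollify ε hε (η ω))
      (fun ω t x => σ t * heatFlow m t (mollify ε hε (η ω)) x) := by
  have hσc : ContinuousOn σ (Set.Ici 0) := fun t ht => (hσ t ht).continuousWithinAt
  have hσd : ∀ t > 0, HasDerivAt σ (-(1 / Real.log ε⁻¹)
      * gaussRate (fun r => deriv (f r)) m ε t (σ t) * σ t) t := fun t ht =>
    (hσ t (Set.mem_Ici.2 ht.le)).hasDerivAt (Ici_mem_nhds ht)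
  have hσ1 : ContDiffOn ℝ 1 σ (Set.Ioi 0) := by
    have hc : ContinuousOn (fun t => -(1 / Real.log ε⁻¹)
        * gaussRate (fun r => deriv (f r)) m ε t (σ t) * σ t) (Set.Ici 0) :=
      (continuousOn_const.mul ((hD.isRate_gaussRate m hε).continuousOn.comp
        (f := fun t => (t, σ t)) (continuousOn_id.prodMk hσc)
        fun t ht => ⟨ht, Set.mem_univ _⟩)).mul hσc
    have := contDiffOn_succ_of_hasDerivAt (n := 0) hσd
      (contDiffOn_zero.2 (hc.mono Set.Ioi_subset_Ici_self))
    simpa using this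
  have hbdd : ∀ T, ∃ S, ∀ t ∈ Set.Icc 0 T, |σ t| ≤ S := fun T =>
    isCompact_Icc.exists_bound_of_continuousOn (hσc.mono fun t ht => ht.1)
  have tame : ∀ ω, TameFun (mollify ε hε (η ω)) := fun ω => tameFun_mollify ε hε (η ω)
  constructor
  · exact fun t ht x => (hη.hasLaw_heatFlow hε m ht x).aemeasurable.const_mul _
  · exact ae_of_all _ fun ω => (tame ω).isRegular_mul_heatFlow m hσc hσ1
  · exact ae_of_all _ fun ω x => by simp [h0, heatFlow]
  · exact fun t ht x => hη.integrable_coeff hε m hD ht (σ t) x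
  · refine ae_of_all _ fun ω t ht x => ?_
    refine ((hσd t ht).mul ((tame ω).hasDerivAt_heatFlow m ht x)).deriv.trans ?_
    rw [laplacian_const_mul (contDiff_infty.1 ((tame ω).contDiff_heatFlow m ht) 2),
      hη.integral_coeff hε m hD ht.le (σ t) x]
    ring
  · refine ae_of_all _ fun ω T => ?_
    obtain ⟨S, hS⟩ := hbdd T
    obtain ⟨a, ha, C, hC⟩ := (tame ω).expGrowth_heatFlow m T
    refine ⟨a, ha, |S| * C, fun t ht x => ?_⟩
    rw [abs_mul, mul_assoc]
    exact mul_le_mul ((hS t ht).trans (le_abs_self S)) (hC t ht x) (abs_nonneg _) (abs_nonneg _)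
  · intro T
    obtain ⟨S, hS⟩ := hbdd T
    obtain ⟨A, hA, hb⟩ := (hD.abs.isRate_gaussRate m hε).bounded T S
    -- The expectation of `|f'|` is a rate too, hence free of `x` and bounded on `[0, T]`; any
    -- positive exponent serves.
    refine ⟨1, one_pos, A, fun t ht x => ?_⟩
    refine (congrArg abs (hη.integral_coeff hε m hD.abs ht.1 (σ t) x)).trans_le ?_
    exact (hb t ht (σ t) (hS t ht)).trans
      (le_mul_of_one_le_right hA (Real.one_le_exp (by positivity)))

end Existence

/-- A solution of the ordinary differential equation is smooth in the self-similar case. -/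
lemma contDiffOn_of_selfSimilar {f : ℝ → ℝ → ℝ} (hf : MemSbar f) (m κ : ℝ) {ε : ℝ} (hε : 0 < ε)
    {F : ℝ → ℝ} (hF : ∀ t > 0, ∀ u, f t u = t ^ (-(3 / 2) : ℝ) * F (Real.sqrt t * u))
    {σ : ℝ → ℝ} (hpos : ∀ t > 0, 0 < σ t)
    (hσ : ∀ t > 0, HasDerivAt σ (-κ * gaussRate (fun r => deriv (f r)) m ε t (σ t) * σ t) t) :
    ContDiffOn ℝ (⊤ : ℕ∞) σ (Set.Ioi 0) := by
  obtain ⟨A, hA, hAeq⟩ := gaussRate_selfSimilar hf m hε hF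
  rw [contDiffOn_infty]
  intro n
  induction n with
  | zero =>
    exact contDiffOn_zero.2 fun t ht => (hσ t ht).continuousAt.continuousWithinAt
  | succ n ih =>
    -- Bootstrap: if `σ` is `C^n`, so is the right-hand side. Positivity of `σ` keeps the argument
    -- of `A` in the half-line where `A` is smooth.
    refine contDiffOn_succ_of_hasDerivAt hσ ?_
    have h1 : ContDiffOn ℝ n (fun t : ℝ => (t + ε ^ 2)⁻¹) (Set.Ioi 0) :=
      ContDiffOn.inv (by fun_prop) fun t ht => by
        have : 0 < t := ht
        positivity
    have h2 : ContDiffOn ℝ n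
        (fun t => A (σ t * (Real.exp (m * t) * Real.sqrt (1 / (4 * Real.pi))))) (Set.Ioi 0) := by
      refine (hA.of_le (by exact_mod_cast le_top)).comp (ih.mul (by fun_prop)) fun t ht => ?_
      have := hpos t ht
      simp only [Set.mem_Ioi]
      positivity
    refine ((contDiffOn_const (c := -κ)).mul (h1.mul h2) |>.mul ih).congr fun t ht => ?_
    rw [hAeq t (le_of_lt ht)]

/-- The `3` is `1 + 2`: `log(t+ε²)` is at most `log ε⁻¹`, and `-log ε²` is `2 log ε⁻¹`. -/
lemma growthFactor_le_exp {ε t L : ℝ} (hε : 0 < ε) (hε₁ : ε < 1) (hL : 0 ≤ L) (ht : 0 ≤ t)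
    (h : t + ε ^ 2 ≤ ε⁻¹) : growthFactor (1 / Real.log ε⁻¹) L ε t ≤ Real.exp (3 * L) := by
  have hlog : 0 < Real.log ε⁻¹ := Real.log_pos ((one_lt_inv₀ hε).2 hε₁)
  have h1 : Real.log (t + ε ^ 2) ≤ Real.log ε⁻¹ := Real.log_le_log (by positivity) h
  have h2 : Real.log (ε ^ 2) = -(2 * Real.log ε⁻¹) := by
    rw [Real.log_pow, Real.log_inv]; push_cast; ring
  refine Real.exp_le_exp.2 ?_
  rw [h2]
  calc 1 / Real.log ε⁻¹ * L * (Real.log (t + ε ^ 2) - -(2 * Real.log ε⁻¹))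
      ≤ 1 / Real.log ε⁻¹ * L * (3 * Real.log ε⁻¹) :=
        mul_le_mul_of_nonneg_left (by linarith) (by positivity)
    _ = 3 * L * (Real.log ε⁻¹ / Real.log ε⁻¹) := by ring
    _ = 3 * L := by rw [div_self hlog.ne', mul_one]

end McKeanVlasov

end

/-! ### The main theorem -/

open McKeanVlasov in
theorem lemma2p3 {Ω : Type*} [MeasurableSpace Ω] (P : Measure Ω) [IsProbabilityMeasure P]
    (η : Ω → 𝓢(Plane, ℝ) →L[ℝ] ℝ) (hη : IsWhiteNoise P η)
    (m ε : ℝ) (hε : 0 < ε) (hε₁ : ε < 1) (f : ℝ → ℝ → ℝ) (hf : MemSbar f) :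
    -- the expectation in the ordinary differential equation makes sense
    (∀ t ≥ 0, ∀ (s : ℝ) (x : Plane), Integrable
      (fun ω => deriv (f (t + ε ^ 2)) (s * heatFlow m t (mollify ε hε (η ω)) x)) P) ∧
    ∃ σ : ℝ → ℝ,
      -- `σ` is a global solution, whatever the point `x` in the equation
      (∀ x, SolvesODE P m ε f (fun ω => mollify ε hε (η ω)) x (Set.Ici 0) σ) ∧
      -- it is the only one, also among solutions on bounded time intervals
      (∀ (x : Plane) (T : ℝ) (τ : ℝ → ℝ),
        SolvesODE P m ε f (fun ω => mollify ε hε (η ω)) x (Set.Icc 0 T) τ →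
          Set.EqOn τ σ (Set.Icc 0 T)) ∧
      -- bounds
      (∀ t ≥ 0, 0 < σ t) ∧
      (∀ (L₁ L₂ γ₁ γ₂ l₁ l₂ : ℝ) (f₁ f₂ : ℝ → ℝ → ℝ),
        MemSbar₁ L₁ L₂ f₁ → MemSbar₂ γ₁ γ₂ l₁ l₂ f₂ →
        (∀ t > 0, ∀ u, f t u = f₁ t u + f₂ t u) →
        ∀ t ≥ 0, σ t ≤ Real.exp (L₁ / Real.log ε⁻¹ * ∫ s in (0 : ℝ)..t, 1 / (s + ε ^ 2)) ∧
          (t + ε ^ 2 ≤ ε⁻¹ → σ t ≤ Real.exp (3 * L₁))) ∧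
      -- `σ(t) (G^m_t * η_ε)(x)` solves the McKean–Vlasov equation
      IsSolution P m ε f (fun ω => mollify ε hε (η ω))
        (fun ω t x => σ t * heatFlow m t (mollify ε hε (η ω)) x) ∧
      -- and it is the only solution
      (∀ w : Ω → ℝ → Plane → ℝ, IsSolution P m ε f (fun ω => mollify ε hε (η ω)) w →
        ∀ᵐ ω ∂P, ∀ t ≥ 0, ∀ x, w ω t x = σ t * heatFlow m t (mollify ε hε (η ω)) x) ∧
      -- in the self-similar case it is jointly smooth
      ((∃ F : ℝ → ℝ, ∀ t > 0, ∀ u, f t u = t ^ (-(3 / 2) : ℝ) * F (Real.sqrt t * u)) →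
        ∀ᵐ ω ∂P, ContDiffOn ℝ (⊤ : ℕ∞)
          (fun p : ℝ × Plane => σ p.1 * heatFlow m p.1 (mollify ε hε (η ω)) p.2)
          (Set.Ioi 0 ×ˢ Set.univ)) := by
  have hlog : 0 < Real.log ε⁻¹ := Real.log_pos ((one_lt_inv₀ hε).2 hε₁)
  have hκ : 0 ≤ 1 / Real.log ε⁻¹ := by positivity
  obtain ⟨n, hD⟩ := hf.exists_tameCoeff
  obtain ⟨L, hL0, hL⟩ := hf.exists_neg_div_le_deriv
  have hrate := hD.isRate_gaussRate m hε
  -- For existence the crude lower bound `-L/ε²`, uniform in time, is enough.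
  obtain ⟨σ, h0, hpos, hσ⟩ := hrate.exists_global hκ (B := L / ε ^ 2) (by positivity)
    fun t ht s => (neg_le_neg (div_le_div_of_nonneg_left hL0 (by positivity) (by linarith))).trans
      (hD.neg_div_le_gaussRate m hε hL ht s)
  have hode : ∀ (x : Plane) (I : Set ℝ) (τ : ℝ → ℝ), I ⊆ Set.Ici 0 →
      (SolvesODE P m ε f (fun ω => mollify ε hε (η ω)) x I τ ↔ τ 0 = 1 ∧ ∀ t ∈ I,
        HasDerivWithinAt τ (-(1 / Real.log ε⁻¹)
          * gaussRate (fun r => deriv (f r)) m ε t (τ t) * τ t) I t) := fun x I τ hI =>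
    and_congr_right fun _ => forall₂_congr fun t ht => by
      rw [hη.integral_coeff hε m hD (hI ht) (τ t) x]
  have hsol := isSolution_mul_heatFlow hη m hε hD h0 hσ
  have hσd : ∀ t > 0, HasDerivAt σ (-(1 / Real.log ε⁻¹)
      * gaussRate (fun r => deriv (f r)) m ε t (σ t) * σ t) t := fun t ht =>
    (hσ t (Set.mem_Ici.2 ht.le)).hasDerivAt (Ici_mem_nhds ht)
  refine ⟨fun t ht s x => hη.integrable_coeff hε m hD ht s x, σ,
    fun x => (hode x _ σ subset_rfl).2 ⟨h0, hσ⟩, fun x T τ hτ => ?_, hpos,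
    fun L₁ L₂ γ₁ γ₂ l₁ l₂ f₁ f₂ hf₁ hf₂ hsum t ht => ?_, hsol,
    fun w hw => hw.ae_eq (hη.isTameField hε) hsol hε hε₁ hf, ?_⟩
  · have hsub : Set.Icc 0 T ⊆ Set.Ici 0 := fun t ht => ht.1
    obtain ⟨hτ0, hτd⟩ := (hode x _ τ hsub).1 hτ
    exact hrate.eqOn _ (hτ0.trans h0.symm) hτd fun t ht => (hσ t (hsub ht)).mono hsub
  -- `σ` was built without reference to the given decomposition, so each decomposition bounds the
  -- same `σ` with its own `L₁`.
  · have hle := le_growthFactor hκ hε h0 hpos (fun t ht => hD.neg_div_le_gaussRate m hε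
      (fun r hr u => neg_div_le_deriv hf₁ hf₂ hsum hr u) ht (σ t)) hσ t ht
    refine ⟨hle.trans_eq ?_, fun h => hle.trans (growthFactor_le_exp hε hε₁ hf₁.L₁_nonneg ht h)⟩
    rw [growthFactor_eq_exp_integral _ _ hε ht, one_div_mul_eq_div]
  · rintro ⟨F, hF⟩
    have hs := contDiffOn_of_selfSimilar hf m _ hε hF (fun t ht => hpos t ht.le) hσd
    exact Filter.Eventually.of_forall fun ω =>
      ContDiffOn.mul (hs.comp (f := Prod.fst) contDiffOn_fst fun p hp => hp.1)
        ((tameFun_mollify ε hε (η ω)).contDiffOn_heatFlow m)
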